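/- **Setting.** Graphs are finite multigraphs $G=(V,E)$ (loops and parallel edges allowed) with $n$ vertices and $m$ edges, with a fixed arbitrary orientation of the edges. For an integer $q\ge 2$ and $w>0$ the Potts measure on colourings $\sigma:V\to[q]$ is $\mu_{\mathrm{Potts},G;q,w}(\sigma)=w^{m(\sigma)}/\sum_{\tau:V\to[q]}w^{m(\tau)}$, where $m(\tau)$ is the number of edges whose endpoints have the same colour under $\tau$. A set $C\subseteq E$ is even if all degrees in $(V,C)$ are even (a loop counts twice); its signed indicator vector $\chi_C\in\mathbb Z^E$, for a chosen Eulerian orientation of $C$, is $0$ off $C$, and is $1$ or $-1$ on an edge of $C$ according to whether this orientation agrees with that of $G$ or not. An even generating set of $G$ is a finite family $\mathcal C$ of even subgraphs, with chosen vectors $\chi_C$, such that these vectors generate the $\mathbb Z$-module of all $\mathbb Z$-flows $E\to\mathbb Z$. Let - $d(\mathcal C)=\max_{C\in\mathcal C}|\{D\in\mathcal C\setminus\{C\}: C\cap D\ne\emptyset\}|$, - $\iota(\mathcal C)=\max\{|C_1\cap C_2|: C_1,C_2\in\mathcal C,\ C_1\neq C_2\}$, - $\ell(\mathcal C)=\max_{C\in\mathcal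 C}|C|$, - $s(\mathcal C)=\max_{e\in E}|\{C\in\mathcal C: e\in C\}|$, where a maximum over the empty set is $0$. Algorithms are programs for a randomised unit-cost RAM, with arrays of natural numbers (addition, truncated subtraction, comparison, indirect addressing) and arrays of real numbers (conversion from natural numbers, $+,-,\times,/$, comparison); one further instruction chooses a random index $j<t$ with probability proportional to the $j$-th entry of a real array. Every elementary operation, and every such random choice, costs one unit of time. The input consists of $G$, an even generating set $\mathcal C$ of $G$ (with the vectors $\chi_C$, each listed by its support and signs), and the real numbers $w$ and $\delta$. A program is a $\delta$-approximate sampler for $\mu$ with running time $T$ on an input if it always stops within time $T$, always outputs a colouring $V\to[q]$, and the law of its output is within total variation distance $\delta$ of $\mu$. **Theorem.** Let $q\ge 2$ be an integer. (i) Let $d\ge 2$, $\iota\ge 1$ and $\kappa\ge 0$ be integers, and let $w>\frac{(d+1)\iota}{2}q-(q-1)$ be real. There are a program and a constant $K$ such that for all $\delta\in(0,1)$, all graphs $G$ with $n$ vertices and $m$ edges and all even generating sets $\mathcal C$ of $G$ with $|\mathcal C|\le\kappa m$, $d(\mathcal C)\le d$ and $\iota(\mathcal C)\le\iota$, the program on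 this input is a $\delta$-approximate sampler for $\mu_{\mathrm{Potts},G;q,w}$ with running time at most $K\,(1+n+m^2\log(m\delta^{-1}))$ (where $m^2\log(m\delta^{-1})$ is read as $0$ for $m=0$), and at most $K\,m^2\log(m\delta^{-1})$ if $m\ge 2$ and $G$ has no isolated vertices. (ii) Let $\ell\ge 3$, $s\ge 2$ and $\kappa\ge 0$ be integers, and let $w>(q-1)(\ell s-1)$ be real. There are a program and a constant $K$ such that for all $\delta\in(0,1)$, all graphs $G$ with $n$ vertices and $m$ edges and all even generating sets $\mathcal C$ of $G$ with $|\mathcal C|\le\kappa m$, $\ell(\mathcal C)\le\ell$ and $s(\mathcal C)\le s$, the program on this input is a $\delta$-approximate sampler for $\mu_{\mathrm{Potts},G;q,w}$ with running time at most $K\,(1+n+m\log(m\delta^{-1}))$ (where $m\log(m\delta^{-1})$ is read as $0$ for $m=0$), and at most $K\,m\log(m\delta^{-1})$ if $m\ge 2$ and $G$ has no isolated vertices. -/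

import Mathlib

/-! ### Multigraphs, the Potts measure, flows and even generating sets -/

/-- A finite multigraph with vertex set `Fin n` and edge set `Fin m` (loops and parallel edges are
allowed), together with a fixed orientation: the edge `e` is directed from `src e` to `tgt e`. -/
structure Multigraph (n m : ℕ) where
  src : Fin m → Fin n
  tgt : Fin m → Fin n

namespace Multigraph

variable {n m : ℕ}

/-- Every vertex is an endpoint of some edge. -/
def NoIsolatedVertex (G : Multigraph n m) : Prop :=
  ∀ v : Fin n, ∃ e : Fin m, G.src e = v ∨ G.tgt e = v

/-- The number of edges whose endpoints have the same colour. -/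
def monoEdges (G : Multigraph n m) {q : ℕ} (σ : Fin n → Fin q) : ℕ :=
  (Finset.univ.filter fun e : Fin m => σ (G.src e) = σ (G.tgt e)).card

/-- The Potts partition function. -/
noncomputable def pottsZ (G : Multigraph n m) (q : ℕ) (w : ℝ) : ℝ :=
  ∑ τ : Fin n → Fin q, w ^ G.monoEdges τ

/-- The Gibbs measure of the `q`-state Potts model with interaction parameter `w`. -/
noncomputable def potts (G : Multigraph n m) (q : ℕ) (w : ℝ) (σ : Fin n → Fin q) : ℝ :=
  w ^ G.monoEdges σ / G.pottsZ q w

/-- The `ℤ`-module of `ℤ`-flows (the cycle space). -/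
def flows (G : Multigraph n m) : Submodule ℤ (Fin m → ℤ) where
  carrier := {f | ∀ v : Fin n,
    ∑ e ∈ Finset.univ.filter (fun e => G.tgt e = v), f e =
      ∑ e ∈ Finset.univ.filter (fun e => G.src e = v), f e}
  zero_mem' := by intro v; simp
  add_mem' := by
    intro f g hf hg v
    simp only [Pi.add_apply, Finset.sum_add_distrib, hf v, hg v]
  smul_mem' := by
    intro c f hf v
    simp only [Pi.smul_apply, smul_eq_mul, ← Finset.mul_sum, hf v]

/-- The degree of `v` in the subgraph with edge set `C`; a loop counts twice. -/
def degIn (G : Multigraph n m) (C : Finset (Fin m)) (v : Fin n) : ℕ :=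
  (C.filter fun e => G.src e = v).card + (C.filter fun e => G.tgt e = v).card

/-- All degrees of the subgraph with edge set `C` are even. -/
def IsEven (G : Multigraph n m) (C : Finset (Fin m)) : Prop :=
  ∀ v, Even (G.degIn C v)

/-- `χ` is the signed indicator vector of `C` for some Eulerian orientation of `C`: it vanishes
off `C`; an edge `e` of `C` keeps its direction if `χ e = 1` and is reversed if `χ e = -1`; and in
this orientation of `C` every vertex has as many incoming as outgoing edges. -/
def IsSignedIndicator (G : Multigraph n m) (C : Finset (Fin m)) (χ : Fin m → ℤ) : Prop :=
  (∀ e, e ∉ C → χ e = 0) ∧ (∀ e ∈ C, χ e = 1 ∨ χ e = -1) ∧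
    ∀ v, (C.filter fun e => (if χ e = 1 then G.tgt e else G.src e) = v).card =
      (C.filter fun e => (if χ e = 1 then G.src e else G.tgt e) = v).card

end Multigraph

/-- An even generating set of the cycle space of `G`, enumerated as `C 0, …, C (r-1)`, with the
chosen signed indicator vectors. -/
structure EvenGeneratingSet {n m : ℕ} (G : Multigraph n m) (r : ℕ) where
  C : Fin r → Finset (Fin m)
  χ : Fin r → Fin m → ℤ
  even : ∀ i, G.IsEven (C i)
  indicator : ∀ i, G.IsSignedIndicator (C i) (χ i)
  span_eq : Submodule.span ℤ (Set.range χ) = G.flows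

namespace EvenGeneratingSet

variable {n m r : ℕ} {G : Multigraph n m}

/-- The largest number of other members that a member meets in at least one edge. -/
def d (S : EvenGeneratingSet G r) : ℕ :=
  Finset.univ.sup fun i : Fin r =>
    (Finset.univ.filter fun j : Fin r => j ≠ i ∧ (S.C i ∩ S.C j).Nonempty).card

/-- The largest number of edges in the intersection of two different members. -/
def iota (S : EvenGeneratingSet G r) : ℕ :=
  (Finset.univ.filter fun p : Fin r × Fin r => p.1 ≠ p.2).sup fun p =>
    (S.C p.1 ∩ S.C p.2).card

/-- The largest number of edges of a member. -/
def ell (S : EvenGeneratingSet G r) : ℕ :=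
  Finset.univ.sup fun i : Fin r => (S.C i).card

/-- The largest number of members that contain a given edge. -/
def s (S : EvenGeneratingSet G r) : ℕ :=
  Finset.univ.sup fun e : Fin m => (Finset.univ.filter fun i : Fin r => e ∈ S.C i).card

/-- All pairs `(i, e)` with `e ∈ C i`, ordered by `i`, then by `e`. -/
def incidences (S : EvenGeneratingSet G r) : List (Fin r × Fin m) :=
  (List.finRange r).flatMap fun i =>
    ((List.finRange m).filter fun e => e ∈ S.C i).map fun e => (i, e)

end EvenGeneratingSet

/-! ### A randomised unit-cost RAM

The memory consists of arrays of natural numbers and arrays of real numbers. A program is a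
while-program; it names finitely many arrays and addresses their cells by computed indices. Its
text contains natural number constants only. Each elementary operation takes one unit of time. -/

namespace RAM

/-- The contents of the memory: `nat a i` and `real a i` are the `i`-th cells of the natural and
of the real array number `a`. -/
structure Mem where
  nat : ℕ → ℕ → ℕ
  real : ℕ → ℕ → ℝ

/-- Write `x` to cell `i` of the natural array `a`. -/
def Mem.setNat (M : Mem) (a i x : ℕ) : Mem :=
  { M with nat := Function.update M.nat a (Function.update (M.nat a) i x) }

/-- Write `x` to cell `i` of the real array `a`. -/
def Mem.setReal (M : Mem) (a i : ℕ) (x : ℝ) : Mem :=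
  { M with real := Function.update M.real a (Function.update (M.real a) i x) }

/-- Expressions of natural number type; `get a i` reads cell `i` of array `a`, and `sub` is
truncated subtraction. -/
inductive NExp where
  | const (k : ℕ)
  | get (a : ℕ) (i : NExp)
  | add (x y : NExp)
  | sub (x y : NExp)

def NExp.eval (M : Mem) : NExp → ℕ
  | .const k => k
  | .get a i => M.nat a (i.eval M)
  | .add x y => x.eval M + y.eval M
  | .sub x y => x.eval M - y.eval M

/-- The number of elementary operations in an expression. -/
def NExp.cost : NExp → ℕ
  | .const _ => 1
  | .get _ i => 1 + i.cost
  | .add x y => 1 + x.cost + y.cost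
  | .sub x y => 1 + x.cost + y.cost

/-- Expressions of real number type; `ofNat` converts a natural number to a real number. -/
inductive RExp where
  | ofNat (x : NExp)
  | get (a : ℕ) (i : NExp)
  | add (x y : RExp)
  | sub (x y : RExp)
  | mul (x y : RExp)
  | div (x y : RExp)

noncomputable def RExp.eval (M : Mem) : RExp → ℝ
  | .ofNat x => (x.eval M : ℝ)
  | .get a i => M.real a (i.eval M)
  | .add x y => x.eval M + y.eval M
  | .sub x y => x.eval M - y.eval M
  | .mul x y => x.eval M * y.eval M
  | .div x y => x.eval M / y.eval M

/-- The number of elementary operations in an expression. -/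
def RExp.cost : RExp → ℕ
  | .ofNat x => 1 + x.cost
  | .get _ i => 1 + i.cost
  | .add x y => 1 + x.cost + y.cost
  | .sub x y => 1 + x.cost + y.cost
  | .mul x y => 1 + x.cost + y.cost
  | .div x y => 1 + x.cost + y.cost

/-- Boolean tests. -/
inductive Test where
  | natEq (x y : NExp)
  | natLt (x y : NExp)
  | realLt (x y : RExp)
  | neg (b : Test)
  | conj (b c : Test)

noncomputable def Test.eval (M : Mem) : Test → Bool
  | .natEq x y => decide (x.eval M = y.eval M)
  | .natLt x y => decide (x.eval M < y.eval M)
  | .realLt x y => decide (x.eval M < y.eval M)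
  | .neg b => !b.eval M
  | .conj b c => b.eval M && c.eval M

/-- The number of elementary operations in a test. -/
def Test.cost : Test → ℕ
  | .natEq x y => 1 + x.cost + y.cost
  | .natLt x y => 1 + x.cost + y.cost
  | .realLt x y => 1 + x.cost + y.cost
  | .neg b => 1 + b.cost
  | .conj b c => 1 + b.cost + c.cost

/-- Programs. `setNat a i x` and `setReal a i x` write `x` to cell `i` of array `a`.
`sample a i b k` writes to cell `i` of the natural array `a` a random element of `{0, …, k-1}`, where
`j` is chosen with probability proportional to the contents of cell `j` of the real array `b`. -/
inductive Prog where
  | skip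
  | setNat (a : ℕ) (i x : NExp)
  | setReal (a : ℕ) (i : NExp) (x : RExp)
  | sample (a : ℕ) (i : NExp) (b : ℕ) (k : NExp)
  | seq (c₁ c₂ : Prog)
  | branch (b : Test) (c₁ c₂ : Prog)
  | loop (b : Test) (c : Prog)

open Classical in
/-- A random element of `{0, …, k-1}` with probabilities proportional to `u 0, …, u (k-1)`; negative
weights count as `0`, and the result is `0` if no weight is positive. -/
noncomputable def weightedChoice (u : ℕ → ℝ) (k : ℕ) : PMF ℕ :=
  if h : ∃ i < k, 0 < u i then
    PMF.normalize (fun i => if i < k then ENNReal.ofReal (u i) else 0)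
      (by
        obtain ⟨i, hi, hu⟩ := h
        intro h0
        have h1 := ENNReal.tsum_eq_zero.1 h0 i
        simp only [hi, if_true, ENNReal.ofReal_eq_zero] at h1
        exact absurd hu (not_lt.2 h1))
      (by
        rw [tsum_eq_sum (s := Finset.range k)
          (fun i hi => if_neg (fun h' => hi (Finset.mem_range.2 h')))]
        refine (ENNReal.sum_lt_top.2 fun i _ => ?_).ne
        split_ifs <;> simp)
  else PMF.pure 0

/-- The outcome of a computation: `some (M, t)` if it stopped with memory contents `M` after time
`t`, and `none` if it was cut off. -/
abbrev Outcome := Option (Mem × ℕ)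

/-- Run `f` after an outcome, adding up the times. -/
noncomputable def Outcome.andThen (o : Outcome) (f : Mem → PMF Outcome) : PMF Outcome :=
  match o with
  | none => PMF.pure none
  | some (M, t) => (f M).map fun o' => o'.map fun p => (p.1, t + p.2)

/-- `repeatWhile b t body k M` repeats `body`, starting from `M`, while `b` holds, where evaluating
`b` takes time `t`; the computation is cut off if `b` would have to be evaluated more than `k`
times. -/
noncomputable def repeatWhile (b : Mem → Bool) (t : ℕ) (body : Mem → PMF Outcome) :
    ℕ → Mem → PMF Outcome
  | 0, _ => PMF.pure none
  | k + 1, M =>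
    if b M = true then
      Outcome.andThen (some (M, t)) fun M₀ =>
        (body M₀).bind fun o => o.andThen (repeatWhile b t body k)
    else PMF.pure (some (M, t))

/-- The distribution of the outcome of a program, where no execution of a loop may evaluate its test
more than `N` times. As such an evaluation takes time at least `1`, a computation that takes time at
most `N` is never cut off. -/
noncomputable def Prog.run (N : ℕ) : Prog → Mem → PMF Outcome
  | .skip, M => PMF.pure (some (M, 1))
  | .setNat a i x, M =>
    PMF.pure (some (M.setNat a (i.eval M) (x.eval M), 1 + i.cost + x.cost))
  | .setReal a i x, M =>
    PMF.pure (some (M.setReal a (i.eval M) (x.eval M), 1 + i.cost + x.cost))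
  | .sample a i b k, M =>
    (weightedChoice (M.real b) (k.eval M)).map fun j =>
      some (M.setNat a (i.eval M) j, 1 + i.cost + k.cost)
  | .seq c₁ c₂, M => (c₁.run N M).bind fun o => o.andThen (c₂.run N)
  | .branch b c₁ c₂, M =>
    Outcome.andThen (some (M, 1 + b.cost)) (if b.eval M = true then c₁.run N else c₂.run N)
  | .loop b c, M => repeatWhile (fun M' => b.eval M') (1 + b.cost) (c.run N) N M

/-- The memory contents `M` represent the colouring `σ` (in the natural array number 6). -/
def Encodes {n q : ℕ} (M : Mem) (σ : Fin n → Fin q) : Prop :=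
  ∀ v : Fin n, M.nat 6 v = σ v

/-- The probability that `c`, started from `M`, stops with the colouring `σ` as its output. -/
noncomputable def outputProb {n q : ℕ} (c : Prog) (N : ℕ) (M : Mem) (σ : Fin n → Fin q) : ℝ :=
  ((c.run N M).toOuterMeasure {o | ∃ M' t, o = some (M', t) ∧ Encodes M' σ}).toReal

/-- Started from `M`, the program `c` always stops within time `T`, its output is always a
colouring, and the distribution of this colouring is within total variation distance `δ` of `μ`. -/
def Samples {n q : ℕ} (c : Prog) (M : Mem) (T : ℕ) (μ : (Fin n → Fin q) → ℝ) (δ : ℝ) : Prop :=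
  (∀ o ∈ (c.run T M).support, ∃ M' t, o = some (M', t) ∧ t ≤ T ∧
      ∃ σ : Fin n → Fin q, Encodes M' σ) ∧
    (1 / 2 : ℝ) * ∑ σ : Fin n → Fin q, |outputProb c T M σ - μ σ| ≤ δ

/-- The initial memory contents on input `G`, an even generating set `S`, `w` and `δ`.
Natural arrays: array 0 holds `n, m, r`; arrays 1 and 2 hold the endpoints `src e` and `tgt e` of the
edges; arrays 4 and 5 list, for `C 0, C 1, …` one after the other, the edges `e` of `C i` and their
signs (1 for `χ i e = 1`, and 0 for `χ i e = -1`); the `i`-th cell of array 3 is the place where the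
list of `C i` starts in them, with `r + 1` cells, the last being the end of the list.
Real arrays: array 0 holds `w, δ`. Everything else is 0. -/
noncomputable def input {n m r : ℕ} (G : Multigraph n m) (S : EvenGeneratingSet G r) (w δ : ℝ) :
    Mem where
  nat a i :=
    match a with
    | 0 => [n, m, r].getD i 0
    | 1 => (List.ofFn fun e => (G.src e : ℕ)).getD i 0
    | 2 => (List.ofFn fun e => (G.tgt e : ℕ)).getD i 0
    | 3 => if i ≤ r then ∑ j : Fin r, if (j : ℕ) < i then (S.C j).card else 0 else 0
    | 4 => (S.incidences.map fun p => (p.2 : ℕ)).getD i 0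
    | 5 => (S.incidences.map fun p => if S.χ p.1 p.2 = 1 then 1 else 0).getD i 0
    | _ => 0
  real a i :=
    match a with
    | 0 => [w, δ].getD i 0
    | _ => 0

end RAM

namespace RAM

/-! ### A program logic for the randomised RAM -/

/-! The Potts measure is the image of a simpler measure on flows. Put `y = (w + q - 1)/(w - 1)` and
give a `ℤ/q`-flow the weight `y` per edge on which it vanishes. Keep every edge with nonzero flow,
open every other edge with probability `1/y`, and colour the components of open edges uniformly. The
joint weight of a flow `f` and an open set `A ⊇ supp f` is `(y - 1) ^ |Aᶜ|`, and Fourier duality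
(`card_flows_mul_pow`) expresses the number of flows supported in `A` through the number of
colourings constant along `A`. As `y - 1 = q/(w - 1)`, what remains is the expansion of `w = (w - 1)
+ 1` over monochromatic edges (`flowAverage_eq_potts`).

Flows are sampled by heat bath: choose a generator `χ i` uniformly and resample `f` on the line `f +
t χ i`. Contraction is path coupling in dual form. Let `φ` change by at most `L` along each
generator. Moving the start along `χ j` has no effect if `i = j`, and otherwise alters the
expectation by at most `(1 + θ) L`, where `θ = (1 - x ^ k)/(1 + x ^ k)`, `x = 1/y`, `k = |C i ∩ C
j|`, bounds the total variation distance of two laws whose weights agree up to `x ^ k`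
(`average_sub_average_le`). If the `θ`s of the others sum to at most `1 - c` for each `j`, one step
multiplies `L` by `1 - c/r` (`lipAlong_heatStep`). Integer generators also generate the flows modulo
`q`, because these lift (`IsFlowOn.exists_lift`), so every flow is at most `r` moves from zero and
`O(r log (m/δ))` steps suffice. The two hypotheses on `w` give `c > 0`: part (i) by Bernoulli's
inequality, part (ii) by `theta_le_mul` and double counting.

For the program, `Refines` couples machine outcomes with an abstract distribution and bounds the
time along the coupling. A heat bath step costs time proportional to `q + |C i| + 1`; components
come from union by rank, whose depth is logarithmic in the number of edges. -/

theorem bind_congr_support {α β : Type*} {p : PMF α} {f g : α → PMF β}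
    (h : ∀ x ∈ p.support, f x = g x) : p.bind f = p.bind g := by
  ext y
  simp only [PMF.bind_apply]
  refine tsum_congr fun x => ?_
  by_cases hx : p x = 0
  · simp [hx]
  · rw [h x ((PMF.mem_support_iff _ _).2 hx)]

/-- The distribution `D` of outcomes is coupled with the distribution `a` of abstract results such
that every coupled pair of an abstract result and a final memory and time satisfies `R`. -/
def Refines {α : Type*} (D : PMF Outcome) (a : PMF α) (R : α → Mem → ℕ → Prop) : Prop :=
  ∃ ρ : PMF (α × (Mem × ℕ)), D = ρ.map (fun p => some p.2) ∧ ρ.map Prod.fst = a ∧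
    ∀ p ∈ ρ.support, R p.1 p.2.1 p.2.2

/-- Refinement of the trivial distribution: a total correctness assertion. -/
def Ensures (D : PMF Outcome) (Q : Mem → ℕ → Prop) : Prop :=
  Refines D (PMF.pure ()) fun _ => Q

variable {α β : Type*} {D : PMF Outcome} {a : PMF α} {R : α → Mem → ℕ → Prop}

theorem Refines.pure {x : α} {M : Mem} {t : ℕ} (h : R x M t) :
    Refines (PMF.pure (some (M, t))) (PMF.pure x) R := by
  refine ⟨PMF.pure (x, M, t), by simp [PMF.pure_map], by simp [PMF.pure_map], ?_⟩
  intro p hp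
  simp only [PMF.support_pure, Set.mem_singleton_iff] at hp
  subst hp
  exact h

theorem Ensures.pure {Q : Mem → ℕ → Prop} {M : Mem} {t : ℕ} (h : Q M t) :
    Ensures (PMF.pure (some (M, t))) Q :=
  Refines.pure h

theorem Refines.mono {Q : α → Mem → ℕ → Prop} (h : Refines D a R)
    (hQ : ∀ x M t, x ∈ a.support → R x M t → Q x M t) : Refines D a Q := by
  obtain ⟨ρ, h1, rfl, h3⟩ := h
  refine ⟨ρ, h1, rfl, fun p hp => hQ _ _ _ ?_ (h3 p hp)⟩
  rw [PMF.support_map]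
  exact ⟨p, hp, rfl⟩

theorem Ensures.mono {Q Q' : Mem → ℕ → Prop} (h : Ensures D Q)
    (hQ : ∀ M t, Q M t → Q' M t) : Ensures D Q' :=
  Refines.mono h fun _ M t _ => hQ M t

theorem Refines.map {Q : β → Mem → ℕ → Prop} (h : Refines D a R) (f : α → β)
    (hQ : ∀ x M t, R x M t → Q (f x) M t) : Refines D (a.map f) Q := by
  obtain ⟨ρ, h1, rfl, h3⟩ := h
  refine ⟨ρ.map fun p => (f p.1, p.2), ?_, ?_, ?_⟩
  · rw [h1, PMF.map_comp]; rfl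
  · rw [PMF.map_comp, PMF.map_comp]; rfl
  · intro p hp
    rw [PMF.support_map] at hp
    obtain ⟨p', hp', rfl⟩ := hp
    exact hQ _ _ _ (h3 p' hp')

/-- Choosing a coupling of the continuations over each point of the first coupling and averaging
gives a coupling of the composites; times add. -/
theorem Refines.bind {Q : β → Mem → ℕ → Prop} (h : Refines D a R) {f : Mem → PMF Outcome}
    {k : α → PMF β} (hf : ∀ x M t, R x M t →
      Refines (f M) (k x) fun y M' t' => Q y M' (t + t')) :
    Refines (D.bind fun o => o.andThen f) (a.bind k) Q := by
  obtain ⟨ρ, rfl, rfl, h3⟩ := h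
  have key := fun p hp => hf _ _ _ (h3 p hp)
  unfold Refines at key
  -- A default coupling, used only off the support of `ρ`.
  have : Nonempty (PMF (β × (Mem × ℕ))) :=
    let ⟨p, hp⟩ := ρ.support_nonempty; ⟨(key p hp).choose⟩
  choose! g hg1 hg2 hg3 using key
  refine ⟨ρ.bind fun p => (g p).map fun z => (z.1, z.2.1, p.2.2 + z.2.2), ?_, ?_, ?_⟩
  · rw [PMF.bind_map, PMF.map_bind]
    refine bind_congr_support fun p hp => ?_
    simp only [Function.comp_apply, Outcome.andThen]
    rw [hg1 p hp, PMF.map_comp, PMF.map_comp]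
    rfl
  · rw [PMF.bind_map, PMF.map_bind]
    refine bind_congr_support fun p hp => ?_
    rw [PMF.map_comp, Function.comp_apply, ← hg2 p hp]
    rfl
  · intro z hz
    rw [PMF.support_bind] at hz
    simp only [Set.mem_iUnion, PMF.support_map, Set.mem_image] at hz
    obtain ⟨p, hp, z', hz', rfl⟩ := hz
    exact hg3 p hp z' hz'

theorem Refines.andThen {M : Mem} {t : ℕ} {f : Mem → PMF Outcome}
    (h : Refines (f M) a fun y M' t' => R y M' (t + t')) :
    Refines (Outcome.andThen (some (M, t)) f) a R := by
  have := Refines.bind (Refines.pure (R := fun _ M' t' => M' = M ∧ t' = t) (x := ()) ⟨rfl, rfl⟩)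
    (f := f) (k := fun _ => a) (Q := R) (by rintro x M' t' ⟨rfl, rfl⟩; exact h)
  simpa [PMF.pure_bind] using this

/-! #### Written arrays -/

/-- Whether the program writes to the natural array `a`. -/
def Prog.writesNat (a : ℕ) : Prog → Bool
  | .skip => false
  | .setNat b _ _ => b == a
  | .setReal _ _ _ => false
  | .sample b _ _ _ => b == a
  | .seq c₁ c₂ => c₁.writesNat a || c₂.writesNat a
  | .branch _ c₁ c₂ => c₁.writesNat a || c₂.writesNat a
  | .loop _ c => c.writesNat a

/-- Whether the program writes to the real array `a`. -/
def Prog.writesReal (a : ℕ) : Prog → Bool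
  | .skip => false
  | .setNat _ _ _ => false
  | .setReal b _ _ => b == a
  | .sample _ _ _ _ => false
  | .seq c₁ c₂ => c₁.writesReal a || c₂.writesReal a
  | .branch _ c₁ c₂ => c₁.writesReal a || c₂.writesReal a
  | .loop _ c => c.writesReal a

/-- The arrays that `c` does not write to are the same in `M` and in `M'`. -/
structure Frame (c : Prog) (M M' : Mem) : Prop where
  nat : ∀ a, c.writesNat a = false → M'.nat a = M.nat a
  real : ∀ a, c.writesReal a = false → M'.real a = M.real a

theorem Frame.refl (c : Prog) (M : Mem) : Frame c M M := ⟨fun _ _ => rfl, fun _ _ => rfl⟩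

theorem Frame.trans {c : Prog} {M M' M'' : Mem} (h : Frame c M M') (h' : Frame c M' M'') :
    Frame c M M'' :=
  ⟨fun a ha => (h'.nat a ha).trans (h.nat a ha), fun a ha => (h'.real a ha).trans (h.real a ha)⟩

theorem Frame.weaken {c c' : Prog} {M M' : Mem} (h : Frame c M M')
    (hn : ∀ a, c'.writesNat a = false → c.writesNat a = false)
    (hr : ∀ a, c'.writesReal a = false → c.writesReal a = false) : Frame c' M M' :=
  ⟨fun a ha => h.nat a (hn a ha), fun a ha => h.real a (hr a ha)⟩

/-- All outcomes that did not get cut off satisfy `Frame c M`. -/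
def Preserves (c : Prog) (M : Mem) (D : PMF Outcome) : Prop :=
  ∀ M' t, some (M', t) ∈ D.support → Frame c M M'

theorem Preserves.bind {c : Prog} {M : Mem} {D : PMF Outcome} (h : Preserves c M D)
    {f : Mem → PMF Outcome} (hf : ∀ M', Preserves c M' (f M')) :
    Preserves c M (D.bind fun o => o.andThen f) := by
  intro M' t hM
  rw [PMF.support_bind] at hM
  simp only [Set.mem_iUnion] at hM
  obtain ⟨o, ho, hM⟩ := hM
  match o, ho, hM with
  | none, ho, hM => simp [Outcome.andThen] at hM
  | some (M₁, t₁), ho, hM =>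
    simp only [Outcome.andThen, PMF.support_map, Set.mem_image] at hM
    obtain ⟨o', ho', hM⟩ := hM
    match o', ho', hM with
    | some (M₂, t₂), ho', hM =>
      simp only [Option.map_some, Option.some.injEq, Prod.mk.injEq] at hM
      obtain ⟨rfl, -⟩ := hM
      exact (h _ _ ho).trans (hf _ _ _ ho')

theorem Preserves.andThen {c : Prog} {M : Mem} {t : ℕ} {f : Mem → PMF Outcome}
    (hf : Preserves c M (f M)) : Preserves c M (Outcome.andThen (some (M, t)) f) := by
  intro M' t' hM
  simp only [Outcome.andThen, PMF.support_map, Set.mem_image] at hM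
  obtain ⟨o', ho', hM⟩ := hM
  match o', ho', hM with
  | some (M₂, t₂), ho', hM =>
    simp only [Option.map_some, Option.some.injEq, Prod.mk.injEq] at hM
    obtain ⟨rfl, -⟩ := hM
    exact hf _ _ ho'

theorem Preserves.weaken {c c' : Prog} {M : Mem} {D : PMF Outcome} (h : Preserves c M D)
    (hn : ∀ a, c'.writesNat a = false → c.writesNat a = false)
    (hr : ∀ a, c'.writesReal a = false → c.writesReal a = false) : Preserves c' M D :=
  fun M' t hM => (h M' t hM).weaken hn hr

/-- A syntactic frame rule. It lets every later specification mention only the arrays that change,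
the others being handled by evaluating `writesNat` and `writesReal`. -/
theorem Prog.preserves (N : ℕ) (c : Prog) (M : Mem) : Preserves c M (c.run N M) := by
  induction c generalizing M with
  | skip =>
    intro M' t h
    simp only [Prog.run, PMF.support_pure, Set.mem_singleton_iff, Option.some.injEq,
      Prod.mk.injEq] at h
    obtain ⟨rfl, -⟩ := h
    exact Frame.refl _ _
  | setNat a i x =>
    intro M' t h
    simp only [Prog.run, PMF.support_pure, Set.mem_singleton_iff, Option.some.injEq,
      Prod.mk.injEq] at h
    obtain ⟨rfl, -⟩ := h
    refine ⟨fun b hb => ?_, fun b hb => rfl⟩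
    simp only [writesNat, beq_eq_false_iff_ne] at hb
    exact Function.update_of_ne hb.symm _ _
  | setReal a i x =>
    intro M' t h
    simp only [Prog.run, PMF.support_pure, Set.mem_singleton_iff, Option.some.injEq,
      Prod.mk.injEq] at h
    obtain ⟨rfl, -⟩ := h
    refine ⟨fun b hb => rfl, fun b hb => ?_⟩
    simp only [writesReal, beq_eq_false_iff_ne] at hb
    exact Function.update_of_ne hb.symm _ _
  | sample a i b k =>
    intro M' t h
    simp only [Prog.run, PMF.support_map, Set.mem_image, Option.some.injEq, Prod.mk.injEq] at h
    obtain ⟨j, -, rfl, -⟩ := h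
    refine ⟨fun b hb => ?_, fun b hb => rfl⟩
    simp only [writesNat, beq_eq_false_iff_ne] at hb
    exact Function.update_of_ne hb.symm _ _
  | seq c₁ c₂ h₁ h₂ =>
    refine Preserves.bind ((h₁ M).weaken ?_ ?_) fun M' => (h₂ M').weaken ?_ ?_ <;>
      simp +contextual [writesNat, writesReal]
  | branch b c₁ c₂ h₁ h₂ =>
    refine Preserves.andThen ?_
    by_cases hb : b.eval M = true
    · simp only [hb, if_true]
      exact (h₁ M).weaken (by simp +contextual [writesNat]) (by simp +contextual [writesReal])
    · simp only [hb]
      exact (h₂ M).weaken (by simp +contextual [writesNat]) (by simp +contextual [writesReal])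
  | loop b c h =>
    have key : ∀ k M, Preserves (.loop b c) M
        (repeatWhile (fun M' => b.eval M') (1 + b.cost) (c.run N) k M) := by
      intro k
      induction k with
      | zero => intro M M' t hM; simp [repeatWhile] at hM
      | succ k ih =>
        intro M
        rw [repeatWhile]
        split_ifs with hb
        · exact Preserves.andThen (Preserves.bind ((h M).weaken (by simp [writesNat])
            (by simp [writesReal])) ih)
        · intro M' t hM
          simp only [PMF.support_pure, Set.mem_singleton_iff, Option.some.injEq,
            Prod.mk.injEq] at hM
          obtain ⟨rfl, -⟩ := hM
          exact Frame.refl _ _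
    exact key N M

theorem Refines.frame {N : ℕ} {c : Prog} {M : Mem} (h : Refines (c.run N M) a R) :
    Refines (c.run N M) a fun x M' t => R x M' t ∧ Frame c M M' := by
  have hp := c.preserves N M
  obtain ⟨ρ, h1, h2, h3⟩ := h
  refine ⟨ρ, h1, h2, fun p hp' => ⟨h3 p hp', hp p.2.1 p.2.2 ?_⟩⟩
  rw [h1, PMF.support_map]
  exact ⟨p, hp', rfl⟩

/-! #### Sequential composition and loops -/

theorem Refines.seq {N : ℕ} {c₁ c₂ : Prog} {M : Mem} {Q : β → Mem → ℕ → Prop} {k : α → PMF β}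
    (h : Refines (c₁.run N M) a R)
    (h₂ : ∀ x M' t, Frame c₁ M M' → R x M' t →
      Refines (c₂.run N M') (k x) fun y M'' t' => Q y M'' (t + t')) :
    Refines ((Prog.seq c₁ c₂).run N M) (a.bind k) Q :=
  h.frame.bind fun x M' t hR => h₂ x M' t hR.2 hR.1

theorem Ensures.seq_refines {N : ℕ} {c₁ c₂ : Prog} {M : Mem} {P : Mem → ℕ → Prop}
    {Q : β → Mem → ℕ → Prop} {b : PMF β} (h : Ensures (c₁.run N M) P)
    (h₂ : ∀ M' t, Frame c₁ M M' → P M' t →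
      Refines (c₂.run N M') b fun y M'' t' => Q y M'' (t + t')) :
    Refines ((Prog.seq c₁ c₂).run N M) b Q := by
  have := Refines.seq (k := fun _ => b) (Q := Q) h fun x M' t hF hR => h₂ M' t hF hR
  rwa [PMF.pure_bind] at this

theorem Ensures.seq {N : ℕ} {c₁ c₂ : Prog} {M : Mem} {P Q : Mem → ℕ → Prop}
    (h : Ensures (c₁.run N M) P)
    (h₂ : ∀ M' t, Frame c₁ M M' → P M' t →
      Ensures (c₂.run N M') fun M'' t' => Q M'' (t + t')) :
    Ensures ((Prog.seq c₁ c₂).run N M) Q :=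
  Ensures.seq_refines h h₂

/-- Apply the kernels `k j, …, k (j + d - 1)` one after the other. -/
noncomputable def iterKernel (k : ℕ → α → PMF α) : ℕ → ℕ → α → PMF α
  | _, 0, x => PMF.pure x
  | j, d + 1, x => (k j x).bind (iterKernel k (j + 1) d)

/-- For loops with a known number `K` of rounds. The time in the invariant is counted from the start
of the loop, and the fuel must exceed the number of remaining rounds because the failing test is
evaluated too. -/
theorem refines_repeatWhile {b : Mem → Bool} {tc : ℕ} {body : Mem → PMF Outcome} {K : ℕ}
    {k : ℕ → α → PMF α} {I : ℕ → α → Mem → ℕ → Prop} {Q : α → Mem → ℕ → Prop}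
    (hbody : ∀ j < K, ∀ x M t, I j x M t → b M = true ∧
      Refines (body M) (k j x) fun y M' t' => I (j + 1) y M' (t + tc + t'))
    (hend : ∀ x M t, I K x M t → b M = false ∧ Q x M (t + tc)) :
    ∀ (d j N : ℕ) (x : α) (M : Mem) (t : ℕ), j + d = K → d < N → I j x M t →
      Refines (repeatWhile b tc body N M) (iterKernel k j d x)
        fun y M' t' => Q y M' (t + t') := by
  intro d
  induction d with
  | zero =>
    intro j N x M t hj hN hI
    obtain ⟨N, rfl⟩ := Nat.exists_eq_succ_of_ne_zero hN.ne'
    rw [Nat.add_zero] at hj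
    subst hj
    obtain ⟨h1, h2⟩ := hend x M t hI
    simp only [repeatWhile, h1, iterKernel]
    exact Refines.pure h2
  | succ d ih =>
    intro j N x M t hj hN hI
    obtain ⟨N, rfl⟩ := Nat.exists_eq_succ_of_ne_zero (Nat.ne_of_gt (Nat.zero_lt_of_lt hN))
    obtain ⟨h1, h2⟩ := hbody j (by omega) x M t hI
    simp only [repeatWhile, h1, iterKernel, if_true]
    refine Refines.andThen (h2.bind fun y M' t' hI' => ?_)
    refine (ih (j + 1) N y M' _ (by omega) (by omega) hI').mono fun z M'' t'' _ h => ?_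
    convert h using 1
    ring

/-- Here `k` is a variant, only an upper bound for the remaining rounds; at `k = 0` the hypothesis
on the body forces the test to fail. -/
theorem ensures_repeatWhile {b : Mem → Bool} {tc : ℕ} {body : Mem → PMF Outcome}
    {I : ℕ → Mem → ℕ → Prop} {Q : Mem → ℕ → Prop}
    (hbody : ∀ k M t, I k M t → b M = true →
      ∃ k', k = k' + 1 ∧ Ensures (body M) fun M' t' => I k' M' (t + tc + t'))
    (hend : ∀ k M t, I k M t → b M = false → Q M (t + tc)) :
    ∀ (k N : ℕ) (M : Mem) (t : ℕ), k < N → I k M t →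
      Ensures (repeatWhile b tc body N M) fun M' t' => Q M' (t + t') := by
  intro k
  induction k with
  | zero =>
    intro N M t hN hI
    obtain ⟨N, rfl⟩ := Nat.exists_eq_succ_of_ne_zero hN.ne'
    cases h : b M with
    | true => obtain ⟨k', hk', -⟩ := hbody 0 M t hI h; omega
    | false =>
      simp only [repeatWhile, h]
      exact Ensures.pure (hend _ M t hI h)
  | succ k ih =>
    intro N M t hN hI
    obtain ⟨N, rfl⟩ := Nat.exists_eq_succ_of_ne_zero (Nat.ne_of_gt (Nat.zero_lt_of_lt hN))
    cases h : b M with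
    | true =>
      obtain ⟨k', hk', h2⟩ := hbody _ M t hI h
      obtain rfl : k = k' := by omega
      simp only [repeatWhile, h, if_true]
      refine Refines.andThen ?_
      have := Refines.bind h2 (f := repeatWhile b tc body N) (k := fun _ => PMF.pure ())
        (Q := fun _ M' t' => Q M' (t + (tc + t'))) ?_
      · rwa [PMF.pure_bind] at this
      · intro _ M' t' hI'
        refine (ih N M' _ (by omega) hI').mono fun M'' t'' h => ?_
        convert h using 1
        ring
    | false =>
      simp only [repeatWhile, h]
      exact Ensures.pure (hend _ M t hI h)

/-- The scalar variable that is stored in cell `0` of the natural array `a`. -/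
abbrev NExp.var (a : ℕ) : NExp := .get a (.const 0)

/-- Assign `x` to the scalar variable `a`. -/
abbrev Prog.assign (a : ℕ) (x : NExp) : Prog := .setNat a (.const 0) x

/-- Run `c` with the variable `a` running through the natural numbers less than `k`. -/
def Prog.forLoop (a : ℕ) (k : NExp) (c : Prog) : Prog :=
  .seq (.assign a (.const 0))
    (.loop (.natLt (.var a) k) (.seq c (.assign a (.add (.var a) (.const 1)))))

@[simp] theorem Mem.setNat_nat (M : Mem) (a i x b : ℕ) :
    (M.setNat a i x).nat b = if b = a then Function.update (M.nat a) i x else M.nat b := by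
  by_cases h : b = a
  · subst h; simp [Mem.setNat]
  · simp [Mem.setNat, h]

@[simp] theorem Mem.setNat_real (M : Mem) (a i x : ℕ) : (M.setNat a i x).real = M.real := rfl

@[simp] theorem Mem.setReal_nat (M : Mem) (a i : ℕ) (x : ℝ) :
    (M.setReal a i x).nat = M.nat := rfl

@[simp] theorem Mem.setReal_real (M : Mem) (a i : ℕ) (x : ℝ) (b : ℕ) :
    (M.setReal a i x).real b = if b = a then Function.update (M.real a) i x else M.real b := by
  by_cases h : b = a
  · subst h; simp [Mem.setReal]
  · simp [Mem.setReal, h]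

/-- The body may use that arrays untouched by the whole loop still have their initial contents, so
the invariant `I` need only describe the progress made. It must not depend on the counter cell,
which is overwritten between rounds. -/
theorem refines_forLoop {N : ℕ} {v : ℕ} {kx : NExp} {c : Prog} {M : Mem} (K : ℕ)
    {k : ℕ → α → PMF α} (I : ℕ → α → Mem → Prop) (b : ℕ → ℕ) (x : α)
    (hv : c.writesNat v = false) (hN : K < N)
    (hI : ∀ j y M' z, I j y M' → I j y (M'.setNat v 0 z))
    (hk : ∀ M', Frame (.forLoop v kx c) M M' → kx.eval M' = K)
    (h0 : I 0 x M)
    (hbody : ∀ j < K, ∀ y M', Frame (.forLoop v kx c) M M' → M'.nat v 0 = j → I j y M' →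
      Refines (c.run N M') (k j y) fun z M'' t => I (j + 1) z M'' ∧ t ≤ b j) :
    Refines ((Prog.forLoop v kx c).run N M) (iterKernel k 0 K x) fun y M' t =>
      I K y M' ∧ t ≤ (∑ j ∈ Finset.range K, (b j + (kx.cost + 10))) + (kx.cost + 10) := by
  -- A round costs `b i` for the body, `kx.cost + 4` for the test and `6` for the increment.
  set B : ℕ → ℕ := fun i => (∑ j ∈ Finset.range i, (b j + (kx.cost + 10))) with hB
  set C := Prog.forLoop v kx c with hC
  refine Ensures.seq_refines (P := fun M' t => M' = M.setNat v 0 0 ∧ t = 3)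
    (Ensures.pure ⟨rfl, rfl⟩) ?_
  rintro M₁ t₁ - ⟨rfl, rfl⟩
  have hCv : C.writesNat v = true := by simp [C, Prog.forLoop, Prog.writesNat]
  have hset : ∀ M' z, Frame C M' (M'.setNat v 0 z) := by
    intro M' z
    refine ⟨fun a ha => ?_, fun a ha => rfl⟩
    have : a ≠ v := by rintro rfl; rw [hCv] at ha; cases ha
    simp [this]
  have hcC : ∀ M' M'', Frame c M' M'' → Frame C M' M'' := by
    intro M' M'' h
    refine h.weaken ?_ ?_ <;> simp +contextual [C, Prog.forLoop, Prog.writesNat, Prog.writesReal]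
  have := refines_repeatWhile (b := fun M' => (Test.natLt (.var v) kx).eval M')
    (tc := 1 + (Test.natLt (.var v) kx).cost)
    (body := (Prog.seq c (.assign v (.add (.var v) (.const 1)))).run N) (K := K) (k := k)
    (I := fun j y M' t => I j y M' ∧ M'.nat v 0 = j ∧ Frame C M M' ∧ t ≤ B j)
    (Q := fun y M' t => I K y M' ∧ t ≤ B K + (kx.cost + 4)) ?_ ?_ K 0 N x
      (M.setNat v 0 0) 0 (by simp) hN ?_
  · refine this.mono fun y M' t _ h => ?_
    refine ⟨h.1, ?_⟩
    have := h.2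
    simp only [hB] at this ⊢
    omega
  · rintro j hj y M' t ⟨h1, h2, h3, h4⟩
    constructor
    · simp [Test.eval, NExp.eval, hk M' h3, h2, hj]
    have := Refines.seq (c₂ := .assign v (.add (.var v) (.const 1)))
      (k := fun z => PMF.pure z) (Q := fun z M'' t' => I (j + 1) z M'' ∧ M''.nat v 0 = j + 1 ∧
        Frame C M M'' ∧ t + (1 + (Test.natLt (.var v) kx).cost) + t' ≤ B (j + 1))
      (hbody j hj y M' h3 h2 h1) ?_
    · simpa [PMF.bind_pure] using this
    · rintro z M'' t' hF ⟨hz, ht'⟩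
      refine Refines.pure ⟨hI _ _ _ _ hz, ?_, ?_, ?_⟩
      · simp [NExp.eval, hF.nat v hv, h2]
      · exact (h3.trans (hcC _ _ hF)).trans (hset _ _)
      · simp only [hB, Finset.sum_range_succ, Test.cost, NExp.cost] at h4 ⊢
        omega
  · rintro y M' t ⟨h1, h2, h3, h4⟩
    refine ⟨by simp [Test.eval, NExp.eval, hk M' h3, h2], h1, ?_⟩
    simp only [Test.cost, NExp.cost]
    omega
  · exact ⟨hI _ _ _ _ h0, by simp, hset _ _, by simp⟩

theorem ensures_forLoop {N : ℕ} {v : ℕ} {kx : NExp} {c : Prog} {M : Mem} (K : ℕ)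
    (I : ℕ → Mem → Prop) (b : ℕ → ℕ)
    (hv : c.writesNat v = false) (hN : K < N)
    (hI : ∀ j M' z, I j M' → I j (M'.setNat v 0 z))
    (hk : ∀ M', Frame (.forLoop v kx c) M M' → kx.eval M' = K)
    (h0 : I 0 M)
    (hbody : ∀ j < K, ∀ M', Frame (.forLoop v kx c) M M' → M'.nat v 0 = j → I j M' →
      Ensures (c.run N M') fun M'' t => I (j + 1) M'' ∧ t ≤ b j) :
    Ensures ((Prog.forLoop v kx c).run N M) fun M' t =>
      I K M' ∧ t ≤ (∑ j ∈ Finset.range K, (b j + (kx.cost + 10))) + (kx.cost + 10) := by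
  have := refines_forLoop (N := N) (v := v) (kx := kx) (c := c) (M := M) K
    (k := fun _ (_ : Unit) => PMF.pure ()) (fun j _ M' => I j M') b () hv hN
    (fun j _ M' z => hI j M' z) hk h0 (fun j hj _ M' hF hj' hI' => hbody j hj M' hF hj' hI')
  have h : ∀ d j, iterKernel (fun _ (_ : Unit) => PMF.pure ()) j d () = PMF.pure () := by
    intro d
    induction d with
    | zero => intro j; rfl
    | succ d ih => intro j; rw [iterKernel, PMF.pure_bind, ih]
  rwa [h] at this

/-! #### Random choices -/

/-- The distribution on a finite type that is proportional to the positive function `u`. -/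
noncomputable def proportional {ι : Type*} [Fintype ι] [Nonempty ι] (u : ι → ℝ)
    (hu : ∀ i, 0 < u i) : PMF ι :=
  PMF.normalize (fun i => ENNReal.ofReal (u i))
    (by
      intro h0
      have h1 := ENNReal.tsum_eq_zero.1 h0 (Classical.arbitrary ι)
      exact absurd (ENNReal.ofReal_eq_zero.1 h1) (not_le.2 (hu _)))
    (by
      rw [tsum_fintype]
      exact (ENNReal.sum_lt_top.2 fun i _ => ENNReal.ofReal_lt_top).ne)

theorem proportional_apply {ι : Type*} [Fintype ι] [Nonempty ι] (u : ι → ℝ)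
    (hu : ∀ i, 0 < u i) (i : ι) :
    proportional u hu i = ENNReal.ofReal (u i / ∑ j, u j) := by
  rw [proportional, PMF.normalize_apply, tsum_fintype, ← ENNReal.ofReal_sum_of_nonneg
    (fun j _ => (hu j).le), ENNReal.ofReal_div_of_pos (Finset.sum_pos (fun j _ => hu j)
      Finset.univ_nonempty), div_eq_mul_inv]

/-- The encoding is a bijection onto `{0, …, k - 1}`, so both sides have the same normalising sum.
-/
theorem weightedChoice_eq_map {ι : Type*} [Fintype ι] [Nonempty ι] (enc : ι → ℕ) {k : ℕ}
    (hinj : Function.Injective enc) (hrange : ∀ i, i < k ↔ ∃ j, enc j = i) (u : ℕ → ℝ)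
    (hu : ∀ i, 0 < u (enc i)) :
    weightedChoice u k = (proportional (fun i => u (enc i)) hu).map enc := by
  classical
  have hex : ∃ i < k, 0 < u i :=
    ⟨enc (Classical.arbitrary ι), (hrange _).2 ⟨_, rfl⟩, hu _⟩
  have hsum : ∑' i, (if i < k then ENNReal.ofReal (u i) else 0) =
      ∑ j, ENNReal.ofReal (u (enc j)) := by
    rw [← tsum_fintype (L := .unconditional _), ← hinj.tsum_eq]
    · refine tsum_congr fun j => if_pos ((hrange _).2 ⟨j, rfl⟩)
    · intro i hi
      simp only [Function.mem_support, ne_eq, ite_eq_right_iff, Classical.not_imp] at hi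
      exact (hrange i).1 hi.1
  ext i
  rw [weightedChoice, dif_pos hex, PMF.normalize_apply]
  simp only [hsum]
  rw [PMF.map_apply]
  by_cases hi : i < k
  · obtain ⟨j, rfl⟩ := (hrange i).1 hi
    rw [tsum_eq_single j, if_pos rfl, if_pos hi, proportional, PMF.normalize_apply, tsum_fintype]
    intro j' hj'
    exact if_neg fun h => hj' (hinj h.symm)
  · rw [if_neg hi, zero_mul, eq_comm]
    refine ENNReal.tsum_eq_zero.2 fun j => if_neg fun h => hi ((hrange i).2 ⟨j, h.symm⟩)

theorem refines_sample {ι : Type*} [Fintype ι] [Nonempty ι] (enc : ι → ℕ) {N a b : ℕ}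
    {i k : NExp} {M : Mem} (hinj : Function.Injective enc)
    (hrange : ∀ i, i < k.eval M ↔ ∃ j, enc j = i) {u : ι → ℝ} (hu : ∀ i, 0 < u i)
    (huM : ∀ i, M.real b (enc i) = u i) :
    Refines ((Prog.sample a i b k).run N M) (proportional u hu) fun j M' t =>
      M' = M.setNat a (i.eval M) (enc j) ∧ t = 1 + i.cost + k.cost := by
  have hu' : u = fun i => M.real b (enc i) := funext fun i => (huM i).symm
  subst hu'
  refine ⟨(proportional _ hu).map fun j =>
    (j, M.setNat a (i.eval M) (enc j), 1 + i.cost + k.cost), ?_, ?_, ?_⟩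
  · rw [Prog.run, weightedChoice_eq_map enc hinj hrange (M.real b) hu, PMF.map_comp, PMF.map_comp]
    rfl
  · rw [PMF.map_comp]
    exact PMF.map_id _
  · intro p hp
    rw [PMF.support_map] at hp
    obtain ⟨j, -, rfl⟩ := hp
    exact ⟨rfl, rfl⟩

/-- A program whose outcomes refine a distribution on colourings is a sampler for every
distribution close to it. -/
theorem samples_of_refines {n q : ℕ} {c : Prog} {M : Mem} {T : ℕ} {a : PMF (Fin n → Fin q)}
    {μ : (Fin n → Fin q) → ℝ} {δ : ℝ}
    (h : Refines (c.run T M) a fun σ M' t => Encodes M' σ ∧ t ≤ T)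
    (hδ : (1 / 2 : ℝ) * ∑ σ, |(a σ).toReal - μ σ| ≤ δ) : Samples c M T μ δ := by
  obtain ⟨ρ, h1, h2, h3⟩ := h
  constructor
  · intro o ho
    rw [h1, PMF.support_map] at ho
    obtain ⟨p, hp, rfl⟩ := ho
    exact ⟨p.2.1, p.2.2, rfl, (h3 p hp).2, p.1, (h3 p hp).1⟩
  · have : ∀ σ, outputProb c T M σ = (a σ).toReal := by
      intro σ
      rw [outputProb, ← h2, h1, PMF.toOuterMeasure_map_apply, ← PMF.toOuterMeasure_apply_singleton,
        PMF.toOuterMeasure_map_apply]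
      congr 1
      -- A memory encodes at most one colouring, so on the support of `ρ` the output event is
      -- equality with the abstract result.
      refine PMF.toOuterMeasure_apply_eq_of_inter_support_eq _ ?_
      ext p
      simp only [Set.mem_inter_iff, Set.mem_preimage, Set.mem_ofPred_eq, Option.some.injEq,
        Set.mem_singleton_iff]
      refine and_congr_left fun hp => ⟨?_, ?_⟩
      · rintro ⟨M', t, h, hσ⟩
        have he := (h3 p hp).1
        rw [h] at he
        funext v
        exact Fin.ext ((he v).symm.trans (hσ v))
      · rintro rfl
        exact ⟨_, _, rfl, (h3 p hp).1⟩
    simpa only [this] using hδ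

end RAM

set_option linter.unusedSectionVars false

namespace FlowChain

open Finset

/-! ### Contraction of the heat bath dynamics on flows -/

/-! ### Averages with respect to two comparable weights -/

section TotalVariation

variable {T : Type*} [Fintype T]

/-- This is the total variation bound for two-point spaces. The extreme case is `P = x P'`, `Q' = x
Q`, `P' = Q`; the slacks `a`, `b` and the square `(P' - Q) ^ 2` measure the distance from it. -/
theorem odds_difference_le {x P Q P' Q' : ℝ} (hx : 0 ≤ x) (hx1 : x ≤ 1) (hQ : 0 ≤ Q)
    (hP' : 0 ≤ P') (hPQ : 0 < P + Q) (hPQ' : 0 < P' + Q') (h1 : x * P' ≤ P)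
    (h2 : x * Q ≤ Q') : P' / (P' + Q') - P / (P + Q) ≤ (1 - x) / (1 + x) := by
  rw [div_sub_div _ _ hPQ'.ne' hPQ.ne', div_le_div_iff₀ (by positivity) (by linarith)]
  obtain ⟨a, rfl⟩ : ∃ a, P = x * P' + a := ⟨P - x * P', by ring⟩
  obtain ⟨b, rfl⟩ : ∃ b, Q' = x * Q + b := ⟨Q' - x * Q, by ring⟩
  have ha : 0 ≤ a := by linarith
  have hb : 0 ≤ b := by linarith
  have hy : 0 ≤ 1 - x := by linarith
  have e1 : 0 ≤ x * (1 - x) * (P' - Q) ^ 2 := by positivity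
  have e2 : 0 ≤ (1 - x) * (a * P') := by positivity
  have e3 : 0 ≤ (1 - x) * (b * Q) := by positivity
  have e4 : 0 ≤ x * P' * b := by positivity
  have e5 : 0 ≤ x * Q * a := by positivity
  have e6 : 0 ≤ a * b := by positivity
  nlinarith

/-- If two positive weights agree up to a factor `x`, the averages of a function of oscillation at
most `L` differ by at most `(1 - x) / (1 + x) * L`. -/
theorem average_sub_average_le [Nonempty T] {u v h : T → ℝ} {x L : ℝ} (hx : 0 ≤ x) (hx1 : x ≤ 1)
    (hu : ∀ t, 0 < u t) (hv : ∀ t, 0 < v t) (huv : ∀ t, x * u t ≤ v t)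
    (hvu : ∀ t, x * v t ≤ u t) (hL : ∀ t t', h t - h t' ≤ L) :
    (∑ t, v t * h t) / ∑ t, v t - (∑ t, u t * h t) / ∑ t, u t ≤ (1 - x) / (1 + x) * L := by
  classical
  have hU : 0 < ∑ t, u t := sum_pos (fun t _ => hu t) univ_nonempty
  have hV : 0 < ∑ t, v t := sum_pos (fun t _ => hv t) univ_nonempty
  -- Both laws have mass one, so subtracting the minimum of `h` changes nothing and makes its values
  -- lie in `[0, L]`.
  obtain ⟨t₀, ht₀⟩ := Finite.exists_min h
  have hL0 : 0 ≤ L := by simpa using hL t₀ t₀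
  set U := ∑ t, u t
  set V := ∑ t, v t
  -- The set on which the total variation distance of the normalised weights is attained.
  set S := univ.filter fun t => u t / U < v t / V
  have e1 : (∑ t, v t * h t) / V - (∑ t, u t * h t) / U =
      ∑ t, (v t / V - u t / U) * (h t - h t₀) := by
    have : ∑ t, (v t / V - u t / U) * (h t - h t₀) =
        (∑ t, v t * h t) / V - (∑ t, u t * h t) / U - (V / V - U / U) * h t₀ := by
      simp only [U, V, sum_div, ← sum_sub_distrib, sum_mul]
      exact sum_congr rfl fun t _ => by ring
    rw [this, div_self hU.ne', div_self hV.ne']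
    ring
  have e2 : ∑ t, (v t / V - u t / U) * (h t - h t₀) ≤ ∑ t ∈ S, (v t / V - u t / U) * L := by
    rw [← sum_filter_add_sum_filter_not univ fun t => u t / U < v t / V]
    have h1 : ∑ t ∈ univ.filter (fun t => ¬ u t / U < v t / V),
        (v t / V - u t / U) * (h t - h t₀) ≤ 0 := by
      refine sum_nonpos fun t ht => mul_nonpos_of_nonpos_of_nonneg ?_ (sub_nonneg.2 (ht₀ t))
      have := (mem_filter.1 ht).2
      linarith
    have h2 : ∑ t ∈ S, (v t / V - u t / U) * (h t - h t₀) ≤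
        ∑ t ∈ S, (v t / V - u t / U) * L := by
      refine sum_le_sum fun t ht => mul_le_mul_of_nonneg_left (hL t t₀) ?_
      have := (mem_filter.1 ht).2
      linarith
    linarith
  have e3 : ∑ t ∈ S, (v t / V - u t / U) ≤ (1 - x) / (1 + x) := by
    have hU' : U = ∑ t ∈ S, u t + ∑ t ∈ Sᶜ, u t := (sum_add_sum_compl S u).symm
    have hV' : V = ∑ t ∈ S, v t + ∑ t ∈ Sᶜ, v t := (sum_add_sum_compl S v).symm
    rw [sum_sub_distrib, ← sum_div, ← sum_div, hU', hV']
    refine odds_difference_le hx hx1 (sum_nonneg fun t _ => (hu t).le)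
      (sum_nonneg fun t _ => (hv t).le) (hU' ▸ hU) (hV' ▸ hV) ?_ ?_
    · rw [mul_sum]; exact sum_le_sum fun t _ => hvu t
    · rw [mul_sum]; exact sum_le_sum fun t _ => huv t
  rw [e1]
  refine e2.trans ?_
  rw [← sum_mul]
  exact mul_le_mul_of_nonneg_right e3 hL0

theorem abs_average_sub_average_le [Nonempty T] {u v h : T → ℝ} {x L : ℝ} (hx : 0 ≤ x)
    (hx1 : x ≤ 1) (hu : ∀ t, 0 < u t) (hv : ∀ t, 0 < v t) (huv : ∀ t, x * u t ≤ v t)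
    (hvu : ∀ t, x * v t ≤ u t) (hL : ∀ t t', h t - h t' ≤ L) :
    |(∑ t, v t * h t) / ∑ t, v t - (∑ t, u t * h t) / ∑ t, u t| ≤ (1 - x) / (1 + x) * L := by
  rw [abs_sub_le_iff]
  exact ⟨average_sub_average_le hx hx1 hu hv huv hvu hL,
    average_sub_average_le hx hx1 hv hu hvu huv hL⟩

theorem abs_average_le [Nonempty T] {u h : T → ℝ} {L : ℝ} (hu : ∀ t, 0 < u t)
    (hL : ∀ t, |h t| ≤ L) : |(∑ t, u t * h t) / ∑ t, u t| ≤ L := by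
  have hU : 0 < ∑ t, u t := sum_pos (fun t _ => hu t) univ_nonempty
  rw [abs_div, abs_of_pos hU, div_le_iff₀ hU, mul_comm L, sum_mul]
  refine (abs_sum_le_sum_abs _ _).trans (sum_le_sum fun t _ => ?_)
  rw [abs_mul, abs_of_pos (hu t)]
  exact mul_le_mul_of_nonneg_left (hL t) (hu t).le

end TotalVariation

/-- `theta x k` bounds the total variation distance of two heat bath distributions that differ in
`k` edges. -/
noncomputable def theta (x : ℝ) (k : ℕ) : ℝ := (1 - x ^ k) / (1 + x ^ k)

theorem theta_zero (x : ℝ) : theta x 0 = 0 := by simp [theta]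

theorem theta_nonneg {x : ℝ} (hx : 0 ≤ x) (hx1 : x ≤ 1) (k : ℕ) : 0 ≤ theta x k :=
  div_nonneg (sub_nonneg.2 (pow_le_one₀ hx hx1)) (by positivity)

theorem theta_mono {x : ℝ} (hx : 0 ≤ x) (hx1 : x ≤ 1) {k l : ℕ} (h : k ≤ l) :
    theta x k ≤ theta x l := by
  have := pow_le_pow_of_le_one hx hx1 h
  have hk : 0 ≤ x ^ l := by positivity
  rw [theta, theta, div_le_div_iff₀ (by linarith) (by linarith)]
  nlinarith

/-- For `x = exp (-2 s)` this is the subadditivity of `tanh` on `[0, ∞)`, as `theta x k = tanh (k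
s)`. -/
theorem theta_le_mul {x : ℝ} (hx : 0 ≤ x) (hx1 : x ≤ 1) (k : ℕ) : theta x k ≤ k * theta x 1 := by
  induction k with
  | zero => simp [theta_zero]
  | succ k ih =>
    have : theta x (k + 1) ≤ theta x k + theta x 1 := by
      have h0 : 0 ≤ x ^ k := by positivity
      have h1 : x ^ k ≤ 1 := pow_le_one₀ hx hx1
      simp only [theta, pow_succ]
      generalize x ^ k = z at h0 h1
      rw [div_add_div _ _ (by positivity) (by positivity), div_le_div_iff₀ (by positivity)
        (by positivity)]
      have : 0 ≤ (1 - z) * (1 - x) * ((1 - z * x)) :=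
        mul_nonneg (mul_nonneg (by linarith) (by linarith)) (by nlinarith)
      nlinarith
    push_cast
    linarith

/-! ### The heat bath operator, its contraction and its stationary measure -/

section Chain

variable {E ι : Type*} [Fintype E] [DecidableEq E] {q : ℕ}

/-- The weight of the flow `f + t χ` relative to that of the flow off `C`. -/
noncomputable def heatWeight (y : ℝ) (C : Finset E) (χ : E → ZMod q) (f : E → ZMod q)
    (t : ZMod q) : ℝ :=
  ∏ e ∈ C, if f e + t * χ e = 0 then y else 1

theorem heatWeight_pos {y : ℝ} (hy : 0 < y) (C : Finset E) (χ f : E → ZMod q) (t : ZMod q) :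
    0 < heatWeight y C χ f t :=
  prod_pos fun e _ => by split_ifs <;> linarith

/-- The expectation of `φ` after a heat bath update in the direction `χ`. -/
noncomputable def heatAverage [NeZero q] (y : ℝ) (C : Finset E) (χ : E → ZMod q)
    (φ : (E → ZMod q) → ℝ) (f : E → ZMod q) : ℝ :=
  (∑ t, heatWeight y C χ f t * φ (f + t • χ)) / ∑ t, heatWeight y C χ f t

/-- The expectation of `φ` after one step of the dynamics. -/
noncomputable def heatStep [NeZero q] [Fintype ι] (y : ℝ) (C : ι → Finset E)
    (χ : ι → E → ZMod q) (φ : (E → ZMod q) → ℝ) (f : E → ZMod q) : ℝ :=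
  (∑ i, heatAverage y (C i) (χ i) φ f) / Fintype.card ι

/-- `φ` changes by at most `L` along each generator. -/
def LipAlong (χ : ι → E → ZMod q) (φ : (E → ZMod q) → ℝ) (L : ℝ) : Prop :=
  ∀ (i : ι) (t : ZMod q) (f : E → ZMod q), |φ (f + t • χ i) - φ f| ≤ L

/-- Only the factors of edges in `C ∩ D` can change, each by at most a factor `y`. -/
theorem heatWeight_le [NeZero q] {y : ℝ} (hy : 1 ≤ y) {C D : Finset E} {χ ψ : E → ZMod q}
    (hψ : ∀ e ∉ D, ψ e = 0) (f : E → ZMod q) (s t : ZMod q) :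
    (y⁻¹) ^ (C ∩ D).card * heatWeight y C χ f t ≤ heatWeight y C χ (f + s • ψ) t := by
  have hy0 : 0 < y := by linarith
  have h1 : (y⁻¹) ^ (C ∩ D).card = ∏ e ∈ C, if e ∈ D then y⁻¹ else 1 := by
    rw [← filter_mem_eq_inter, prod_ite, prod_const_one, mul_one, prod_const]
  rw [h1, heatWeight, heatWeight, ← prod_mul_distrib]
  refine prod_le_prod (fun e _ => ?_) fun e _ => ?_
  · split_ifs <;> positivity
  · have hi : y⁻¹ ≤ 1 := inv_le_one_of_one_le₀ hy
    by_cases he : e ∈ D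
    · rw [if_pos he]
      have : y⁻¹ * y = 1 := inv_mul_cancel₀ hy0.ne'
      split_ifs <;> linarith
    · simp [he, hψ e he]

/-- The update forgets the position on the line in direction `χ`. Hence the generator along which
two states differ contributes nothing to the distance after its own update. -/
theorem heatAverage_add_smul [NeZero q] (y : ℝ) (C : Finset E) (χ : E → ZMod q)
    (φ : (E → ZMod q) → ℝ) (f : E → ZMod q) (s : ZMod q) :
    heatAverage y C χ φ (f + s • χ) = heatAverage y C χ φ f := by
  have hw : ∀ t, heatWeight y C χ (f + s • χ) t = heatWeight y C χ f (s + t) := by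
    intro t
    refine prod_congr rfl fun e _ => ?_
    simp only [Pi.add_apply, Pi.smul_apply, smul_eq_mul, add_mul, add_assoc]
  unfold heatAverage
  congr 1
  · rw [← Equiv.sum_comp (Equiv.addLeft s) fun t => heatWeight y C χ f t * φ (f + t • χ)]
    refine sum_congr rfl fun t _ => ?_
    rw [hw, Equiv.coe_addLeft, add_smul, add_assoc]
  · rw [← Equiv.sum_comp (Equiv.addLeft s) fun t => heatWeight y C χ f t]
    exact sum_congr rfl fun t _ => hw t

/-- Two effects are separated: with the weights of the moved state kept, moving the argument costs
`L`; replacing these weights by the old ones costs `theta * L`, because `φ` oscillates by at most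
`L` along `χ`. -/
theorem abs_heatAverage_sub_le [NeZero q] {y : ℝ} (hy : 1 ≤ y) {C D : Finset E}
    {χ ψ : E → ZMod q} (hψ : ∀ e ∉ D, ψ e = 0) {φ : (E → ZMod q) → ℝ} {L : ℝ}
    (hχφ : ∀ (t : ZMod q) f, |φ (f + t • χ) - φ f| ≤ L)
    (hψφ : ∀ (t : ZMod q) f, |φ (f + t • ψ) - φ f| ≤ L) (f : E → ZMod q) (s : ZMod q) :
    |heatAverage y C χ φ (f + s • ψ) - heatAverage y C χ φ f| ≤
      (1 + theta y⁻¹ (C ∩ D).card) * L := by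
  have hy0 : 0 < y := by linarith
  have hyi : 0 ≤ y⁻¹ := by positivity
  have hyi1 : y⁻¹ ≤ 1 := inv_le_one_of_one_le₀ hy
  have hpos := fun f t => heatWeight_pos hy0 C χ f t
  set g := f + s • ψ with hg
  have h1 : |(∑ t, heatWeight y C χ g t * (φ (g + t • χ) - φ (f + t • χ))) /
      ∑ t, heatWeight y C χ g t| ≤ L := by
    refine abs_average_le (hpos g) fun t => ?_
    have := hψφ s (f + t • χ)
    rwa [add_right_comm] at this
  have h2 := abs_average_sub_average_le (u := heatWeight y C χ f) (v := heatWeight y C χ g)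
    (h := fun t => φ (f + t • χ)) (x := (y⁻¹) ^ (C ∩ D).card) (L := L) (by positivity)
    (pow_le_one₀ hyi hyi1) (hpos f) (hpos g) (fun t => heatWeight_le hy hψ f s t) (fun t => by
      have := heatWeight_le hy (C := C) (χ := χ) hψ g (-s) t
      rwa [hg, neg_smul, add_neg_cancel_right] at this) (fun t t' => by
      have := hχφ (t - t') (f + t' • χ)
      rw [add_assoc, ← add_smul, add_sub_cancel] at this
      exact (le_abs_self _).trans this)
  have h3 : heatAverage y C χ φ g - heatAverage y C χ φ f =
      (∑ t, heatWeight y C χ g t * (φ (g + t • χ) - φ (f + t • χ))) /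
        ∑ t, heatWeight y C χ g t +
      ((∑ t, heatWeight y C χ g t * φ (f + t • χ)) / ∑ t, heatWeight y C χ g t -
        (∑ t, heatWeight y C χ f t * φ (f + t • χ)) / ∑ t, heatWeight y C χ f t) := by
    simp only [heatAverage, mul_sub, sum_sub_distrib, sub_div]
    ring
  rw [h3, add_mul, one_mul]
  exact (abs_add_le _ _).trans (add_le_add h1 h2)

/-- Of the `r` generators, `j` contributes zero and the other `r - 1` contribute `1 + theta` each,
in total at most `r - c`. -/
theorem lipAlong_heatStep [NeZero q] [Fintype ι] [DecidableEq ι] {y c : ℝ}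
    (hy : 1 ≤ y) {C : ι → Finset E} {χ : ι → E → ZMod q} (hχ : ∀ i, ∀ e ∉ C i, χ i e = 0)
    (hc : ∀ j, ∑ i ∈ univ.erase j, theta y⁻¹ (C i ∩ C j).card ≤ 1 - c)
    {φ : (E → ZMod q) → ℝ} {L : ℝ} (hL : 0 ≤ L) (hφ : LipAlong χ φ L) :
    LipAlong χ (heatStep y C χ φ) ((1 - c / Fintype.card ι) * L) := by
  intro j s f
  have hr : (0 : ℝ) < Fintype.card ι := by
    have : Nonempty ι := ⟨j⟩
    exact_mod_cast Fintype.card_pos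
  have h1 : |∑ i, (heatAverage y (C i) (χ i) φ (f + s • χ j) - heatAverage y (C i) (χ i) φ f)| ≤
      (Fintype.card ι - c) * L := by
    rw [← add_sum_erase _ _ (mem_univ j), heatAverage_add_smul, sub_self, zero_add]
    refine (abs_sum_le_sum_abs _ _).trans ?_
    refine (sum_le_sum fun i _ =>
      abs_heatAverage_sub_le hy (hχ j) (hφ i) (hφ j) f s).trans ?_
    rw [← sum_mul, sum_add_distrib]
    refine mul_le_mul_of_nonneg_right ?_ hL
    have hcard : ∑ i ∈ univ.erase j, (1 : ℝ) = Fintype.card ι - 1 := by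
      rw [sum_const, card_erase_of_mem (mem_univ j), card_univ, nsmul_eq_mul, mul_one,
        Nat.cast_sub (by exact_mod_cast hr), Nat.cast_one]
    have := hc j
    linarith
  rw [heatStep, heatStep, ← sub_div, ← sum_sub_distrib, abs_div, abs_of_pos hr, div_le_iff₀ hr]
  refine h1.trans (le_of_eq ?_)
  field_simp

theorem lipAlong_iterate_heatStep [NeZero q] [Fintype ι] [DecidableEq ι] {y c : ℝ}
    (hy : 1 ≤ y) {C : ι → Finset E} {χ : ι → E → ZMod q} (hχ : ∀ i, ∀ e ∉ C i, χ i e = 0)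
    (hc : ∀ j, ∑ i ∈ univ.erase j, theta y⁻¹ (C i ∩ C j).card ≤ 1 - c)
    (hc1 : c ≤ Fintype.card ι)
    {φ : (E → ZMod q) → ℝ} {L : ℝ} (hL : 0 ≤ L) (hφ : LipAlong χ φ L) (N : ℕ) :
    LipAlong χ ((heatStep y C χ)^[N] φ) ((1 - c / Fintype.card ι) ^ N * L) := by
  have h0 : 0 ≤ 1 - c / Fintype.card ι :=
    sub_nonneg.2 (div_le_one_of_le₀ hc1 (Nat.cast_nonneg _))
  induction N with
  | zero => simpa using hφ
  | succ N ih =>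
    rw [Function.iterate_succ_apply', pow_succ', mul_assoc]
    exact lipAlong_heatStep hy hχ hc (by positivity) ih

/-- Telescoping from the zero flow, one generator at a time; a coefficient of any size costs a
single move. -/
theorem LipAlong.abs_sum_sub_le [Fintype ι] [DecidableEq ι] {χ : ι → E → ZMod q}
    {φ : (E → ZMod q) → ℝ} {L : ℝ} (hφ : LipAlong χ φ L) (a : ι → ZMod q) :
    |φ (∑ i, a i • χ i) - φ 0| ≤ Fintype.card ι * L := by
  have : ∀ s : Finset ι, |φ (∑ i ∈ s, a i • χ i) - φ 0| ≤ s.card * L := by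
    intro s
    induction s using Finset.induction_on with
    | empty => simp
    | insert i s hi ih =>
      rw [sum_insert hi, card_insert_of_notMem hi, add_comm (a i • χ i)]
      have h1 := hφ i (a i) (∑ i ∈ s, a i • χ i)
      have h2 := abs_sub_le (φ (∑ i ∈ s, a i • χ i + a i • χ i)) (φ (∑ i ∈ s, a i • χ i)) (φ 0)
      push_cast
      linarith
  exact this univ

/-- The weight of a flow, up to a constant factor. -/
noncomputable def flowWeight (y : ℝ) (f : E → ZMod q) : ℝ := ∏ e, if f e = 0 then y else 1

theorem flowWeight_pos {y : ℝ} (hy : 0 < y) (f : E → ZMod q) : 0 < flowWeight y f :=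
  prod_pos fun e _ => by split_ifs <;> linarith

theorem flowWeight_add_smul (y : ℝ) {C : Finset E} {χ : E → ZMod q} (hχ : ∀ e ∉ C, χ e = 0)
    (f : E → ZMod q) (t : ZMod q) :
    flowWeight y (f + t • χ) =
      (∏ e ∈ Cᶜ, if f e = 0 then y else 1) * heatWeight y C χ f t := by
  rw [flowWeight, ← prod_mul_prod_compl C, mul_comm]
  congr 1
  refine prod_congr rfl fun e he => ?_
  simp [hχ e (mem_compl.1 he)]

theorem heatAverage_eq [NeZero q] {y : ℝ} (hy : 0 < y) {C : Finset E} {χ : E → ZMod q}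
    (hχ : ∀ e ∉ C, χ e = 0) (φ : (E → ZMod q) → ℝ) (f : E → ZMod q) :
    heatAverage y C χ φ f = (∑ t : ZMod q, flowWeight y (f + t • χ) * φ (f + t • χ)) /
      ∑ t : ZMod q, flowWeight y (f + t • χ) := by
  have hpos : 0 < ∏ e ∈ Cᶜ, if f e = 0 then y else 1 :=
    prod_pos fun e _ => by split_ifs <;> linarith
  simp only [flowWeight_add_smul y hχ, mul_assoc, ← mul_sum]
  rw [mul_div_mul_left _ _ hpos.ne']
  rfl

-- Stationarity. `F` is invariant under the shifts by `s • χ`, so both sums can be averaged over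
-- them; on each line the heat average is constant and equals the weighted mean.
open Classical in
theorem sum_flowWeight_mul_heatAverage [NeZero q] {y : ℝ} (hy : 0 < y) {C : Finset E}
    {χ : E → ZMod q} (hχ : ∀ e ∉ C, χ e = 0) (F : AddSubgroup (E → ZMod q))
    (hF : ∀ t : ZMod q, t • χ ∈ F) (φ : (E → ZMod q) → ℝ) :
    ∑ f ∈ univ.filter (· ∈ F), flowWeight y f * heatAverage y C χ φ f =
      ∑ f ∈ univ.filter (· ∈ F), flowWeight y f * φ f := by
  have shift : ∀ (ψ : (E → ZMod q) → ℝ) (s : ZMod q),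
      ∑ f ∈ univ.filter (· ∈ F), ψ (f + s • χ) = ∑ f ∈ univ.filter (· ∈ F), ψ f := by
    intro ψ s
    simp only [sum_filter]
    rw [← Equiv.sum_comp (Equiv.addRight (s • χ)) fun f => if f ∈ F then ψ f else 0]
    refine sum_congr rfl fun f _ => ?_
    simp only [Equiv.coe_addRight, F.add_mem_cancel_right (hF s)]
  have hq : (q : ℝ) ≠ 0 := Nat.cast_ne_zero.2 (NeZero.ne q)
  have key : ∀ ψ : (E → ZMod q) → ℝ, (q : ℝ) * ∑ f ∈ univ.filter (· ∈ F), ψ f =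
      ∑ f ∈ univ.filter (· ∈ F), ∑ s : ZMod q, ψ (f + s • χ) := by
    intro ψ
    rw [sum_comm, sum_congr rfl fun s _ => shift ψ s, sum_const, card_univ, ZMod.card,
      nsmul_eq_mul]
  refine mul_left_cancel₀ hq ?_
  rw [key, key]
  refine sum_congr rfl fun f _ => ?_
  simp only [heatAverage_add_smul, ← sum_mul]
  rw [heatAverage_eq hy hχ, mul_div_cancel₀]
  exact (sum_pos (fun t _ => flowWeight_pos hy _) univ_nonempty).ne'

open Classical in
/-- The expectation of `φ` under the flow measure. -/
noncomputable def flowAverage [NeZero q] (y : ℝ) (F : AddSubgroup (E → ZMod q))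
    (φ : (E → ZMod q) → ℝ) : ℝ :=
  (∑ f ∈ univ.filter (· ∈ F), flowWeight y f * φ f) /
    ∑ f ∈ univ.filter (· ∈ F), flowWeight y f

theorem flowAverage_heatStep [NeZero q] [Fintype ι] [Nonempty ι] {y : ℝ} (hy : 0 < y)
    {C : ι → Finset E} {χ : ι → E → ZMod q} (hχ : ∀ i, ∀ e ∉ C i, χ i e = 0)
    (F : AddSubgroup (E → ZMod q)) (hF : ∀ i, ∀ t : ZMod q, t • χ i ∈ F)
    (φ : (E → ZMod q) → ℝ) :
    flowAverage y F (heatStep y C χ φ) = flowAverage y F φ := by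
  classical
  have hr : (Fintype.card ι : ℝ) ≠ 0 := Nat.cast_ne_zero.2 Fintype.card_ne_zero
  unfold flowAverage
  congr 1
  simp only [heatStep, ← mul_div_assoc, mul_sum, ← sum_div]
  rw [sum_comm, sum_congr rfl fun i _ =>
    sum_flowWeight_mul_heatAverage hy (hχ i) F (hF i) φ, sum_const, card_univ, nsmul_eq_mul,
    mul_div_cancel_left₀ _ hr]

theorem flowAverage_iterate_heatStep [NeZero q] [Fintype ι] [Nonempty ι] {y : ℝ} (hy : 0 < y)
    {C : ι → Finset E} {χ : ι → E → ZMod q} (hχ : ∀ i, ∀ e ∉ C i, χ i e = 0)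
    (F : AddSubgroup (E → ZMod q)) (hF : ∀ i, ∀ t : ZMod q, t • χ i ∈ F)
    (φ : (E → ZMod q) → ℝ) (N : ℕ) :
    flowAverage y F ((heatStep y C χ)^[N] φ) = flowAverage y F φ := by
  induction N with
  | zero => rfl
  | succ N ih => rw [Function.iterate_succ_apply', flowAverage_heatStep hy hχ F hF, ih]

theorem abs_sub_flowAverage_le [NeZero q] {y : ℝ} (hy : 0 < y) (F : AddSubgroup (E → ZMod q))
    {φ : (E → ZMod q) → ℝ} {z B : ℝ} (h : ∀ f ∈ F, |φ f - z| ≤ B) :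
    |z - flowAverage y F φ| ≤ B := by
  classical
  have : Nonempty {f // f ∈ univ.filter (· ∈ F)} := ⟨⟨0, by simp⟩⟩
  have h1 := abs_average_le (T := {f // f ∈ univ.filter (· ∈ F)})
    (u := fun f => flowWeight y f.1) (h := fun f => φ f.1 - z) (L := B)
    (fun f => flowWeight_pos hy _) (fun f => h f.1 (mem_filter.1 f.2).2)
  rw [sum_coe_sort (univ.filter (· ∈ F)) fun f => flowWeight y f * (φ f - z),
    sum_coe_sort (univ.filter (· ∈ F)) fun f => flowWeight y f] at h1
  rw [abs_sub_comm]
  convert h1 using 2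
  rw [flowAverage]
  have hpos : 0 < ∑ f ∈ univ.filter (· ∈ F), flowWeight y f :=
    sum_pos (fun f _ => flowWeight_pos hy _) ⟨0, by simp⟩
  simp only [mul_sub, sum_sub_distrib, sub_div, ← sum_mul]
  rw [mul_div_cancel_left₀ _ hpos.ne']

/-- The rate of convergence of the heat bath dynamics, started from the zero flow. -/
theorem abs_iterate_heatStep_sub_flowAverage_le [NeZero q] [Fintype ι] [Nonempty ι]
    [DecidableEq ι] {y c : ℝ}
    (hy : 1 ≤ y) {C : ι → Finset E} {χ : ι → E → ZMod q} (hχ : ∀ i, ∀ e ∉ C i, χ i e = 0)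
    (hc : ∀ j, ∑ i ∈ univ.erase j, theta y⁻¹ (C i ∩ C j).card ≤ 1 - c)
    (hc1 : c ≤ 1) (F : AddSubgroup (E → ZMod q)) (hF : ∀ i, ∀ t : ZMod q, t • χ i ∈ F)
    (hgen : ∀ f ∈ F, ∃ a : ι → ZMod q, f = ∑ i, a i • χ i)
    {φ : (E → ZMod q) → ℝ} {L : ℝ} (hL : 0 ≤ L) (hφ : LipAlong χ φ L) (N : ℕ) :
    |(heatStep y C χ)^[N] φ 0 - flowAverage y F φ| ≤
      Fintype.card ι * ((1 - c / Fintype.card ι) ^ N * L) := by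
  have hy0 : 0 < y := by linarith
  have hr : (1 : ℝ) ≤ Fintype.card ι := by exact_mod_cast Fintype.card_pos
  -- By stationarity `φ` may be replaced by its iterate in the average, and then only the
  -- oscillation of the iterate over `F` matters.
  rw [← flowAverage_iterate_heatStep hy0 hχ F hF φ N]
  refine abs_sub_flowAverage_le hy0 F fun f hf => ?_
  obtain ⟨a, rfl⟩ := hgen f hf
  exact (lipAlong_iterate_heatStep hy hχ hc (hc1.trans hr) hL hφ N).abs_sum_sub_le a

end Chain

end FlowChain

open Finset

/-! ### Flows with values in a ring -/

section RingFlows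

variable {V E R : Type*}

/-- `f` restricted to the edges in `s` is a flow: it is orthogonal to all potential differences. -/
def IsFlowOn [CommRing R] (src tgt : E → V) (s : Finset E) (f : E → R) : Prop :=
  ∀ h : V → R, ∑ e ∈ s, f e * (h (tgt e) - h (src e)) = 0

/-- Flows modulo `q` lift to integer flows. -/
theorem IsFlowOn.exists_lift [DecidableEq V] [DecidableEq E] {q : ℕ} (s : Finset E) :
    ∀ {src tgt : E → V} {f : E → ZMod q}, IsFlowOn src tgt s f →
      ∃ F : E → ℤ, (∀ e ∈ s, (F e : ZMod q) = f e) ∧ IsFlowOn src tgt s F := by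
  induction s using Finset.induction_on with
  | empty => intro src tgt f _; exact ⟨0, by simp, by simp [IsFlowOn]⟩
  | insert e₀ s he₀ ih =>
    intro src tgt f hf
    set a := src e₀ with ha
    set b := tgt e₀ with hb
    -- Contract `e₀` by merging its head `b` into its tail `a`. On the other edges `f` remains a
    -- flow, and a lift exists there by induction.
    set φ : V → V := fun v => if v = b then a else v with hφ
    have hφa : φ a = a := by simp only [hφ]; split_ifs <;> rfl
    have hφb : φ b = a := by simp [hφ]
    obtain ⟨F, hF, hF'⟩ := ih (src := φ ∘ src) (tgt := φ ∘ tgt) (f := f) (fun h => by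
      have := hf (h ∘ φ)
      rw [sum_insert he₀] at this
      simpa [← ha, ← hb, hφa, hφb] using this)
    set c : ℤ := ∑ e ∈ s, F e * ((if tgt e = b then 1 else 0) - if src e = b then 1 else 0) with hc
    obtain ⟨z, hz⟩ := ZMod.intCast_surjective (f e₀)
    -- A loop is unconstrained, so any integer representative works. Otherwise conservation at `b`
    -- forces `-c`, which reduces to `f e₀` because `f` is conserved at `b`.
    refine ⟨Function.update F e₀ (if a = b then z else -c), ?_, ?_⟩
    · intro e he
      rcases Finset.mem_insert.1 he with rfl | he
      · rw [Function.update_self]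
        split_ifs with hab
        · exact hz
        · have := hf fun v => if v = b then 1 else 0
          rw [sum_insert he₀, ← ha, ← hb, if_pos rfl, if_neg hab, sub_zero, mul_one] at this
          rw [eq_neg_of_add_eq_zero_left this, hc]
          push_cast
          congr 1
          refine sum_congr rfl fun e he => ?_
          rw [hF e he]
      · rw [Function.update_of_ne (ne_of_mem_of_not_mem he he₀), hF e he]
    · intro h
      -- Every potential is one pulled back from the contraction plus a multiple of the indicator of
      -- `b`; the first part is handled by induction, the second by the choice of the value on `e₀`.
      have hdec : ∀ v, h v = h (φ v) + (h b - h a) * if v = b then 1 else 0 := by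
        intro v
        by_cases hv : v = b <;> simp [hφ, hv]
      have h1 : ∑ e ∈ s, Function.update F e₀ (if a = b then z else -c) e *
          (h (tgt e) - h (src e)) = (h b - h a) * c := by
        have h2 : ∑ e ∈ s, F e * (h (φ (tgt e)) - h (φ (src e))) = 0 := hF' h
        rw [hc, mul_sum]
        refine Eq.trans ?_ ((congrArg (· + _) h2).trans (zero_add _))
        rw [← sum_add_distrib]
        refine sum_congr rfl fun e he => ?_
        rw [Function.update_of_ne (ne_of_mem_of_not_mem he he₀), hdec (tgt e), hdec (src e)]
        ring
      rw [sum_insert he₀, h1, Function.update_self, ← ha, ← hb]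
      split_ifs with hab
      · simp [hab]
      · ring

end RingFlows

namespace Multigraph

variable {n m : ℕ}

/-- Summation by parts in one direction, testing against indicators of vertices in the other. -/
theorem mem_flows_iff (G : Multigraph n m) (f : Fin m → ℤ) :
    f ∈ G.flows ↔ IsFlowOn G.src G.tgt univ f := by
  have hfib : ∀ (p : Fin m → Fin n) (h : Fin n → ℤ), ∑ e, f e * h (p e) =
      ∑ v, h v * ∑ e ∈ univ.filter (fun e => p e = v), f e := by
    intro p h
    rw [← sum_fiberwise (s := univ) (g := p)]
    refine sum_congr rfl fun v _ => ?_
    rw [mul_sum]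
    refine sum_congr rfl fun e he => ?_
    rw [(mem_filter.1 he).2, mul_comm]
  have hmem : f ∈ G.flows ↔ ∀ v : Fin n, ∑ e ∈ univ.filter (fun e => G.tgt e = v), f e =
    ∑ e ∈ univ.filter (fun e => G.src e = v), f e := Iff.rfl
  rw [hmem]
  constructor
  · intro hf h
    simp only [mul_sub, sum_sub_distrib]
    rw [hfib, hfib, sub_eq_zero]
    exact sum_congr rfl fun v _ => by rw [hf v]
  · intro hf v
    have := hf (Pi.single v 1)
    simp only [mul_sub, sum_sub_distrib] at this
    rw [hfib, hfib, sub_eq_zero] at this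
    simpa [Pi.single_apply] using this

/-- The group of flows with values in `ℤ/q`. -/
def modFlows (G : Multigraph n m) (q : ℕ) : AddSubgroup (Fin m → ZMod q) where
  carrier := {f | IsFlowOn G.src G.tgt univ f}
  zero_mem' := by intro h; simp
  add_mem' := by
    intro f g hf hg h
    have := congrArg₂ (· + ·) (hf h) (hg h)
    simpa [add_mul, sum_add_distrib] using this
  neg_mem' := by
    intro f hf h
    have := congrArg Neg.neg (hf h)
    simpa [neg_mul, sum_neg_distrib] using this

theorem cast_mem_modFlows {G : Multigraph n m} (q : ℕ) {f : Fin m → ℤ} (hf : f ∈ G.flows) :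
    (fun e => (f e : ZMod q)) ∈ G.modFlows q := by
  intro h
  choose h' hh' using fun v => ZMod.intCast_surjective (h v)
  have := congrArg (Int.cast : ℤ → ZMod q) ((G.mem_flows_iff f).1 hf h')
  push_cast at this
  simpa only [hh'] using this

end Multigraph

namespace EvenGeneratingSet

variable {n m r : ℕ} {G : Multigraph n m}

/-- The signed indicators modulo `q`. -/
def modχ (S : EvenGeneratingSet G r) (q : ℕ) (i : Fin r) (e : Fin m) : ZMod q := (S.χ i e : ZMod q)

theorem modχ_of_notMem (S : EvenGeneratingSet G r) (q : ℕ) (i : Fin r) (e : Fin m)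
    (he : e ∉ S.C i) : S.modχ q i e = 0 := by
  simp [modχ, (S.indicator i).1 e he]

theorem smul_modχ_mem (S : EvenGeneratingSet G r) (q : ℕ) (i : Fin r) (t : ZMod q) :
    t • S.modχ q i ∈ G.modFlows q := by
  intro h
  have h1 : S.χ i ∈ G.flows := by
    rw [← S.span_eq]
    exact Submodule.subset_span ⟨i, rfl⟩
  have h2 := congrArg (t * ·) (Multigraph.cast_mem_modFlows q h1 h)
  simpa [mul_sum, mul_assoc, modχ] using h2

/-- Generation over `ℤ` is what is needed here: the flow is lifted to `ℤ`, expanded, and reduced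
modulo `q`. -/
theorem exists_eq_sum_smul_modχ (S : EvenGeneratingSet G r) (q : ℕ) {f : Fin m → ZMod q}
    (hf : f ∈ G.modFlows q) : ∃ a : Fin r → ZMod q, f = ∑ i, a i • S.modχ q i := by
  obtain ⟨F, hF, hF'⟩ := IsFlowOn.exists_lift univ hf
  rw [← G.mem_flows_iff, ← S.span_eq, Submodule.mem_span_range_iff_exists_fun] at hF'
  obtain ⟨c, hc⟩ := hF'
  refine ⟨fun i => (c i : ZMod q), ?_⟩
  funext e
  rw [← hF e (mem_univ e), ← hc]
  simp [modχ]

end EvenGeneratingSet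

/-! ### From flows to colourings -/

namespace Multigraph

variable {n m : ℕ}

/-- The colourings that are constant along the edges in `A`. -/
def compatible (G : Multigraph n m) (Q : Type*) [Fintype Q] [DecidableEq Q] (A : Fin m → Bool) :
    Finset (Fin n → Q) :=
  univ.filter fun σ => ∀ e, A e = true → σ (G.src e) = σ (G.tgt e)

theorem compatible_nonempty (G : Multigraph n m) (Q : Type*) [Fintype Q] [DecidableEq Q]
    [Nonempty Q] (A : Fin m → Bool) : (G.compatible Q A).Nonempty :=
  ⟨fun _ => Classical.arbitrary Q, by simp [compatible]⟩

theorem card_compatible_congr (G : Multigraph n m) {Q Q' : Type*} [Fintype Q] [DecidableEq Q]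
    [Fintype Q'] [DecidableEq Q'] (u : Q ≃ Q') (A : Fin m → Bool) :
    (G.compatible Q A).card = (G.compatible Q' A).card := by
  refine card_bij (fun σ _ v => u (σ v)) ?_ ?_ ?_
  · intro σ hσ
    simpa [compatible] using hσ
  · intro σ _ τ _ h
    funext v
    exact u.injective (congrFun h v)
  · intro τ hτ
    refine ⟨fun v => u.symm (τ v), ?_, by simp⟩
    simpa [compatible] using hτ

open Classical in
/-- The flows supported in `A` and the colourings compatible with `A` are dual to each other. -/
theorem card_flows_mul_pow (G : Multigraph n m) (q : ℕ) [NeZero q] (A : Fin m → Bool) :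
    ((univ.filter fun f => f ∈ G.modFlows q ∧ ∀ e, A e = false → f e = 0).card : ℝ) * q ^ n =
      q ^ (univ.filter fun e => A e = true).card * (G.compatible (ZMod q) A).card := by
  have hψ := ZMod.isPrimitive_stdAddChar q
  set ψ : AddChar (ZMod q) ℂ := ZMod.stdAddChar
  -- The sum of `ψ (b f h)` over all potentials `h` and all `f` supported in `A` is evaluated in
  -- both orders.
  set b : (Fin m → ZMod q) → (Fin n → ZMod q) → ZMod q :=
    fun f h => ∑ e, f e * (h (G.tgt e) - h (G.src e)) with hb
  have badd : ∀ f h h', b f (h + h') = b f h + b f h' := by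
    intro f h h'
    simp only [hb, ← sum_add_distrib, Pi.add_apply]
    exact sum_congr rfl fun e _ => by ring
  have bsmul : ∀ f (t : ZMod q) h, b f (t • h) = t * b f h := by
    intro f t h
    simp only [hb, mul_sum, Pi.smul_apply, smul_eq_mul]
    exact sum_congr rfl fun e _ => by ring
  have h1 : ∀ f, ∑ h, ψ (b f h) = if f ∈ G.modFlows q then (q : ℂ) ^ n else 0 := by
    intro f
    split_ifs with hf
    · have : ∀ h, b f h = 0 := hf
      simp [this, ZMod.card]
    · have : ∃ h₀, b f h₀ ≠ 0 := by
        by_contra! hcon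
        exact hf hcon
      obtain ⟨h₀, hh₀⟩ := this
      -- The character is primitive, so it is nontrivial on multiples of a nonzero value; shifting
      -- by `t • h₀` then forces the sum to vanish.
      obtain ⟨t, ht⟩ : ∃ t, ψ (t * b f h₀) ≠ 1 := by
        by_contra! hcon
        have := AddChar.sum_mulShift (b f h₀) hψ
        simp only [hcon, if_neg hh₀, sum_const, card_univ, ZMod.card, nsmul_eq_mul, mul_one] at this
        exact NeZero.ne q (by exact_mod_cast this)
      have hshift : ∑ h, ψ (b f h) = ψ (t * b f h₀) * ∑ h, ψ (b f h) := by
        conv_lhs => rw [← Equiv.sum_comp (Equiv.addLeft (t • h₀)) fun h => ψ (b f h)]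
        rw [mul_sum]
        refine sum_congr rfl fun h _ => ?_
        rw [Equiv.coe_addLeft, badd, bsmul, AddChar.map_add_eq_mul]
      have : (1 - ψ (t * b f h₀)) * ∑ h, ψ (b f h) = 0 := by
        rw [sub_mul, one_mul, ← hshift, sub_self]
      exact (mul_eq_zero.1 this).resolve_left (sub_ne_zero.2 ht.symm)
  have h2 : ∀ h : Fin n → ZMod q,
      ∑ f ∈ univ.filter (fun f : Fin m → ZMod q => ∀ e, A e = false → f e = 0), ψ (b f h) =
        if h ∈ G.compatible (ZMod q) A then
          (q : ℂ) ^ (univ.filter fun e => A e = true).card else 0 := by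
    intro h
    -- For fixed `h` the sum factorises over the edges of `A`, and each factor is `q` or `0` by
    -- orthogonality.
    have e1 : ∀ f, ψ (b f h) = ∏ e, ψ (f e * (h (G.tgt e) - h (G.src e))) := by
      intro f
      exact map_prod ψ.toMonoidHom (fun e => Multiplicative.ofAdd (f e * (h (G.tgt e) - h (G.src e)))) univ
    have e2 : (univ.filter fun f : Fin m → ZMod q => ∀ e, A e = false → f e = 0) =
        Fintype.piFinset fun e => if A e = true then univ else {0} := by
      ext f
      simp only [mem_filter, mem_univ, true_and, Fintype.mem_piFinset]
      refine forall_congr' fun e => ?_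
      cases A e <;> simp
    simp only [e1, e2]
    have e4 := prod_univ_sum (fun e => if A e = true then (univ : Finset (ZMod q)) else {0})
      fun e z => ψ (z * (h (G.tgt e) - h (G.src e)))
    rw [← e4]
    have e3 : ∀ e, ∑ z ∈ (if A e = true then (univ : Finset (ZMod q)) else {0}),
        ψ (z * (h (G.tgt e) - h (G.src e))) =
        if A e = true then (if h (G.src e) = h (G.tgt e) then (q : ℂ) else 0) else 1 := by
      intro e
      split_ifs with hA hh
      · rw [AddChar.sum_mulShift _ hψ, if_pos (sub_eq_zero.2 hh.symm), ZMod.card]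
      · rw [AddChar.sum_mulShift _ hψ, if_neg (sub_ne_zero.2 (Ne.symm ‹_›)), Nat.cast_zero]
      · simp
    simp only [e3]
    rw [prod_ite, prod_const_one, mul_one]
    split_ifs with hh
    · rw [compatible, mem_filter] at hh
      rw [prod_congr rfl fun e he => if_pos (hh.2 e (mem_filter.1 he).2), prod_const]
    · have : ∃ e, A e = true ∧ h (G.src e) ≠ h (G.tgt e) := by
        by_contra! hcon
        exact hh (by simpa [compatible] using hcon)
      obtain ⟨e, he, hne⟩ := this
      exact prod_eq_zero (mem_filter.2 ⟨mem_univ e, he⟩) (if_neg hne)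
  have h3 : (((univ.filter fun f => f ∈ G.modFlows q ∧ ∀ e, A e = false → f e = 0).card : ℝ) *
      q ^ n : ℂ) =
      q ^ (univ.filter fun e => A e = true).card * (G.compatible (ZMod q) A).card := by
    have e1 : ∑ f ∈ univ.filter (fun f : Fin m → ZMod q => ∀ e, A e = false → f e = 0),
        ∑ h, ψ (b f h) =
        ((univ.filter fun f => f ∈ G.modFlows q ∧ ∀ e, A e = false → f e = 0).card : ℂ) *
          q ^ n := by
      simp only [h1]
      rw [← sum_filter, sum_const, nsmul_eq_mul, filter_filter]
      congr 3
      ext f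
      simp [and_comm]
    rw [sum_comm] at e1
    simp only [h2] at e1
    rw [← sum_filter, sum_const, nsmul_eq_mul, filter_univ_mem] at e1
    push_cast
    rw [← e1, mul_comm]
  exact_mod_cast h3

/-- The probability that the edge with flow value `z` is open, respectively closed. -/
noncomputable def edgeProb {q : ℕ} (x : ℝ) (z : ZMod q) (b : Bool) : ℝ :=
  if z = 0 then (if b then x else 1 - x) else (if b then 1 else 0)

/-- A zero edge contributes `y * y⁻¹ = 1` when open and `y - 1` when closed; a nonzero edge
contributes `1` when open and excludes being closed. -/
theorem flowWeight_mul_prod_edgeProb {q : ℕ} {y : ℝ} (hy : y ≠ 0) (f : Fin m → ZMod q)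
    (A : Fin m → Bool) : FlowChain.flowWeight y f * ∏ e, edgeProb y⁻¹ (f e) (A e) =
      if ∀ e, A e = false → f e = 0 then
        (y - 1) ^ (univ.filter fun e => A e = false).card else 0 := by
  have h1 : FlowChain.flowWeight y f * ∏ e, edgeProb y⁻¹ (f e) (A e) =
      ∏ e, if A e = false then (if f e = 0 then y - 1 else 0) else 1 := by
    rw [FlowChain.flowWeight, ← prod_mul_distrib]
    refine prod_congr rfl fun e _ => ?_
    by_cases hf : f e = 0 <;> cases A e <;> simp [edgeProb, hf, hy, mul_sub]
  rw [h1, prod_ite, prod_const_one, mul_one]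
  split_ifs with h
  · rw [prod_congr rfl fun e he => if_pos (h e (mem_filter.1 he).2), prod_const]
  · push Not at h
    obtain ⟨e, he, hne⟩ := h
    exact prod_eq_zero (mem_filter.2 ⟨mem_univ e, he⟩) (if_neg hne)

/-- The Fortuin–Kasteleyn expansion: each monochromatic edge contributes `(w - 1) + 1`, each other
edge `1`. -/
theorem sum_prod_mono (G : Multigraph n m) {q : ℕ} (w : ℝ) (σ : Fin n → Fin q) :
    ∑ A : Fin m → Bool, (if σ ∈ G.compatible (Fin q) A then
      (w - 1) ^ (univ.filter fun e => A e = true).card else 0) = w ^ G.monoEdges σ := by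
  have h1 : ∀ A : Fin m → Bool, (if σ ∈ G.compatible (Fin q) A then
      (w - 1) ^ (univ.filter fun e => A e = true).card else 0) =
      ∏ e, if A e = true then (if σ (G.src e) = σ (G.tgt e) then w - 1 else 0) else 1 := by
    intro A
    rw [prod_ite, prod_const_one, mul_one]
    split_ifs with h
    · rw [compatible, mem_filter] at h
      rw [prod_congr rfl fun e he => if_pos (h.2 e (mem_filter.1 he).2), prod_const]
    · have : ∃ e, A e = true ∧ σ (G.src e) ≠ σ (G.tgt e) := by
        by_contra! hcon
        exact h (by simpa [compatible] using hcon)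
      obtain ⟨e, he, hne⟩ := this
      exact (prod_eq_zero (mem_filter.2 ⟨mem_univ e, he⟩) (if_neg hne)).symm
  simp only [h1]
  have h2 := prod_univ_sum (fun _ : Fin m => (univ : Finset Bool)) fun e (b : Bool) =>
    if b = true then (if σ (G.src e) = σ (G.tgt e) then w - 1 else 0) else (1 : ℝ)
  rw [Fintype.piFinset_univ] at h2
  rw [← h2, monoEdges, ← prod_const, prod_filter]
  refine prod_congr rfl fun e _ => ?_
  rw [Fintype.sum_bool]
  by_cases h : σ (G.src e) = σ (G.tgt e) <;> simp [h]

open Classical in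
/-- Opening the edges off the support of a random flow with probability `1/y` each and colouring
the components uniformly at random yields the Potts measure, up to normalisation. -/
theorem sum_flowWeight_mul_colourProb (G : Multigraph n m) {q : ℕ} [NeZero q] {w y : ℝ}
    (hw : 1 < w) (hy : y = (w + (q - 1)) / (w - 1)) (σ : Fin n → Fin q) :
    ∑ f ∈ univ.filter (· ∈ G.modFlows q), FlowChain.flowWeight y f *
      ∑ A, (∏ e, edgeProb y⁻¹ (f e) (A e)) *
        (if σ ∈ G.compatible (Fin q) A then ((G.compatible (Fin q) A).card : ℝ)⁻¹ else 0) =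
      (q : ℝ) ^ m / ((q : ℝ) ^ n * (w - 1) ^ m) * w ^ G.monoEdges σ := by
  have hq : (1 : ℝ) ≤ q := by exact_mod_cast NeZero.one_le
  have hq0 : (q : ℝ) ≠ 0 := by linarith
  have hw0 : w - 1 ≠ 0 := by linarith
  have hypos : 0 < y := by rw [hy]; exact div_pos (by linarith) (by linarith)
  have hy1 : y - 1 = q / (w - 1) := by rw [hy]; field_simp; ring
  simp only [mul_sum, ← mul_assoc, flowWeight_mul_prod_edgeProb hypos.ne']
  rw [sum_comm, ← sum_prod_mono, mul_sum]
  refine sum_congr rfl fun A _ => ?_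
  rw [← sum_mul, ← sum_filter, filter_filter, sum_const, nsmul_eq_mul]
  split_ifs with hσ
  -- Duality turns the number of flows divided by the number of colourings into `q ^ k / q ^ n`;
  -- together with `(q / (w - 1)) ^ l` and `k + l = m` this leaves `(w - 1) ^ k` times the constant.
  · have h1 := G.card_flows_mul_pow q A
    rw [G.card_compatible_congr (ZMod.finEquiv q).symm.toEquiv A] at h1
    have hcard : ((G.compatible (Fin q) A).card : ℝ) ≠ 0 :=
      Nat.cast_ne_zero.2 (card_ne_zero.2 ⟨σ, hσ⟩)
    have hm : (univ.filter fun e => A e = true).card + (univ.filter fun e => A e = false).card =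
        m := by
      have := card_filter_add_card_filter_not (s := (univ : Finset (Fin m))) fun e => A e = true
      simpa using this
    set k := (univ.filter fun e => A e = true).card
    set l := (univ.filter fun e => A e = false).card
    set c := ((univ.filter fun f => f ∈ G.modFlows q ∧ ∀ e, A e = false → f e = 0).card : ℝ)
    have hc : c = q ^ k * (G.compatible (Fin q) A).card / q ^ n := by
      rw [← h1, mul_div_cancel_right₀ _ (pow_ne_zero _ hq0)]
    have e1 : (q : ℝ) ^ m = q ^ k * q ^ l := by rw [← pow_add, hm]
    have e2 : (w - 1) ^ m = (w - 1) ^ k * (w - 1) ^ l := by rw [← pow_add, hm]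
    rw [hc, hy1, e1, e2, div_pow]
    field_simp
  · simp

/-- The constant need not be computed: summing over `σ` shows that it also relates the two
normalisations. -/
theorem flowAverage_eq_potts (G : Multigraph n m) {q : ℕ} [NeZero q] {w y : ℝ}
    (hw : 1 < w) (hy : y = (w + (q - 1)) / (w - 1)) (K : (Fin m → ZMod q) → (Fin n → Fin q) → ℝ)
    (hK1 : ∀ f, ∑ σ, K f σ = 1)
    (hK : ∀ f σ, K f σ = ∑ A, (∏ e, edgeProb y⁻¹ (f e) (A e)) *
        (if σ ∈ G.compatible (Fin q) A then ((G.compatible (Fin q) A).card : ℝ)⁻¹ else 0))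
    (σ : Fin n → Fin q) :
    FlowChain.flowAverage y (G.modFlows q) (fun f => K f σ) = G.potts q w σ := by
  classical
  have hq : (1 : ℝ) ≤ q := by exact_mod_cast NeZero.one_le
  have hN : ∀ σ, ∑ f ∈ univ.filter (· ∈ G.modFlows q), FlowChain.flowWeight y f * K f σ =
      (q : ℝ) ^ m / ((q : ℝ) ^ n * (w - 1) ^ m) * w ^ G.monoEdges σ := by
    intro σ
    rw [← G.sum_flowWeight_mul_colourProb hw hy σ]
    exact sum_congr rfl fun f _ => by rw [hK]
  have hD : ∑ f ∈ univ.filter (· ∈ G.modFlows q), FlowChain.flowWeight y f =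
      (q : ℝ) ^ m / ((q : ℝ) ^ n * (w - 1) ^ m) * G.pottsZ q w := by
    rw [pottsZ, mul_sum, sum_congr rfl fun σ _ => (hN σ).symm, sum_comm]
    refine sum_congr rfl fun f _ => ?_
    rw [← mul_sum, hK1, mul_one]
  have hpos : (q : ℝ) ^ m / ((q : ℝ) ^ n * (w - 1) ^ m) ≠ 0 := by
    have : 0 < w - 1 := by linarith
    have : (0 : ℝ) < q := by linarith
    positivity
  rw [FlowChain.flowAverage, hN, hD, mul_div_mul_left _ _ hpos, potts]

end Multigraph

namespace RAM

/-! ### The ideal sampler -/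

section Expectation

variable {α β : Type*} [Fintype α] [Fintype β]

/-- The expectation of a function on a finite probability space. -/
noncomputable def expect (p : PMF α) (φ : α → ℝ) : ℝ := ∑ x, (p x).toReal * φ x

omit [Fintype β] in
theorem toReal_bind_apply (p : PMF α) (k : α → PMF β) (y : β) :
    (p.bind k y).toReal = ∑ x, (p x).toReal * (k x y).toReal := by
  rw [PMF.bind_apply, tsum_fintype, ENNReal.toReal_sum]
  · simp only [ENNReal.toReal_mul]
  · exact fun x _ => ENNReal.mul_ne_top (p.apply_ne_top x) ((k x).apply_ne_top y)

theorem expect_bind (p : PMF α) (k : α → PMF β) (φ : β → ℝ) :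
    expect (p.bind k) φ = expect p fun x => expect (k x) φ := by
  simp only [expect, toReal_bind_apply, sum_mul, mul_sum, mul_assoc]
  exact sum_comm

theorem expect_pure (x : α) (φ : α → ℝ) : expect (PMF.pure x) φ = φ x := by
  classical
  rw [expect, sum_eq_single x]
  · simp
  · intro y _ hy
    simp [PMF.pure_apply, hy]
  · simp

theorem expect_map (p : PMF α) (f : α → β) (φ : β → ℝ) :
    expect (p.map f) φ = expect p fun x => φ (f x) := by
  rw [← PMF.bind_pure_comp, expect_bind]
  simp only [Function.comp_apply, expect_pure]

theorem sum_toReal_eq_one (p : PMF α) : ∑ x, (p x).toReal = 1 := by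
  rw [← ENNReal.toReal_sum fun x _ => p.apply_ne_top x, ← tsum_fintype (L := .unconditional _),
    p.tsum_coe, ENNReal.toReal_one]

theorem expect_proportional [Nonempty α] (u : α → ℝ) (hu : ∀ i, 0 < u i) (φ : α → ℝ) :
    expect (proportional u hu) φ = (∑ i, u i * φ i) / ∑ i, u i := by
  have : 0 < ∑ i, u i := sum_pos (fun i _ => hu i) univ_nonempty
  rw [expect, sum_div]
  refine sum_congr rfl fun i _ => ?_
  rw [proportional_apply, ENNReal.toReal_ofReal (div_nonneg (hu i).le this.le)]
  ring

theorem toReal_proportional [Nonempty α] (u : α → ℝ) (hu : ∀ i, 0 < u i) (i : α) :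
    (proportional u hu i).toReal = u i / ∑ j, u j := by
  rw [proportional_apply, ENNReal.toReal_ofReal]
  exact div_nonneg (hu i).le (sum_nonneg fun i _ => (hu i).le)

/-- Independent choices, made one after the other. -/
noncomputable def fillKernel {K : ℕ} (ν : Fin K → PMF β) (j : ℕ) (g : Fin K → β) :
    PMF (Fin K → β) :=
  if h : j < K then (ν ⟨j, h⟩).map fun b => Function.update g ⟨j, h⟩ b else PMF.pure g

-- The generalisation to a start at `j` is needed for the induction: coordinates below `j` are
-- frozen, the remaining ones are independent.
omit [Fintype β] in
theorem iterKernel_fillKernel_apply [DecidableEq β] {K : ℕ} (ν : Fin K → PMF β)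
    (g : Fin K → β) : ∀ (d j : ℕ) (g₀ : Fin K → β), j + d = K →
      iterKernel (fillKernel ν) j d g₀ g = if ∀ i : Fin K, (i : ℕ) < j → g i = g₀ i then
        ∏ i : Fin K, (if (i : ℕ) < j then 1 else ν i (g i)) else 0 := by
  intro d
  induction d with
  | zero =>
    intro j g₀ hj
    rw [Nat.add_zero] at hj
    subst hj
    simp only [iterKernel, PMF.pure_apply, Fin.is_lt, if_true, forall_const, prod_const_one,
      funext_iff]
  | succ d ih =>
    intro j g₀ hj
    have hjK : j < K := by omega
    rw [iterKernel, fillKernel, dif_pos hjK, PMF.bind_map, PMF.bind_apply,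
      tsum_eq_single (g ⟨j, hjK⟩)]
    · rw [Function.comp_apply, ih (j + 1) _ (by omega)]
      have hiff : (∀ i : Fin K, (i : ℕ) < j + 1 →
          g i = Function.update g₀ ⟨j, hjK⟩ (g ⟨j, hjK⟩) i) ↔
          ∀ i : Fin K, (i : ℕ) < j → g i = g₀ i := by
        refine forall_congr' fun i => ?_
        by_cases hi : i = ⟨j, hjK⟩
        · subst hi; simp
        · rw [Function.update_of_ne hi]
          have : (i : ℕ) ≠ j := fun h => hi (Fin.ext h)
          have : (i : ℕ) < j + 1 ↔ (i : ℕ) < j := by omega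
          rw [this]
      simp only [hiff]
      split_ifs with h
      · rw [← mul_prod_erase univ _ (mem_univ (⟨j, hjK⟩ : Fin K)),
          ← mul_prod_erase univ (fun i : Fin K => if (i : ℕ) < j then 1 else ν i (g i))
            (mem_univ (⟨j, hjK⟩ : Fin K))]
        simp only [lt_add_iff_pos_right, zero_lt_one, if_true, one_mul, lt_self_iff_false, if_false]
        congr 1
        refine prod_congr rfl fun i hi => ?_
        have : (i : ℕ) ≠ j := fun h => (mem_erase.1 hi).1 (Fin.ext h)
        have : (i : ℕ) < j + 1 ↔ (i : ℕ) < j := by omega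
        simp only [this]
      · rw [mul_zero]
    · intro b hb
      rw [Function.comp_apply, ih (j + 1) _ (by omega), if_neg, mul_zero]
      intro h
      have := h ⟨j, hjK⟩ (Nat.lt_succ_self j)
      rw [Function.update_self] at this
      exact hb this.symm

/-- The product of the distributions `ν i`. -/
noncomputable def productPMF {K : ℕ} (ν : Fin K → PMF β) (g₀ : Fin K → β) : PMF (Fin K → β) :=
  iterKernel (fillKernel ν) 0 K g₀

omit [Fintype β] in
theorem productPMF_apply [DecidableEq β] {K : ℕ} (ν : Fin K → PMF β) (g₀ g : Fin K → β) :
    productPMF ν g₀ g = ∏ i, ν i (g i) := by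
  rw [productPMF, iterKernel_fillKernel_apply ν g K 0 g₀ (zero_add K)]
  simp

end Expectation

/-! ### The idealised Markov chain and its distance from the Potts measure -/

section Sampler

variable {n m r q : ℕ} [NeZero q] {G : Multigraph n m}

open Classical in
/-- One step of the heat bath dynamics on flows. -/
noncomputable def glauber (S : EvenGeneratingSet G r) {y : ℝ} (hy : 0 < y) (f : Fin m → ZMod q) :
    PMF (Fin m → ZMod q) :=
  if _h : Nonempty (Fin r) then
    (proportional (fun _ : Fin r => 1) fun _ => one_pos).bind fun i =>
      (proportional (FlowChain.heatWeight y (S.C i) (S.modχ q i) f)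
        (FlowChain.heatWeight_pos hy _ _ _)).map fun t => f + t • S.modχ q i
  else PMF.pure f

theorem expect_glauber (S : EvenGeneratingSet G r) {y : ℝ} (hy : 0 < y) [Nonempty (Fin r)]
    (f : Fin m → ZMod q) (φ : (Fin m → ZMod q) → ℝ) :
    expect (glauber S hy f) φ = FlowChain.heatStep y S.C (S.modχ q) φ f := by
  rw [glauber, dif_pos ‹Nonempty (Fin r)›, expect_bind]
  simp only [expect_map, expect_proportional, one_mul, sum_const, card_univ, nsmul_eq_mul, mul_one]
  rfl

/-- Duality between kernels and operators: the first step of the chain is the outermost application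
of `heatStep`. -/
theorem expect_iterKernel_glauber (S : EvenGeneratingSet G r) {y : ℝ} (hy : 0 < y)
    [Nonempty (Fin r)] (φ : (Fin m → ZMod q) → ℝ) (d : ℕ) : ∀ (j : ℕ) (f : Fin m → ZMod q),
    expect (iterKernel (fun _ => glauber S hy) j d f) φ =
      (FlowChain.heatStep y S.C (S.modχ q))^[d] φ f := by
  induction d with
  | zero => intro j f; exact expect_pure f φ
  | succ d ih =>
    intro j f
    rw [iterKernel, expect_bind, Function.iterate_succ_apply']
    simp only [ih]
    exact expect_glauber S hy f _

/-- The law of the state of an edge with flow value `z`; `true` means open. -/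
noncomputable def edgeLaw {w : ℝ} (hw : 1 < w) (z : ZMod q) : PMF Bool :=
  if z = 0 then proportional (fun b : Bool => if b then w - 1 else (q : ℝ)) (by
    intro b
    have : (0 : ℝ) < q := Nat.cast_pos.2 (Nat.pos_of_neZero q)
    cases b
    · simpa using this
    · simpa using hw)
  else PMF.pure true

theorem toReal_edgeLaw {w y : ℝ} (hw : 1 < w) (hy : y = (w + (q - 1)) / (w - 1)) (z : ZMod q)
    (b : Bool) : (edgeLaw hw z b).toReal = Multigraph.edgeProb y⁻¹ z b := by
  have hq : (0 : ℝ) < q := Nat.cast_pos.2 (Nat.pos_of_neZero q)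
  have h1 : w + (q - 1) ≠ 0 := by linarith
  rw [edgeLaw, Multigraph.edgeProb]
  split_ifs with hz hb hb
  · subst hb
    rw [toReal_proportional, Fintype.sum_bool, hy, inv_div]
    simp only [if_true, Bool.false_eq_true, if_false]
    congr 1
    ring
  · rw [Bool.not_eq_true] at hb
    subst hb
    rw [toReal_proportional, Fintype.sum_bool, hy, inv_div]
    simp only [if_true, Bool.false_eq_true, if_false]
    rw [eq_sub_iff_add_eq, div_add_div _ _ (by linarith) h1, div_eq_one_iff_eq]
    · ring
    · exact mul_ne_zero (by linarith) h1
  · simp [hb]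
  · simp [hb]

/-- A uniformly random colouring that is constant along the edges in `A`. -/
noncomputable def uniformCompatible (G : Multigraph n m) (q : ℕ) [NeZero q] (A : Fin m → Bool) :
    PMF (Fin n → Fin q) :=
  PMF.uniformOfFinset (G.compatible (Fin q) A) (G.compatible_nonempty (Fin q) A)

/-- The random colouring that is obtained from a flow. -/
noncomputable def colourLaw (G : Multigraph n m) {w : ℝ} (hw : 1 < w) (f : Fin m → ZMod q) :
    PMF (Fin n → Fin q) :=
  (productPMF (fun e => edgeLaw hw (f e)) fun _ => false).bind (uniformCompatible G q)

theorem toReal_colourLaw (G : Multigraph n m) {w y : ℝ} (hw : 1 < w)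
    (hy : y = (w + (q - 1)) / (w - 1)) (f : Fin m → ZMod q) (σ : Fin n → Fin q) :
    (colourLaw G hw f σ).toReal = ∑ A, (∏ e, Multigraph.edgeProb y⁻¹ (f e) (A e)) *
      (if σ ∈ G.compatible (Fin q) A then ((G.compatible (Fin q) A).card : ℝ)⁻¹ else 0) := by
  rw [colourLaw, toReal_bind_apply]
  refine sum_congr rfl fun A _ => ?_
  congr 1
  · rw [productPMF_apply, ENNReal.toReal_prod]
    exact prod_congr rfl fun e _ => toReal_edgeLaw hw hy _ _
  · rw [uniformCompatible, PMF.uniformOfFinset_apply]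
    split_ifs <;> simp

/-- The ideal sampler is close to the Potts measure. -/
theorem ideal_sampler_tv (S : EvenGeneratingSet G r) {w y c : ℝ} (hw : 1 < w)
    (hy : y = (w + (q - 1)) / (w - 1)) (hy0 : 0 < y) (hc1 : c ≤ 1)
    (hc : ∀ j, ∑ i ∈ univ.erase j, FlowChain.theta y⁻¹ (S.C i ∩ S.C j).card ≤ 1 - c)
    (N : ℕ) {δ : ℝ} (hδ : (r : ℝ) * (1 - c / r) ^ N ≤ δ) :
    (1 / 2 : ℝ) * ∑ σ, |(((iterKernel (fun _ => glauber S hy0) 0 N (0 : Fin m → ZMod q)).bind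
      (colourLaw G hw)) σ).toReal - G.potts q w σ| ≤ δ := by
  have hq : (1 : ℝ) ≤ q := by exact_mod_cast NeZero.one_le
  have hy1 : 1 ≤ y := by
    rw [hy, le_div_iff₀ (by linarith)]
    linarith
  set p := iterKernel (fun _ => glauber S hy0) 0 N (0 : Fin m → ZMod q) with hp
  set a : (Fin n → Fin q) → ℝ := fun σ => ((p.bind (colourLaw G hw)) σ).toReal with ha
  -- The signs of the differences turn the `ℓ¹` distance into a difference of expectations of one
  -- test function `φ` on flows.
  set ε : (Fin n → Fin q) → ℝ := fun σ => if 0 ≤ a σ - G.potts q w σ then 1 else -1 with hε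
  have hε1 : ∀ σ, |ε σ| = 1 := by
    intro σ
    simp only [hε]
    split_ifs <;> simp
  set φ : (Fin m → ZMod q) → ℝ := fun f => expect (colourLaw G hw f) ε with hφ
  have hφ1 : ∀ f, |φ f| ≤ 1 := by
    intro f
    refine (abs_sum_le_sum_abs _ _).trans ?_
    simp only [abs_mul, hε1, mul_one, abs_of_nonneg ENNReal.toReal_nonneg]
    exact (sum_toReal_eq_one _).le
  -- The constant `2` comes from `|φ| ≤ 1` and cancels the factor `1/2` of the total variation
  -- distance.
  have hLip : FlowChain.LipAlong (S.modχ q) φ 2 := by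
    intro i t f
    have h1 := hφ1 (f + t • S.modχ q i)
    have h2 := hφ1 f
    rw [abs_le] at h1 h2 ⊢
    constructor <;> linarith [h1.1, h1.2, h2.1, h2.2]
  have hpotts : ∀ σ, G.potts q w σ =
      FlowChain.flowAverage y (G.modFlows q) fun f => (colourLaw G hw f σ).toReal := fun σ =>
    (G.flowAverage_eq_potts hw hy _ (fun f => sum_toReal_eq_one _)
      (fun f σ => toReal_colourLaw G hw hy f σ) σ).symm
  have hsum : ∑ σ, |a σ - G.potts q w σ| =
      expect p φ - FlowChain.flowAverage y (G.modFlows q) φ := by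
    have h1 : ∀ σ, |a σ - G.potts q w σ| = a σ * ε σ - G.potts q w σ * ε σ := by
      intro σ
      simp only [hε]
      split_ifs with h
      · rw [abs_of_nonneg h]; ring
      · rw [abs_of_neg (not_le.1 h)]; ring
    have h2 : ∑ σ, G.potts q w σ * ε σ = FlowChain.flowAverage y (G.modFlows q) φ := by
      simp only [hpotts, FlowChain.flowAverage, div_mul_eq_mul_div, ← sum_div]
      congr 1
      simp only [sum_mul, hφ, expect, mul_sum, mul_assoc]
      exact sum_comm
    rw [sum_congr rfl fun σ _ => h1 σ, sum_sub_distrib, h2]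
    congr 1
    exact expect_bind p (colourLaw G hw) ε
  have hmain : |expect p φ - FlowChain.flowAverage y (G.modFlows q) φ| ≤
      r * ((1 - c / r) ^ N * 2) := by
    by_cases hr : Nonempty (Fin r)
    · rw [hp, expect_iterKernel_glauber]
      have := FlowChain.abs_iterate_heatStep_sub_flowAverage_le hy1 (S.modχ_of_notMem q) hc hc1
        (G.modFlows q) (S.smul_modχ_mem q) (fun f hf => S.exists_eq_sum_smul_modχ q hf)
        zero_le_two hLip N
      rwa [Fintype.card_fin] at this
    -- Without generators the zero flow is the only flow, and the chain is exact from the start.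
    · have : IsEmpty (Fin r) := not_nonempty_iff.1 hr
      have hr1 : r = 0 := Nat.eq_zero_of_not_pos fun h => hr ⟨⟨0, h⟩⟩
      have hpure : ∀ d j, iterKernel (fun _ => glauber S hy0) j d (0 : Fin m → ZMod q) =
          PMF.pure 0 := by
        intro d
        induction d with
        | zero => intro j; rfl
        | succ d ih => intro j; rw [iterKernel, glauber, dif_neg hr, PMF.pure_bind, ih]
      rw [hp, hpure, expect_pure]
      refine FlowChain.abs_sub_flowAverage_le hy0 _ fun f hf => ?_
      obtain ⟨b, rfl⟩ := S.exists_eq_sum_smul_modχ q hf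
      simp [hr1]
  rw [hsum]
  have := (le_abs_self _).trans hmain
  linarith

end Sampler

end RAM

namespace RAM

/-! ### The program

Natural arrays: 7 holds the flow; 8 and 9 hold the parents (plus one, and zero for a root) and ranks
of a union-find structure; 10 holds colours of the roots, 11 the states of the edges. The arrays
from 12 on are used for scalar variables. Real arrays: 1 holds ones, 2 the weights of a heat bath
update, 3 the weights of the states of an edge, 4 a scalar variable. -/

namespace Prog

/-- `a` times `x`. -/
def timesConst : ℕ → NExp → NExp
  | 0, _ => .const 0
  | a + 1, x => .add (timesConst a x) x

/-- The same cells serve as weights for the uniform choice among `r` generators and among `q`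
colours. -/
def initOnes (q : ℕ) : Prog :=
  forLoop 12 (.add (.get 0 (.const 2)) (.const q)) (.setReal 1 (.var 12) (.ofNat (.const 1)))

/-- Compute `a * r * (L + 1)` where `L` is the number of doublings that take `δ` to at least `m`. -/
def countSteps (a : ℕ) : Prog :=
  .seq (.setReal 4 (.const 0) (.get 0 (.const 1)))
    (.seq (.assign 13 (timesConst a (.get 0 (.const 2))))
      (.loop (.realLt (.get 4 (.const 0)) (.ofNat (.get 0 (.const 1))))
        (.seq (.setReal 4 (.const 0) (.add (.get 4 (.const 0)) (.get 4 (.const 0))))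
          (.assign 13 (.add (.var 13) (timesConst a (.get 0 (.const 2))))))))

/-- The place of the current edge of the current generator in the input. -/
def place : NExp := .add (.get 3 (.var 14)) (.var 20)

/-- The number of edges of the current generator. -/
def memberSize : NExp := .sub (.get 3 (.add (.var 14) (.const 1))) (.get 3 (.var 14))

/-- Multiply the weight of the update that makes the flow vanish on the current edge. -/
def weighEdge (q : ℕ) : Prog :=
  .seq
    -- Exactly one `t` annihilates the flow on the edge: `-f e` for sign `1` and `f e` for sign
    -- `-1`. Only its weight changes, so the time per edge does not depend on `q`.
    (.branch (.natEq (.get 5 place) (.const 1))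
      (.branch (.natEq (.get 7 (.get 4 place)) (.const 0)) (.assign 17 (.const 0))
        (.assign 17 (.sub (.const q) (.get 7 (.get 4 place)))))
      (.assign 17 (.get 7 (.get 4 place))))
    (.setReal 2 (.var 17) (.mul (.get 2 (.var 17))
      (.div (.add (.get 0 (.const 0)) (.sub (.ofNat (.const q)) (.ofNat (.const 1))))
        (.sub (.get 0 (.const 0)) (.ofNat (.const 1))))))

/-- Update the flow on the current edge. -/
def updateEdge (q : ℕ) : Prog :=
  .seq
    (.branch (.natEq (.get 5 place) (.const 1))
      (.assign 17 (.add (.get 7 (.get 4 place)) (.var 16)))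
      -- Subtraction modulo `q` as addition of `q - t`; the result is below `2 q`, so one reduction
      -- suffices.
      (.assign 17 (.add (.get 7 (.get 4 place)) (.sub (.const q) (.var 16)))))
    (.branch (.natLt (.var 17) (.const q)) (.setNat 7 (.get 4 place) (.var 17))
      (.setNat 7 (.get 4 place) (.sub (.var 17) (.const q))))

/-- One step of the heat bath dynamics. -/
def heatBath (q : ℕ) : Prog :=
  .seq (.sample 14 (.const 0) 1 (.get 0 (.const 2)))
    (.seq (.forLoop 20 (.const q) (.setReal 2 (.var 20) (.ofNat (.const 1))))
      (.seq (.forLoop 20 memberSize (weighEdge q))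
        (.seq (.sample 16 (.const 0) 2 (.const q))
          (.forLoop 20 memberSize (updateEdge q)))))

def runChain (q : ℕ) : Prog := .forLoop 12 (.var 13) (heatBath q)

/-- Choose the states of the edges. -/
def openEdges (q : ℕ) : Prog :=
  .seq (.setReal 3 (.const 0) (.ofNat (.const q)))
    (.seq (.setReal 3 (.const 1) (.sub (.get 0 (.const 0)) (.ofNat (.const 1))))
      (.forLoop 12 (.get 0 (.const 1))
        (.branch (.natEq (.get 7 (.var 12)) (.const 0)) (.sample 11 (.var 12) 3 (.const 2))
          (.setNat 11 (.var 12) (.const 1)))))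

/-- Replace the vertex in the variable `a` by its root. -/
def findRoot (a : ℕ) : Prog :=
  .loop (.neg (.natEq (.get 8 (.var a)) (.const 0)))
    (.assign a (.sub (.get 8 (.var a)) (.const 1)))

/-- Make the root in the variable `b` the parent of the root in the variable `a`. -/
def attach (a b : ℕ) : Prog :=
  .seq (.setNat 8 (.var a) (.add (.var b) (.const 1)))
    -- By truncated subtraction the new rank is the maximum of the rank of `b` and the rank of `a`
    -- plus one.
    (.setNat 9 (.var b) (.add (.get 9 (.var b))
      (.sub (.add (.get 9 (.var a)) (.const 1)) (.get 9 (.var b)))))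

/-- Unite the components of the endpoints of an edge. -/
def unite : Prog :=
  .seq (.assign 18 (.get 1 (.var 12)))
    (.seq (findRoot 18)
      (.seq (.assign 19 (.get 2 (.var 12)))
        (.seq (findRoot 19)
          (.branch (.natEq (.var 18) (.var 19)) .skip
            (.branch (.natLt (.get 9 (.var 18)) (.get 9 (.var 19))) (attach 18 19)
              (attach 19 18))))))

/-- Compute the components of the graph of open edges. -/
def components : Prog :=
  .forLoop 12 (.get 0 (.const 1)) (.branch (.natEq (.get 11 (.var 12)) (.const 1)) unite .skip)

/-- Choose independent uniformly random colours. -/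
def drawColours (q : ℕ) : Prog :=
  .forLoop 12 (.get 0 (.const 0)) (.sample 10 (.var 12) 1 (.const q))

/-- Give every vertex the colour of its root. -/
def copyColours : Prog :=
  .forLoop 12 (.get 0 (.const 0))
    (.seq (.assign 18 (.var 12)) (.seq (findRoot 18) (.setNat 6 (.var 12) (.get 10 (.var 18)))))

/-- The sampler for the Potts measure. -/
def pottsSampler (q a : ℕ) : Prog :=
  .seq (initOnes q) (.seq (countSteps a) (.seq (runChain q) (.seq (openEdges q)
    (.seq components (.seq (drawColours q) copyColours)))))

end Prog

/-! ### Access to the input -/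

/-- This justifies the addressing by array 3, whose entries are the partial sums of the block
lengths. -/
theorem getElem?_flatten_sum_take_add {α : Type*} (l : List (List α)) : ∀ (i p : ℕ) (hi : i < l.length)
    (hp : p < l[i].length), l.flatten[((l.take i).map List.length).sum + p]? = some l[i][p] := by
  induction l with
  | nil => intro i p hi; simp at hi
  | cons x l ih =>
    intro i p hi hp
    cases i with
    | zero =>
      simp only [List.getElem_cons_zero] at hp
      simp [List.getElem?_append_left hp]
    | succ i =>
      have := ih i p (by simpa using hi) (by simpa using hp)
      simp only [List.take_succ_cons, List.map_cons, List.sum_cons, List.flatten_cons,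
        List.getElem_cons_succ]
      rw [List.getElem?_append_right (by omega), ← this]
      congr 1
      omega

section Input

variable {n m r q : ℕ} {G : Multigraph n m}

/-- The edges of `C i` in increasing order. -/
def memberList (S : EvenGeneratingSet G r) (i : Fin r) : List (Fin m) :=
  (List.finRange m).filter fun e => e ∈ S.C i

theorem mem_memberList {S : EvenGeneratingSet G r} {i : Fin r} {e : Fin m} :
    e ∈ memberList S i ↔ e ∈ S.C i := by
  simp [memberList]

theorem nodup_memberList (S : EvenGeneratingSet G r) (i : Fin r) : (memberList S i).Nodup :=
  (List.nodup_finRange m).filter _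

theorem toFinset_memberList (S : EvenGeneratingSet G r) (i : Fin r) :
    (memberList S i).toFinset = S.C i := by
  ext e; simp [mem_memberList]

theorem length_memberList (S : EvenGeneratingSet G r) (i : Fin r) :
    (memberList S i).length = (S.C i).card := by
  rw [← toFinset_memberList, List.toFinset_card_of_nodup (nodup_memberList S i)]

/-- The memory `M` still contains the input. -/
structure HasInput (S : EvenGeneratingSet G r) (w δ : ℝ) (M : Mem) : Prop where
  numVert : M.nat 0 0 = n
  numEdge : M.nat 0 1 = m
  numGen : M.nat 0 2 = r
  src : ∀ e : Fin m, M.nat 1 e = G.src e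
  tgt : ∀ e : Fin m, M.nat 2 e = G.tgt e
  size : ∀ i : Fin r, M.nat 3 (i + 1) - M.nat 3 i = (memberList S i).length
  edge : ∀ (i : Fin r) (p : ℕ) (hp : p < (memberList S i).length),
    M.nat 4 (M.nat 3 i + p) = (memberList S i)[p]
  sign : ∀ (i : Fin r) (p : ℕ) (hp : p < (memberList S i).length),
    M.nat 5 (M.nat 3 i + p) = if S.χ i (memberList S i)[p] = 1 then 1 else 0
  weight : M.real 0 0 = w
  tolerance : M.real 0 1 = δ

theorem HasInput.of_eq {S : EvenGeneratingSet G r} {w δ : ℝ} {M M' : Mem} (h : HasInput S w δ M)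
    (hn : ∀ a < 6, M'.nat a = M.nat a) (hr : M'.real 0 = M.real 0) : HasInput S w δ M' := by
  obtain ⟨h1, h2, h3, h4, h5, h6, h7, h8, h9, h10⟩ := h
  constructor <;> simp only [hr, hn 0 (by norm_num), hn 1 (by norm_num), hn 2 (by norm_num),
    hn 3 (by norm_num), hn 4 (by norm_num), hn 5 (by norm_num)] <;> assumption

theorem HasInput.frame {S : EvenGeneratingSet G r} {w δ : ℝ} {M M' : Mem} {c : Prog}
    (h : HasInput S w δ M) (hF : Frame c M M') (hn : ∀ a < 6, c.writesNat a = false)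
    (hr : c.writesReal 0 = false) : HasInput S w δ M' :=
  h.of_eq (fun a ha => hF.nat a (hn a ha)) (hF.real 0 hr)

theorem hasInput_input (S : EvenGeneratingSet G r) (w δ : ℝ) : HasInput S w δ (input G S w δ) := by
  have h3 : ∀ i : Fin r, (input G S w δ).nat 3 i =
      (((List.finRange r).map fun j => (memberList S j).map fun e => (j, e)).take i |>.map
        List.length).sum := by
    intro i
    have e1 : (input G S w δ).nat 3 i = ∑ j : Fin r, if (j : ℕ) < i then (S.C j).card else 0 :=
      if_pos i.2.le
    have e2 : ∀ k ≤ r, ∑ j : Fin r, (if (j : ℕ) < k then (S.C j).card else 0) =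
        (((List.finRange r).map fun j => (memberList S j).map fun e => (j, e)).take k |>.map
        List.length).sum := by
      intro k
      induction k with
      | zero => simp
      | succ k ih =>
        intro hk
        rw [List.take_add_one, List.map_append, List.sum_append, ← ih (by omega)]
        have hk' : k < r := hk
        have e3 : ∀ j : Fin r, (if (j : ℕ) < k + 1 then (S.C j).card else 0) =
            (if (j : ℕ) < k then (S.C j).card else 0) +
              if j = ⟨k, hk'⟩ then (S.C j).card else 0 := by
          intro j
          have : j = ⟨k, hk'⟩ ↔ (j : ℕ) = k := Fin.ext_iff
          split_ifs <;> omega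
        rw [sum_congr rfl fun j _ => e3 j, sum_add_distrib]
        simp [hk', length_memberList]
    rw [e1, e2 i i.2.le]
  have hinc : S.incidences =
      ((List.finRange r).map fun j => (memberList S j).map fun e => (j, e)).flatten := by
    rw [EvenGeneratingSet.incidences, List.flatMap]
    rfl
  have hget : ∀ (i : Fin r) (p : ℕ) (hp : p < (memberList S i).length),
      S.incidences[(input G S w δ).nat 3 i + p]? = some (i, (memberList S i)[p]) := by
    intro i p hp
    rw [hinc, h3 i, getElem?_flatten_sum_take_add _ _ _ (by simp) (by simpa using hp)]
    simp
  constructor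
  · rfl
  · rfl
  · rfl
  · intro e; simp [input]
  · intro e; simp [input]
  · intro i
    have e1 : (input G S w δ).nat 3 i = ∑ j : Fin r, if (j : ℕ) < i then (S.C j).card else 0 :=
      if_pos i.2.le
    have e2 : (input G S w δ).nat 3 (i + 1) =
        ∑ j : Fin r, if (j : ℕ) < i + 1 then (S.C j).card else 0 := if_pos i.2
    have e3 : ∀ j : Fin r, (if (j : ℕ) < i + 1 then (S.C j).card else 0) =
        (if (j : ℕ) < i then (S.C j).card else 0) + if j = i then (S.C j).card else 0 := by
      intro j
      have : j = i ↔ (j : ℕ) = i := Fin.ext_iff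
      split_ifs <;> omega
    rw [e1, e2, sum_congr rfl fun j _ => e3 j, sum_add_distrib, add_tsub_cancel_left,
      sum_ite_eq', if_pos (mem_univ i), length_memberList]
  · intro i p hp
    have : (input G S w δ).nat 4 = fun i => (S.incidences.map fun p => (p.2 : ℕ)).getD i 0 := rfl
    rw [this]
    simp [List.getD_eq_getElem?_getD, List.getElem?_map, hget i p hp]
  · intro i p hp
    have : (input G S w δ).nat 5 =
      fun i => (S.incidences.map fun p => if S.χ p.1 p.2 = 1 then 1 else 0).getD i 0 := rfl
    rw [this]
    simp [List.getD_eq_getElem?_getD, List.getElem?_map, hget i p hp]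
  · rfl
  · rfl

end Input

end RAM

namespace RAM

/-! ### Proof rules for single instructions -/

section Rules

theorem NExp.eval_add (M : Mem) (x y : NExp) : (NExp.add x y).eval M = x.eval M + y.eval M := rfl

theorem NExp.eval_sub (M : Mem) (x y : NExp) : (NExp.sub x y).eval M = x.eval M - y.eval M := rfl

theorem Test.natEq_eq_true {M : Mem} {x y : NExp} :
    (Test.natEq x y).eval M = true ↔ x.eval M = y.eval M := by simp [Test.eval]

theorem Test.natEq_eq_false {M : Mem} {x y : NExp} :
    (Test.natEq x y).eval M = false ↔ x.eval M ≠ y.eval M := by simp [Test.eval]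

theorem Test.natLt_eq_true {M : Mem} {x y : NExp} :
    (Test.natLt x y).eval M = true ↔ x.eval M < y.eval M := by simp [Test.eval]

theorem Test.natLt_eq_false {M : Mem} {x y : NExp} :
    (Test.natLt x y).eval M = false ↔ y.eval M ≤ x.eval M := by simp [Test.eval]

variable {α : Type*} {N : ℕ} {M : Mem}

theorem Ensures.to_refines {D : PMF Outcome} {Q : α → Mem → ℕ → Prop} (x : α)
    (h : Ensures D (Q x)) : Refines D (PMF.pure x) Q := by
  have := Refines.map (Q := Q) h (fun _ => x) fun _ M t h => h
  rwa [PMF.pure_map] at this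

theorem Ensures.setNat {a : ℕ} {i x : NExp} {Q : Mem → ℕ → Prop}
    (h : Q (M.setNat a (i.eval M) (x.eval M)) (1 + i.cost + x.cost)) :
    Ensures ((Prog.setNat a i x).run N M) Q :=
  Ensures.pure h

theorem Ensures.setReal {a : ℕ} {i : NExp} {x : RExp} {Q : Mem → ℕ → Prop}
    (h : Q (M.setReal a (i.eval M) (x.eval M)) (1 + i.cost + x.cost)) :
    Ensures ((Prog.setReal a i x).run N M) Q :=
  Ensures.pure h

theorem Ensures.skip {Q : Mem → ℕ → Prop} (h : Q M 1) : Ensures (Prog.skip.run N M) Q :=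
  Ensures.pure h

theorem Refines.branch {b : Test} {c₁ c₂ : Prog} {a : PMF α} {Q : α → Mem → ℕ → Prop}
    (h₁ : b.eval M = true → Refines (c₁.run N M) a fun x M' t => Q x M' (1 + b.cost + t))
    (h₂ : b.eval M = false → Refines (c₂.run N M) a fun x M' t => Q x M' (1 + b.cost + t)) :
    Refines ((Prog.branch b c₁ c₂).run N M) a Q := by
  refine Refines.andThen ?_
  cases h : b.eval M with
  | true => simpa using h₁ h
  | false => simpa using h₂ h

theorem Ensures.branch {b : Test} {c₁ c₂ : Prog} {Q : Mem → ℕ → Prop}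
    (h₁ : b.eval M = true → Ensures (c₁.run N M) fun M' t => Q M' (1 + b.cost + t))
    (h₂ : b.eval M = false → Ensures (c₂.run N M) fun M' t => Q M' (1 + b.cost + t)) :
    Ensures ((Prog.branch b c₁ c₂).run N M) Q :=
  Refines.branch h₁ h₂

end Rules

open Prog

theorem eval_timesConst (M : Mem) (a : ℕ) (x : NExp) : (timesConst a x).eval M = a * x.eval M := by
  induction a with
  | zero => simp [timesConst, NExp.eval]
  | succ a ih => simp [timesConst, NExp.eval, ih, add_mul]

theorem cost_timesConst (a : ℕ) (x : NExp) : (timesConst a x).cost = a * (x.cost + 1) + 1 := by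
  induction a with
  | zero => simp [timesConst, NExp.cost]
  | succ a ih => simp [timesConst, NExp.cost, ih]; ring

/-! ### Correctness of the step counter and of the inner loops of a heat bath update -/

section Specs

variable {n m r q : ℕ} {G : Multigraph n m} {S : EvenGeneratingSet G r} {w δ : ℝ} {N : ℕ} {M : Mem}

theorem ensures_initOnes (hM : HasInput S w δ M) (hN : r + q < N) :
    Ensures ((initOnes q).run N M) fun M' t =>
      (∀ i < r + q, M'.real 1 i = 1) ∧ t ≤ 30 * (r + q + 1) := by
  refine (ensures_forLoop (r + q) (fun j M' => ∀ i < j, M'.real 1 i = 1) (fun _ => 5) rfl hN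
    (fun j M' z h => h) (fun M' hF => ?_) (by simp) ?_).mono ?_
  · simp [NExp.eval, hF.nat 0 rfl, hM.numGen]
  · intro j hj M' hF hv hI
    refine Ensures.setReal ⟨?_, by simp [NExp.cost, RExp.cost]⟩
    intro i hi
    rcases Nat.lt_succ_iff_lt_or_eq.1 hi with hi | rfl
    · simp [NExp.eval, RExp.eval, hv, Function.update_of_ne hi.ne, hI i hi]
    · simp [NExp.eval, RExp.eval, hv]
  · rintro M' t ⟨h1, h2⟩
    refine ⟨h1, h2.trans ?_⟩
    simp only [NExp.cost, sum_const, card_range, smul_eq_mul]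
    omega

/-- The two hypotheses on `L` determine the number of doublings exactly, so the program finds the
required logarithm by comparisons alone. -/
theorem ensures_countSteps (hM : HasInput S w δ M) (a L : ℕ)
    (hL : ∀ k < L, δ * 2 ^ k < m) (hL' : m ≤ δ * 2 ^ L) (hN : L < N) :
    Ensures ((countSteps a).run N M) fun M' t =>
      M'.nat 13 0 = a * r * (L + 1) ∧ t ≤ (3 * a + 40) * (L + 1) := by
  have hcost := cost_timesConst a (.get 0 (.const 2))
  simp only [NExp.cost] at hcost
  refine Ensures.seq (P := fun M' t => M'.real 4 0 = δ ∧ t = 4)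
    (Ensures.setReal ⟨by simp [NExp.eval, RExp.eval, hM.tolerance], rfl⟩) ?_
  rintro M₁ t₁ hF₁ ⟨h1, rfl⟩
  have hM₁ := hM.frame hF₁ (fun _ _ => rfl) rfl
  refine Ensures.seq (P := fun M' t => M'.nat 13 0 = a * r * 1 ∧ t = 3 * a + 3)
    (Ensures.setNat ⟨by simp [NExp.eval, eval_timesConst, hM₁.numGen], ?_⟩) ?_
  · rw [hcost]; simp only [NExp.cost]; ring
  rintro M₂ t₂ hF₂ ⟨h2, rfl⟩
  have hM₂ := hM₁.frame hF₂ (fun a ha => by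
    simp only [Prog.writesNat, beq_eq_false_iff_ne]; omega) rfl
  have h1' : M₂.real 4 0 = δ := by rw [hF₂.real 4 rfl, h1]
  have := ensures_repeatWhile
    (b := fun M' => (Test.realLt (.get 4 (.const 0)) (.ofNat (.get 0 (.const 1)))).eval M')
    (tc := 1 + (Test.realLt (.get 4 (.const 0)) (.ofNat (.get 0 (.const 1)))).cost)
    (body := (Prog.seq (.setReal 4 (.const 0) (.add (.get 4 (.const 0)) (.get 4 (.const 0))))
      (.assign 13 (.add (.var 13) (timesConst a (.get 0 (.const 2)))))).run N)
    (I := fun k M' t => ∃ j, j + k = L ∧ M'.real 4 0 = δ * 2 ^ j ∧ M'.nat 13 0 = a * r * (j + 1) ∧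
      M'.nat 0 = M₂.nat 0 ∧ t ≤ (3 * a + 30) * j)
    (Q := fun M' t => M'.nat 13 0 = a * r * (L + 1) ∧ t ≤ (3 * a + 30) * L + 10)
    ?_ ?_ L N M₂ 0 hN ⟨0, by simp, by simp [h1'], by simp [h2], rfl, by simp⟩
  · refine this.mono fun M' t h => ⟨h.1, ?_⟩
    have := h.2
    nlinarith
  · rintro k M' t ⟨j, hj, h4, h13, h0, ht⟩ hb
    simp only [Test.eval, NExp.eval, RExp.eval, h4, h0, hM₂.numEdge, decide_eq_true_eq] at hb
    have hjL : j < L := by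
      by_contra hcon
      obtain rfl : j = L := by omega
      exact absurd hL' (not_le.2 hb)
    refine ⟨k - 1, by omega, ?_⟩
    refine Ensures.seq (P := fun M'' t => M''.real 4 0 = δ * 2 ^ (j + 1) ∧ t = 7)
      (Ensures.setReal ⟨?_, rfl⟩) ?_
    · simp [NExp.eval, RExp.eval, h4]; ring
    · rintro M'' t'' hF ⟨h4', rfl⟩
      refine Ensures.setNat ⟨j + 1, by omega, by simpa using h4', ?_, ?_, ?_⟩
      · simp [NExp.eval, eval_timesConst, hF.nat 13 rfl, hF.nat 0 rfl, h13, h0, hM₂.numGen]; ring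
      · simp [hF.nat 0 rfl, h0]
      · simp only [NExp.cost, Test.cost, RExp.cost, hcost]
        nlinarith
  · rintro k M' t ⟨j, hj, h4, h13, h0, ht⟩ hb
    simp only [Test.eval, NExp.eval, RExp.eval, h4, h0, hM₂.numEdge, decide_eq_false_iff_not] at hb
    have hjL : j = L := by
      by_contra hcon
      exact hb (hL j (by omega))
    subst hjL
    refine ⟨h13, ?_⟩
    simp only [Test.cost, NExp.cost, RExp.cost]
    omega

/-- The memory `M` contains the flow `f`. -/
def HasFlow [NeZero q] (f : Fin m → ZMod q) (M : Mem) : Prop := ∀ e : Fin m, M.nat 7 e = (f e).val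

theorem val_eq_of_natCast_eq [NeZero q] {x : ℕ} {z : ZMod q} (h : (x : ZMod q) = z)
    (hx : x < 2 * q) : z.val = if x < q then x else x - q := by
  rw [← h, ZMod.val_natCast]
  split_ifs with hlt
  · exact Nat.mod_eq_of_lt hlt
  · rw [Nat.mod_eq_sub_mod (not_lt.1 hlt), Nat.mod_eq_of_lt (by omega)]

theorem modχ_cases (S : EvenGeneratingSet G r) (q : ℕ) {i : Fin r} {e : Fin m} (he : e ∈ S.C i) :
    (S.χ i e = 1 ∧ S.modχ q i e = 1) ∨ (S.χ i e ≠ 1 ∧ S.modχ q i e = -1) := by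
  rcases (S.indicator i).2.1 e he with h | h
  · left; exact ⟨h, by simp [EvenGeneratingSet.modχ, h]⟩
  · right; exact ⟨by rw [h]; norm_num, by simp [EvenGeneratingSet.modχ, h]⟩

/-- What the two inner loops of a heat bath update know about the current edge. -/
theorem HasInput.place (hM : HasInput S w δ M) {i : Fin r} (hi : M.nat 14 0 = i) {p : ℕ}
    (hp : p < (memberList S i).length) (h20 : M.nat 20 0 = p) :
    (NExp.get 4 Prog.place).eval M = (memberList S i)[p] ∧
    (NExp.get 5 Prog.place).eval M = if S.χ i (memberList S i)[p] = 1 then 1 else 0 := by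
  constructor
  · simp only [Prog.place, NExp.eval, hi, h20]
    exact hM.edge i p hp
  · simp only [Prog.place, NExp.eval, hi, h20]
    exact hM.sign i p hp

theorem HasInput.eval_memberSize (hM : HasInput S w δ M) {i : Fin r} (hi : M.nat 14 0 = i) :
    memberSize.eval M = (memberList S i).length := by
  simp only [memberSize, NExp.eval, hi]
  exact hM.size i

theorem ensures_weigh [NeZero q] {f : Fin m → ZMod q} (hM : HasInput S w δ M) (hf : HasFlow f M)
    {i : Fin r} (hi : M.nat 14 0 = i) (h2 : ∀ t < q, M.real 2 t = 1)
    (hN : (memberList S i).length < N) :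
    Ensures ((forLoop 20 memberSize (weighEdge q)).run N M) fun M' t =>
      (∀ t : ZMod q, M'.real 2 t.val =
        FlowChain.heatWeight ((w + (q - 1)) / (w - 1)) (S.C i) (S.modχ q i) f t) ∧
      t ≤ 200 * ((S.C i).card + 1) := by
  set y := (w + ((q : ℝ) - 1)) / (w - 1) with hy
  have hq : 0 < q := Nat.pos_of_neZero q
  refine (ensures_forLoop (memberList S i).length (fun p M' => ∀ t : ZMod q, M'.real 2 t.val =
      (((memberList S i).take p).map fun e => if f e + t * S.modχ q i e = 0 then y else 1).prod)
    (fun _ => 100) rfl hN (fun j M' z h => h) (fun M' hF => ?_) ?_ ?_).mono ?_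
  · exact (hM.frame hF (fun a ha => by interval_cases a <;> rfl) rfl).eval_memberSize
      (by rw [hF.nat 14 rfl, hi])
  · intro t
    simp [h2 t.val (ZMod.val_lt t)]
  · intro p hp M' hF h20 hI
    have hM' := hM.frame hF (fun a ha => by interval_cases a <;> rfl) rfl
    have hi' : M'.nat 14 0 = i := by rw [hF.nat 14 rfl, hi]
    obtain ⟨he, hs⟩ := hM'.place hi' hp h20
    set e := (memberList S i)[p] with hedef
    have heC : e ∈ S.C i := mem_memberList.1 (List.getElem_mem hp)
    have hfe : M'.nat 7 e = (f e).val := by rw [hF.nat 7 rfl, hf]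
    have hfe' : (NExp.get 7 (.get 4 Prog.place)).eval M' = (f e).val := by
      rw [NExp.eval, he, hfe]
    -- The only `t` for which the updated flow vanishes on `e`.
    set z : ZMod q := if S.χ i e = 1 then -f e else f e with hz
    have hzero : ∀ t : ZMod q, f e + t * S.modχ q i e = 0 ↔ t = z := by
      intro t
      rcases modχ_cases S q heC with ⟨h1, h2⟩ | ⟨h1, h2⟩
      · rw [hz, if_pos h1, h2, mul_one, add_comm, eq_neg_iff_add_eq_zero]
      · rw [hz, if_neg h1, h2, mul_neg, mul_one, ← sub_eq_add_neg, sub_eq_zero, eq_comm]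
    refine Ensures.seq (P := fun M'' t => M''.nat 17 0 = z.val ∧ M''.real = M'.real ∧ t ≤ 50)
      ?_ ?_
    · refine Ensures.branch (fun hb => ?_) (fun hb => ?_)
      · rw [Test.eval, hs] at hb
        have h1 : S.χ i e = 1 := by
          by_contra h1
          simp [h1, NExp.eval] at hb
        refine Ensures.branch (fun hb' => ?_) (fun hb' => ?_)
        · rw [Test.eval, hfe'] at hb'
          have h0 : f e = 0 := by simpa [NExp.eval] using hb'
          refine Ensures.setNat ⟨by simp [hz, NExp.eval, h0], rfl, by
            simp [Test.cost, NExp.cost, Prog.place]⟩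
        · rw [Test.eval, hfe'] at hb'
          have h0 : f e ≠ 0 := by simpa [NExp.eval] using hb'
          refine Ensures.setNat ⟨?_, rfl, by simp [Test.cost, NExp.cost, Prog.place]⟩
          have : NeZero (f e) := ⟨h0⟩
          rw [NExp.eval_sub, hfe']
          simp [hz, h1, NExp.eval, ZMod.val_neg_of_ne_zero]
      · rw [Test.eval, hs] at hb
        have h1 : S.χ i e ≠ 1 := by
          intro h1
          simp [h1, NExp.eval] at hb
        refine Ensures.setNat ⟨?_, rfl, by simp [Test.cost, NExp.cost, Prog.place]⟩
        rw [hfe']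
        simp [hz, h1, NExp.eval]
    · rintro M'' t'' hF'' ⟨h17, hreal, ht⟩
      refine Ensures.setReal ⟨?_, ?_⟩
      · intro t
        have hw : M''.real 0 0 = w := by rw [hreal]; exact hM'.weight
        rw [List.take_add_one, List.getElem?_eq_getElem hp, ← hedef]
        simp only [Option.toList_some, List.map_append, List.prod_append, List.map_cons,
          List.map_nil, List.prod_cons, List.prod_nil, mul_one, ← hI t, hzero]
        simp only [Mem.setReal_real, if_true, NExp.eval, RExp.eval, h17, hw, hreal]
        by_cases htz : t = z
        · subst htz
          rw [Function.update_self, if_pos rfl, hy]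
          simp
        · rw [Function.update_of_ne (fun h => htz (ZMod.val_injective q h)), if_neg htz, mul_one]
      · simp only [NExp.cost, RExp.cost]
        omega
  · rintro M' t ⟨h1, h2⟩
    refine ⟨fun t => ?_, h2.trans ?_⟩
    · rw [h1 t, List.take_length, ← List.prod_toFinset _ (nodup_memberList S i),
        toFinset_memberList]
      rfl
    · simp only [sum_const, card_range, smul_eq_mul, length_memberList, memberSize, NExp.cost]
      omega

theorem ensures_update [NeZero q] {f : Fin m → ZMod q} (hM : HasInput S w δ M) (hf : HasFlow f M)
    {i : Fin r} (hi : M.nat 14 0 = i) {t : ZMod q} (ht : M.nat 16 0 = t.val)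
    (hN : (memberList S i).length < N) :
    Ensures ((forLoop 20 memberSize (updateEdge q)).run N M) fun M' T =>
      HasFlow (f + t • S.modχ q i) M' ∧ T ≤ 200 * ((S.C i).card + 1) := by
  have hq : 0 < q := Nat.pos_of_neZero q
  refine (ensures_forLoop (memberList S i).length (fun p M' => ∀ e : Fin m, M'.nat 7 e =
      (if e ∈ (memberList S i).take p then f e + t * S.modχ q i e else f e).val)
    (fun _ => 100) rfl hN (fun j M' z h => by simpa using h) (fun M' hF => ?_) ?_ ?_).mono ?_
  · exact (hM.frame hF (fun a ha => by interval_cases a <;> rfl) rfl).eval_memberSize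
      (by rw [hF.nat 14 rfl, hi])
  · intro e
    simp [hf e]
  · intro p hp M' hF h20 hI
    have hM' := hM.frame hF (fun a ha => by interval_cases a <;> rfl) rfl
    have hi' : M'.nat 14 0 = i := by rw [hF.nat 14 rfl, hi]
    have ht' : M'.nat 16 0 = t.val := by rw [hF.nat 16 rfl, ht]
    obtain ⟨he, hs⟩ := hM'.place hi' hp h20
    set e := (memberList S i)[p] with hedef
    have heC : e ∈ S.C i := mem_memberList.1 (List.getElem_mem hp)
    -- The list of a member has no repetitions, so the cell of `e` still holds the old flow value.
    have hnot : e ∉ (memberList S i).take p := by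
      intro hmem
      obtain ⟨k, hk, hk'⟩ := List.mem_iff_getElem.1 hmem
      rw [List.getElem_take, hedef, (nodup_memberList S i).getElem_inj_iff] at hk'
      rw [List.length_take] at hk
      omega
    have hfe : (NExp.get 7 (.get 4 Prog.place)).eval M' = (f e).val := by
      rw [NExp.eval, he, hI e, if_neg hnot]
    set z := f e + t * S.modχ q i e with hz
    refine Ensures.seq (P := fun M'' T => ((M''.nat 17 0 : ℕ) : ZMod q) = z ∧
      M''.nat 17 0 < 2 * q ∧ T ≤ 50) ?_ ?_
    · have h1 := ZMod.val_lt (f e)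
      have h2 := ZMod.val_lt t
      refine Ensures.branch (fun hb => ?_) (fun hb => ?_)
      · rw [Test.eval, hs] at hb
        have hχ : S.χ i e = 1 := by
          by_contra h1
          simp [h1, NExp.eval] at hb
        have hχ' : S.modχ q i e = 1 := by simp [EvenGeneratingSet.modχ, hχ]
        refine Ensures.setNat ?_
        rw [NExp.eval_add, hfe]
        refine ⟨by simp [NExp.eval, ht', hz, hχ'], ?_, by
            simp [Test.cost, NExp.cost, Prog.place]⟩
        simp only [Mem.setNat_nat, if_true, NExp.eval, Function.update_self, ht']
        omega
      · rw [Test.eval, hs] at hb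
        have hχ : S.χ i e ≠ 1 := by
          intro h1
          simp [h1, NExp.eval] at hb
        have hχ' : S.modχ q i e = -1 := by
          rcases modχ_cases S q heC with h | h
          · exact absurd h.1 hχ
          · exact h.2
        refine Ensures.setNat ?_
        rw [NExp.eval_add, hfe]
        refine ⟨?_, ?_, by simp [Test.cost, NExp.cost, Prog.place]⟩
        · simp [NExp.eval, ht', hz, hχ', Nat.cast_sub h2.le]
        · simp only [Mem.setNat_nat, if_true, NExp.eval, Function.update_self, ht']
          omega
    · rintro M'' T'' hF'' ⟨h17, hlt, hT⟩
      have hval := val_eq_of_natCast_eq h17 hlt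
      have he'' : (NExp.get 4 Prog.place).eval M'' = e := by
        rw [← he]
        simp only [Prog.place, NExp.eval, hF''.nat 4 rfl, hF''.nat 3 rfl, hF''.nat 14 rfl,
          hF''.nat 20 rfl]
      have hI'' : ∀ x, M''.nat 7 = M'.nat 7 → x = z.val → ∀ e' : Fin m,
          (M''.setNat 7 e x).nat 7 e' = (if e' ∈ (memberList S i).take (p + 1) then
            f e' + t * S.modχ q i e' else f e').val := by
        intro x h7 hx e'
        rw [List.take_add_one, List.getElem?_eq_getElem hp, ← hedef]
        simp only [Option.toList_some, List.mem_append, List.mem_singleton, Mem.setNat_nat,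
          if_true]
        by_cases hee : e' = e
        · subst hee
          rw [Function.update_self, if_pos (Or.inr rfl), hx]
        · rw [Function.update_of_ne (fun h => hee (Fin.ext h)), h7, hI e']
          simp [hee]
      refine Ensures.branch (fun hb => ?_) (fun hb => ?_)
      · simp only [Test.natLt_eq_true, NExp.eval] at hb
        rw [if_pos hb] at hval
        refine Ensures.setNat ?_
        rw [he'']
        refine ⟨hI'' _ (hF''.nat 7 rfl) hval.symm, ?_⟩
        simp [Test.cost, NExp.cost, Prog.place]
        omega
      · simp only [Test.natLt_eq_false, NExp.eval] at hb
        rw [if_neg hb.not_gt] at hval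
        refine Ensures.setNat ?_
        rw [he'']
        refine ⟨hI'' _ (hF''.nat 7 rfl) hval.symm, ?_⟩
        simp [Test.cost, NExp.cost, Prog.place]
        omega
  · rintro M' T ⟨h1, h2⟩
    refine ⟨fun e => ?_, h2.trans ?_⟩
    · rw [h1 e, List.take_length]
      simp only [mem_memberList, Pi.add_apply, Pi.smul_apply, smul_eq_mul]
      split_ifs with he
      · rfl
      · rw [S.modχ_of_notMem q i e he, mul_zero, add_zero]
    · simp only [sum_const, card_range, smul_eq_mul, length_memberList, memberSize, NExp.cost]
      omega

end Specs

end RAM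

namespace RAM

open Prog

section Specs

variable {n m r q : ℕ} {G : Multigraph n m} {S : EvenGeneratingSet G r} {w δ y : ℝ} {N : ℕ} {M : Mem}

theorem ensures_resetWeights (hN : q < N) :
    Ensures ((forLoop 20 (.const q) (.setReal 2 (.var 20) (.ofNat (.const 1)))).run N M)
      fun M' t => (∀ i < q, M'.real 2 i = 1) ∧ t ≤ 30 * (q + 1) := by
  refine (ensures_forLoop q (fun j M' => ∀ i < j, M'.real 2 i = 1) (fun _ => 5) rfl hN
    (fun j M' z h => h) (fun M' hF => rfl) (by simp) ?_).mono ?_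
  · intro j hj M' hF hv hI
    refine Ensures.setReal ⟨?_, by simp [NExp.cost, RExp.cost]⟩
    intro i hi
    rcases Nat.lt_succ_iff_lt_or_eq.1 hi with hi | rfl
    · simp [NExp.eval, RExp.eval, hv, Function.update_of_ne hi.ne, hI i hi]
    · simp [NExp.eval, RExp.eval, hv]
  · rintro M' t ⟨h1, h2⟩
    refine ⟨h1, h2.trans ?_⟩
    simp only [NExp.cost, sum_const, card_range, smul_eq_mul]
    omega

theorem lt_iff_exists_val [NeZero q] (i : ℕ) : i < q ↔ ∃ z : ZMod q, z.val = i :=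
  ⟨fun h => ⟨i, ZMod.val_natCast_of_lt h⟩, by rintro ⟨z, rfl⟩; exact ZMod.val_lt z⟩

theorem lt_iff_exists_fin {k : ℕ} (i : ℕ) : i < k ↔ ∃ z : Fin k, (z : ℕ) = i :=
  ⟨fun h => ⟨⟨i, h⟩, rfl⟩, by rintro ⟨z, rfl⟩; exact z.2⟩

theorem refines_heatBath [NeZero q] [Nonempty (Fin r)] (hy : y = (w + (q - 1)) / (w - 1))
    (hy0 : 0 < y) {l : ℕ} (hl : ∀ i, (S.C i).card ≤ l) {f : Fin m → ZMod q}
    (hM : HasInput S w δ M) (hf : HasFlow f M) (hones : ∀ i < r, M.real 1 i = 1)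
    (hN : l < N) (hN' : q < N) :
    Refines ((heatBath q).run N M) (glauber S hy0 f) fun f' M' t =>
      HasFlow f' M' ∧ t ≤ 500 * (q + l + 1) := by
  rw [glauber, dif_pos ‹Nonempty (Fin r)›]
  refine Refines.seq (refines_sample (Fin.val : Fin r → ℕ) Fin.val_injective (fun i => ?_)
    (u := fun _ => 1) (fun _ => one_pos) fun i => hones i i.2) ?_
  · rw [NExp.eval, NExp.eval, hM.numGen]
    exact lt_iff_exists_fin i
  rintro i M₁ t₁ hF₁ ⟨hM₁, ht₁⟩
  have hi₁ : M₁.nat 14 0 = i := by rw [hM₁]; simp [NExp.eval]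
  replace hM₁ := hM.frame hF₁ (fun a ha => by interval_cases a <;> rfl) rfl
  have hf₁ : HasFlow f M₁ := fun e => by rw [hF₁.nat 7 rfl, hf e]
  have hNi : (memberList S i).length < N := by rw [length_memberList]; exact (hl i).trans_lt hN
  refine Ensures.seq_refines (ensures_resetWeights hN') ?_
  rintro M₂ t₂ hF₂ ⟨h2, ht₂⟩
  have hM₂ := hM₁.frame hF₂ (fun a ha => by interval_cases a <;> rfl) rfl
  have hf₂ : HasFlow f M₂ := fun e => by rw [hF₂.nat 7 rfl, hf₁ e]
  have hi₂ : M₂.nat 14 0 = i := by rw [hF₂.nat 14 rfl, hi₁]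
  refine Ensures.seq_refines (ensures_weigh hM₂ hf₂ hi₂ h2 hNi) ?_
  rintro M₃ t₃ hF₃ ⟨h3, ht₃⟩
  have hM₃ := hM₂.frame hF₃ (fun a ha => by interval_cases a <;> rfl) rfl
  have hf₃ : HasFlow f M₃ := fun e => by rw [hF₃.nat 7 rfl, hf₂ e]
  have hi₃ : M₃.nat 14 0 = i := by rw [hF₃.nat 14 rfl, hi₂]
  rw [← hy] at h3
  rw [← PMF.bind_pure_comp]
  refine Refines.seq (refines_sample (ZMod.val : ZMod q → ℕ) (ZMod.val_injective q)
    (by intro i; exact lt_iff_exists_val (q := q) i) (FlowChain.heatWeight_pos hy0 _ _ _) h3) ?_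
  rintro t M₄ t₄ hF₄ ⟨hM₄, ht₄⟩
  have h16 : M₄.nat 16 0 = t.val := by rw [hM₄]; simp [NExp.eval]
  replace hM₄ := hM₃.frame hF₄ (fun a ha => by interval_cases a <;> rfl) rfl
  have hf₄ : HasFlow f M₄ := fun e => by rw [hF₄.nat 7 rfl, hf₃ e]
  have hi₄ : M₄.nat 14 0 = i := by rw [hF₄.nat 14 rfl, hi₃]
  refine Ensures.to_refines _ ((ensures_update hM₄ hf₄ hi₄ h16 hNi).mono ?_)
  rintro M₅ t₅ ⟨h5, ht₅⟩
  refine ⟨h5, ?_⟩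
  have := hl i
  simp only [NExp.cost] at ht₁ ht₄
  omega

theorem refines_runChain [NeZero q] (hy : y = (w + (q - 1)) / (w - 1))
    (hy0 : 0 < y) {l : ℕ} (hl : ∀ i, (S.C i).card ≤ l) {f : Fin m → ZMod q}
    (hM : HasInput S w δ M) (hf : HasFlow f M) (hones : ∀ i < r, M.real 1 i = 1)
    (hN : l < N) (hN' : q < N) {K : ℕ} (hK : M.nat 13 0 = K) (hKN : K < N) (hr : 0 < K → 0 < r) :
    Refines ((runChain q).run N M) (iterKernel (fun _ => glauber S hy0) 0 K f) fun f' M' t =>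
      HasFlow f' M' ∧ t ≤ 600 * (q + l + 1) * K + 20 := by
  refine (refines_forLoop K (fun _ f' M' => HasFlow f' M') (fun _ => 500 * (q + l + 1)) f rfl hKN
    (fun j f' M' z h => by simpa [HasFlow] using h) (fun M' hF => ?_) hf ?_).mono ?_
  · rw [NExp.eval, NExp.eval, hF.nat 13 rfl, hK]
  · intro j hj f' M' hF _ hf'
    have : Nonempty (Fin r) := ⟨⟨0, hr (by omega)⟩⟩
    exact refines_heatBath hy hy0 hl (hM.frame hF (fun a ha => by interval_cases a <;> rfl) rfl) hf'
      (fun i hi => by rw [hF.real 1 rfl, hones i hi]) hN hN'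
  · rintro f' M' t - ⟨h1, h2⟩
    refine ⟨h1, h2.trans ?_⟩
    simp only [NExp.cost, sum_const, card_range, smul_eq_mul]
    nlinarith

/-- The memory `M` contains the states `A` of the edges. -/
def HasEdges (A : Fin m → Bool) (M : Mem) : Prop :=
  ∀ e : Fin m, M.nat 11 e = if A e = true then 1 else 0

theorem refines_openEdges [NeZero q] (hw : 1 < w) {f : Fin m → ZMod q}
    (hM : HasInput S w δ M) (hf : HasFlow f M) (hN : m < N) :
    Refines ((openEdges q).run N M) (productPMF (fun e => edgeLaw hw (f e)) fun _ => false)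
      fun A M' t => HasEdges A M' ∧ t ≤ 50 * (m + 1) := by
  have hq : 0 < q := Nat.pos_of_neZero q
  refine Ensures.seq_refines (P := fun M' t => M'.real 3 0 = q ∧ t = 4)
    (Ensures.setReal ⟨by simp [NExp.eval, RExp.eval], rfl⟩) ?_
  rintro M₁ t₁ hF₁ ⟨h1, rfl⟩
  have hM₁ := hM.frame hF₁ (fun _ _ => rfl) rfl
  refine Ensures.seq_refines (P := fun M' t => M'.real 3 0 = q ∧ M'.real 3 1 = w - 1 ∧ t = 7)
    (Ensures.setReal ⟨by simp [NExp.eval, h1], by simp [NExp.eval, RExp.eval, hM₁.weight], rfl⟩) ?_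
  rintro M₂ t₂ hF₂ ⟨h2, h2', rfl⟩
  have hM₂ := hM₁.frame hF₂ (fun _ _ => rfl) rfl
  have hf₂ : HasFlow f M₂ := fun e => by rw [hF₂.nat 7 rfl, hF₁.nat 7 rfl, hf e]
  refine (refines_forLoop m (k := fillKernel fun e => edgeLaw hw (f e))
    (fun j A M' => ∀ e : Fin m, (e : ℕ) < j → M'.nat 11 e = if A e = true then 1 else 0)
    (fun _ => 20) (fun _ => false) rfl hN (fun j A M' z h => by simpa using h) (fun M' hF => ?_)
    (by simp) ?_).mono ?_
  · rw [NExp.eval, NExp.eval, hF.nat 0 rfl, hM₂.numEdge]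
  · intro j hj A M' hF h12 hI
    have hstep : ∀ b : Bool, ∀ e : Fin m, (e : ℕ) < j + 1 →
        (M'.setNat 11 j (if b = true then 1 else 0)).nat 11 e =
          if Function.update A ⟨j, hj⟩ b e = true then 1 else 0 := by
      intro b e he
      rcases Nat.lt_succ_iff_lt_or_eq.1 he with he | he
      · have hne : e ≠ ⟨j, hj⟩ := fun h => he.ne (congrArg Fin.val h)
        rw [Function.update_of_ne hne]
        simp [Function.update_of_ne he.ne, hI e he]
      · obtain rfl : e = ⟨j, hj⟩ := Fin.ext he
        simp
    have h7 : (NExp.get 7 (.var 12)).eval M' = (f ⟨j, hj⟩).val := by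
      rw [NExp.eval, NExp.eval, NExp.eval, h12, hF.nat 7 rfl, hf₂ ⟨j, hj⟩]
    rw [fillKernel, dif_pos hj]
    refine Refines.branch (fun hb => ?_) (fun hb => ?_)
    · rw [Test.natEq_eq_true, h7] at hb
      have h0 : f ⟨j, hj⟩ = 0 := by simpa [NExp.eval] using hb
      rw [edgeLaw, if_pos h0]
      refine Refines.map (refines_sample (fun b : Bool => if b = true then 1 else 0) ?_ ?_ _ ?_) _
        ?_
      · intro b b'; cases b <;> cases b' <;> simp
      · intro i
        simp only [NExp.eval, Bool.exists_bool]
        simp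
        omega
      · intro b
        rw [hF.real 3 rfl]
        cases b
        · simp [h2]
        · simp [h2']
      · rintro b M'' t ⟨rfl, rfl⟩
        refine ⟨?_, by simp [Test.cost, NExp.cost]⟩
        have : (NExp.var 12).eval M' = j := h12
        rw [this]
        exact hstep b
    · rw [Test.natEq_eq_false, h7] at hb
      have h0 : f ⟨j, hj⟩ ≠ 0 := by simpa [NExp.eval] using hb
      rw [edgeLaw, if_neg h0, PMF.pure_map]
      refine Ensures.to_refines _ (Ensures.setNat ⟨?_, by simp [Test.cost, NExp.cost]⟩)
      have : (NExp.var 12).eval M' = j := h12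
      rw [this]
      exact hstep true
  · rintro A M' t - ⟨h3, h4⟩
    refine ⟨fun e => h3 e e.2, ?_⟩
    simp only [NExp.cost, sum_const, card_range, smul_eq_mul] at h4
    omega

/-! #### Union-find -/

/-- `p` and `rk` are the parents (plus one) and the ranks of a union-find structure with
representatives `root`, after `k` steps. -/
structure UnionFind (p rk : ℕ → ℕ) (root : Fin n → Fin n) (k : ℕ) : Prop where
  zero_iff : ∀ v : Fin n, p v = 0 ↔ root v = v
  parent : ∀ v : Fin n, p v ≠ 0 → ∃ u : Fin n, p v = u + 1 ∧ root u = root v ∧ rk v < rk u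
  root_root : ∀ v, root (root v) = root v
  rank_le : ∀ v : Fin n, rk v ≤ rk (root v)
  size : ∀ v : Fin n, root v = v → 2 ^ rk v ≤ (univ.filter fun u => root u = v).card
  nonroot : (univ.filter fun v => root v ≠ v).card ≤ k

theorem UnionFind.mono {p rk : ℕ → ℕ} {root : Fin n → Fin n} {k l : ℕ}
    (h : UnionFind p rk root k) (hkl : k ≤ l) : UnionFind p rk root l :=
  ⟨h.zero_iff, h.parent, h.root_root, h.rank_le, h.size, h.nonroot.trans hkl⟩

/-- A class consists of its root and non-roots, of which there are at most `k`, while its size is at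
least `2 ^ rk`. The bound is thus logarithmic in the number of processed edges, not in `n`. -/
theorem UnionFind.rank_root_le {p rk : ℕ → ℕ} {root : Fin n → Fin n} {k D : ℕ}
    (h : UnionFind p rk root k) (hD : k + 1 ≤ 2 ^ D) (v : Fin n) : rk (root v) ≤ D := by
  have h1 := h.size (root v) (h.root_root v)
  have h2 : (univ.filter fun u => root u = root v).card ≤ k + 1 := by
    refine (card_le_card (t := insert (root v) (univ.filter fun u => root u ≠ u)) ?_).trans
      ((card_insert_le _ _).trans (Nat.succ_le_succ h.nonroot))
    intro u hu
    simp only [mem_filter, mem_univ, true_and, mem_insert] at hu ⊢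
    by_cases hr : root u = u
    · left; rw [← hr, hu]
    · right; exact hr
  exact (Nat.pow_le_pow_iff_right one_lt_two).1 (h1.trans (h2.trans hD))

/-- Union by rank. The rank of `b` grows only if the ranks are equal, and then two classes of size
at least `2 ^ rk` merge; `a` is the only new non-root. -/
theorem UnionFind.link {p rk : ℕ → ℕ} {root : Fin n → Fin n} {k : ℕ}
    (h : UnionFind p rk root k) {a b : Fin n} (ha : root a = a) (hb : root b = b) (hab : a ≠ b)
    (hrk : rk a ≤ rk b) :
    UnionFind (Function.update p a (b + 1))
      (Function.update rk b (rk b + (rk a + 1 - rk b)))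
      (fun v => if root v = a then b else root v) (k + 1) := by
  have up : ∀ v : Fin n, v ≠ a → Function.update p a (b + 1) v = p v := fun v hv =>
    Function.update_of_ne (fun h => hv (Fin.ext h)) _ _
  have ur : ∀ v : Fin n, v ≠ b → Function.update rk b (rk b + (rk a + 1 - rk b)) v = rk v :=
    fun v hv => Function.update_of_ne (fun h => hv (Fin.ext h)) _ _
  have ur' : ∀ v : Fin n, rk v ≤ Function.update rk b (rk b + (rk a + 1 - rk b)) v := by
    intro v
    by_cases hv : v = b
    · subst hv; rw [Function.update_self]; omega
    · rw [ur v hv]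
  have hz : ∀ v : Fin n, Function.update p a (b + 1) v = 0 ↔
      (if root v = a then b else root v) = v := by
    intro v
    by_cases hv : v = a
    · subst hv
      simp [ha, hab.symm]
    · rw [up v hv, h.zero_iff]
      split_ifs with hr
      · constructor
        · intro h'; exact absurd (h'.symm.trans hr) hv
        · rintro rfl; exact hb
      · rfl
  refine ⟨hz, ?_, ?_, ?_, ?_, ?_⟩
  · intro v hv
    by_cases hva : v = a
    · subst hva
      refine ⟨b, by simp, by simp [ha, hb], ?_⟩
      rw [ur v hab, Function.update_self]
      omega
    · rw [up v hva] at hv ⊢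
      obtain ⟨u, hu1, hu2, hu3⟩ := h.parent v hv
      refine ⟨u, hu1, by rw [hu2], ?_⟩
      have hvb : v ≠ b := by
        rintro rfl
        exact hv ((h.zero_iff v).2 hb)
      rw [ur v hvb]
      exact hu3.trans_le (ur' u)
  · intro v
    by_cases hr : root v = a
    · simp [hr, hb]
    · simp [hr, h.root_root]
  · intro v
    by_cases hvb : v = b
    · subst hvb
      simp [hb]
    · rw [ur v hvb]
      refine (h.rank_le v).trans ?_
      split_ifs with hr
      · rw [hr, Function.update_self]; omega
      · exact ur' _
  · intro v hv
    have hva : v ≠ a := by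
      rintro rfl
      rw [if_pos ha] at hv
      exact hab hv.symm
    have hrv : root v = v := by
      rw [← h.zero_iff, ← up v hva, hz, hv]
    by_cases hvb : v = b
    · subst hvb
      have h1 := h.size a ha
      have h2 := h.size v hrv
      have hsplit : (univ.filter fun u => (if root u = a then v else root u) = v) =
          (univ.filter fun u => root u = a) ∪ univ.filter fun u => root u = v := by
        ext u
        simp only [mem_filter, mem_univ, true_and, mem_union]
        split_ifs with hr <;> simp [hr]
      rw [hsplit, card_union_of_disjoint, Function.update_self]
      · rcases Nat.lt_or_ge (rk a) (rk v) with hlt | hge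
        · rw [Nat.sub_eq_zero_of_le hlt, add_zero]
          omega
        · have heq : rk a = rk v := le_antisymm hrk hge
          rw [heq, Nat.add_sub_cancel_left, pow_succ]
          rw [heq] at h1
          omega
      · rw [disjoint_filter]
        intro u _ h1 h2
        exact hva (h2.symm.trans h1)
    · rw [ur v hvb]
      refine (h.size v hrv).trans (card_le_card fun u hu => ?_)
      simp only [mem_filter, mem_univ, true_and] at hu ⊢
      rw [hu, if_neg hva]
  · refine (card_le_card (t := insert a (univ.filter fun u => root u ≠ u)) ?_).trans
      ((card_insert_le _ _).trans (Nat.succ_le_succ h.nonroot))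
    intro u hu
    simp only [mem_filter, mem_univ, true_and, mem_insert] at hu ⊢
    by_cases hua : u = a
    · exact Or.inl hua
    · right
      intro hr
      rw [hr, if_neg hua] at hu
      exact hu rfl

/-- Ranks increase strictly along parents and are largest at the root, so the difference of ranks
bounds the number of steps and serves as the variant. -/
theorem ensures_findRoot {root : Fin n → Fin n} {k : ℕ}
    (h : UnionFind (M.nat 8) (M.nat 9) root k) {a : ℕ} (ha : a ≠ 8) {u : Fin n}
    (hu : M.nat a 0 = u) (hN : M.nat 9 (root u) - M.nat 9 u < N) :
    Ensures ((findRoot a).run N M) fun M' t =>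
      M'.nat a 0 = root u ∧ t ≤ 20 * (M.nat 9 (root u) - M.nat 9 u) + 10 := by
  set d := M.nat 9 (root u) - M.nat 9 u with hd
  have := ensures_repeatWhile
    (b := fun M' => (Test.neg (.natEq (.get 8 (.var a)) (.const 0))).eval M')
    (tc := 1 + (Test.neg (.natEq (.get 8 (.var a)) (.const 0))).cost)
    (body := (Prog.assign a (.sub (.get 8 (.var a)) (.const 1))).run N)
    (I := fun k M' t => ∃ c : Fin n, M'.nat a 0 = c ∧ root c = root u ∧
      M.nat 9 (root u) ≤ M.nat 9 c + k ∧ M'.nat 8 = M.nat 8 ∧ k ≤ d ∧ t ≤ 20 * (d - k))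
    (Q := fun M' t => M'.nat a 0 = root u ∧ t ≤ 20 * d + 10)
    ?_ ?_ d N M 0 hN ⟨u, hu, rfl, by omega, rfl, le_rfl, by omega⟩
  · refine this.mono fun M' t h => ?_
    rwa [zero_add] at h
  · rintro k M' t ⟨c, hc, hroot, hrk, h8, hkd, ht⟩ hb
    have hp : M.nat 8 c ≠ 0 := by
      intro h0
      simp [Test.eval, NExp.eval, hc, h8, h0] at hb
    obtain ⟨c', hc', hroot', hrk'⟩ := h.parent c hp
    have hle := h.rank_le c'
    rw [hroot', hroot] at hle
    refine ⟨k - 1, by omega, Ensures.setNat ⟨c', ?_, hroot'.trans hroot, by omega, ?_, by omega,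
      ?_⟩⟩
    · simp [NExp.eval, hc, h8, hc']
    · simp [ha.symm, h8]
    · simp only [Test.cost, NExp.cost]
      omega
  · rintro k M' t ⟨c, hc, hroot, hrk, h8, hkd, ht⟩ hb
    have hp : M.nat 8 c = 0 := by
      simpa [Test.eval, NExp.eval, hc, h8] using hb
    rw [h.zero_iff, hroot] at hp
    refine ⟨by rw [hc, hp], ?_⟩
    simp only [Test.cost, NExp.cost]
    omega

theorem ensures_attach {root : Fin n → Fin n} {k : ℕ} (h : UnionFind (M.nat 8) (M.nat 9) root k)
    {a b : ℕ} (ha : a ≠ 8) (hb : b ≠ 8) {u v : Fin n}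
    (hau : M.nat a 0 = u) (hbv : M.nat b 0 = v) (hu : root u = u) (hv : root v = v) (huv : u ≠ v)
    (hrk : M.nat 9 u ≤ M.nat 9 v) :
    Ensures ((attach a b).run N M) fun M' t =>
      UnionFind (M'.nat 8) (M'.nat 9) (fun x => if root x = u then v else root x) (k + 1) ∧
      t ≤ 30 := by
  refine Ensures.seq (P := fun M' t => M' = M.setNat 8 u (v + 1) ∧ t = 7)
    (Ensures.setNat ⟨by simp [NExp.eval, hau, hbv], rfl⟩) ?_
  rintro M' t - ⟨rfl, rfl⟩
  refine Ensures.setNat ⟨?_, by simp [NExp.cost]⟩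
  have := h.link hu hv huv hrk
  simpa [NExp.eval, ha, hb, hau, hbv] using this

/-- The memory `M` contains a union-find structure for the edges in `A` that are less than `j`. -/
def HasComponents (G : Multigraph n m) (q : ℕ) (A : Fin m → Bool) (j : ℕ) (root : Fin n → Fin n)
    (M : Mem) : Prop :=
  UnionFind (M.nat 8) (M.nat 9) root j ∧
    (∀ e : Fin m, (e : ℕ) < j → A e = true → root (G.src e) = root (G.tgt e)) ∧
    ∀ σ ∈ G.compatible (Fin q) A, ∀ v, σ (root v) = σ v

/-- Connectedness of a vertex to its root is encoded without paths: compatible colourings agree on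
both. Linking keeps this true because the open edge `j` forces equal colours on the two roots. -/
theorem ensures_unite {A : Fin m → Bool} {j : Fin m} {root : Fin n → Fin n}
    (hM : HasInput S w δ M) (h12 : M.nat 12 0 = j) (hA : A j = true)
    (h : HasComponents G q A j root M) {D : ℕ} (hD : m ≤ 2 ^ D) (hN : D < N) :
    Ensures (unite.run N M) fun M' t =>
      (∃ root', HasComponents G q A (j + 1) root' M') ∧ t ≤ 100 * (D + 1) := by
  obtain ⟨huf, hA', hσ⟩ := h
  have hrank := huf.rank_root_le (D := D) (by have := j.2; omega)
  refine Ensures.seq (P := fun M' t => M'.nat 18 0 = G.src j ∧ t = 5)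
    (Ensures.setNat ⟨by simp [NExp.eval, h12, hM.src], rfl⟩) ?_
  rintro M₁ t₁ hF₁ ⟨h1, rfl⟩
  have huf₁ : UnionFind (M₁.nat 8) (M₁.nat 9) root j := by
    rwa [hF₁.nat 8 rfl, hF₁.nat 9 rfl]
  have h91 : M₁.nat 9 = M.nat 9 := hF₁.nat 9 rfl
  refine Ensures.seq (ensures_findRoot huf₁ (by norm_num) h1 ?_) ?_
  · have := hrank (G.src j)
    rw [h91]
    omega
  rintro M₂ t₂ hF₂ ⟨h2, ht₂⟩
  have huf₂ : UnionFind (M₂.nat 8) (M₂.nat 9) root j := by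
    rwa [hF₂.nat 8 rfl, hF₂.nat 9 rfl]
  have h92 : M₂.nat 9 = M.nat 9 := (hF₂.nat 9 rfl).trans h91
  have h12' : M₂.nat 12 0 = j := by rw [hF₂.nat 12 rfl, hF₁.nat 12 rfl, h12]
  have htgt : M₂.nat 2 j = G.tgt j := by rw [hF₂.nat 2 rfl, hF₁.nat 2 rfl, hM.tgt]
  refine Ensures.seq (P := fun M' t => M'.nat 19 0 = G.tgt j ∧ t = 5)
    (Ensures.setNat ⟨by simp [NExp.eval, h12', htgt], rfl⟩) ?_
  rintro M₃ t₃ hF₃ ⟨h3, rfl⟩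
  have huf₃ : UnionFind (M₃.nat 8) (M₃.nat 9) root j := by
    rwa [hF₃.nat 8 rfl, hF₃.nat 9 rfl]
  have h93 : M₃.nat 9 = M.nat 9 := (hF₃.nat 9 rfl).trans h92
  refine Ensures.seq (ensures_findRoot huf₃ (by norm_num) h3 ?_) ?_
  · have := hrank (G.tgt j)
    rw [h93]
    omega
  rintro M₄ t₄ hF₄ ⟨h4, ht₄⟩
  have huf₄ : UnionFind (M₄.nat 8) (M₄.nat 9) root j := by
    rwa [hF₄.nat 8 rfl, hF₄.nat 9 rfl]
  have h94 : M₄.nat 9 = M.nat 9 := (hF₄.nat 9 rfl).trans h93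
  have h4' : M₄.nat 18 0 = root (G.src j) := by rw [hF₄.nat 18 rfl, hF₃.nat 18 rfl, h2]
  have hr1 := hrank (G.src j)
  have hr2 := hrank (G.tgt j)
  rw [h91] at ht₂
  rw [h93] at ht₄
  have hlink : ∀ {u v : Fin n}, (u = root (G.src j) ∧ v = root (G.tgt j) ∨
      u = root (G.tgt j) ∧ v = root (G.src j)) →
      (∀ e : Fin m, (e : ℕ) < j + 1 → A e = true →
        (if root (G.src e) = u then v else root (G.src e)) =
          if root (G.tgt e) = u then v else root (G.tgt e)) ∧
      ∀ σ ∈ G.compatible (Fin q) A, ∀ x, σ (if root x = u then v else root x) = σ x := by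
    intro u v huv
    constructor
    · intro e he hAe
      rcases Nat.lt_succ_iff_lt_or_eq.1 he with he | he
      · rw [hA' e he hAe]
      · obtain rfl : e = j := Fin.ext he
        rcases huv with ⟨rfl, rfl⟩ | ⟨rfl, rfl⟩ <;> split_ifs <;> simp_all
    · intro σ hσA x
      have hj := (mem_filter.1 hσA).2 j hA
      rw [← hσ σ hσA (G.src j), ← hσ σ hσA (G.tgt j)] at hj
      split_ifs with hx
      · rw [← hσ σ hσA x, hx]
        rcases huv with ⟨rfl, rfl⟩ | ⟨rfl, rfl⟩
        · exact hj.symm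
        · exact hj
      · exact hσ σ hσA x
  refine Ensures.branch (fun hb => ?_) (fun hb => ?_)
  · simp only [Test.natEq_eq_true, NExp.eval, h4, h4'] at hb
    refine Ensures.skip ⟨⟨root, huf₄.mono (Nat.le_succ _), ?_, hσ⟩, ?_⟩
    · intro e he hAe
      rcases Nat.lt_succ_iff_lt_or_eq.1 he with he | he
      · exact hA' e he hAe
      · obtain rfl : e = j := Fin.ext he
        exact Fin.ext hb
    · simp only [Test.cost, NExp.cost]
      omega
  · simp only [Test.natEq_eq_false, NExp.eval, h4, h4'] at hb
    have hne : root (G.src j) ≠ root (G.tgt j) := fun h => hb (congrArg Fin.val h)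
    refine Ensures.branch (fun hb' => ?_) (fun hb' => ?_)
    · simp only [Test.natLt_eq_true, NExp.eval, h4, h4'] at hb'
      refine (ensures_attach huf₄ (by norm_num) (by norm_num) h4' h4
        (huf₄.root_root _) (huf₄.root_root _) hne hb'.le).mono ?_
      rintro M₅ t₅ ⟨h5, ht₅⟩
      refine ⟨⟨_, h5, hlink (Or.inl ⟨rfl, rfl⟩)⟩, ?_⟩
      simp only [Test.cost, NExp.cost]
      omega
    · simp only [Test.natLt_eq_false, NExp.eval, h4, h4'] at hb'
      refine (ensures_attach huf₄ (by norm_num) (by norm_num) h4 h4'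
        (huf₄.root_root _) (huf₄.root_root _) hne.symm hb').mono ?_
      rintro M₅ t₅ ⟨h5, ht₅⟩
      refine ⟨⟨_, h5, hlink (Or.inr ⟨rfl, rfl⟩)⟩, ?_⟩
      simp only [Test.cost, NExp.cost]
      omega

theorem ensures_components {A : Fin m → Bool} (hM : HasInput S w δ M) (hA : HasEdges A M)
    (h8 : M.nat 8 = fun _ => 0) (h9 : M.nat 9 = fun _ => 0) {D : ℕ} (hD : m ≤ 2 ^ D) (hN : D < N)
    (hmN : m < N) :
    Ensures (components.run N M) fun M' t =>
      (∃ root, HasComponents G q A m root M') ∧ t ≤ 200 * (D + 1) * m + 20 := by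
  refine (ensures_forLoop m (fun j M' => ∃ root, HasComponents G q A j root M')
    (fun _ => 100 * (D + 1) + 10) rfl hmN (fun j M' z h => by simpa [HasComponents] using h)
    (fun M' hF => ?_) ?_ ?_).mono ?_
  · rw [NExp.eval, NExp.eval, hF.nat 0 rfl, hM.numEdge]
  · refine ⟨id, ⟨fun v => by simp [h8], fun v hv => absurd (by simp [h8]) hv, fun _ => rfl,
      fun _ => le_rfl, fun v _ => ?_, by simp⟩, fun e he => absurd he (Nat.not_lt_zero _),
      fun _ _ _ => rfl⟩
    rw [h9, pow_zero]
    exact card_pos.2 ⟨v, by simp⟩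
  · rintro j hj M' hF h12 ⟨root, hroot⟩
    have hM' := hM.frame hF (fun a ha => by interval_cases a <;> rfl) rfl
    have h11 : M'.nat 11 j = if A ⟨j, hj⟩ = true then 1 else 0 := by
      rw [hF.nat 11 rfl]
      exact hA ⟨j, hj⟩
    refine Ensures.branch (fun hb => ?_) (fun hb => ?_)
    · simp only [Test.natEq_eq_true, NExp.eval, h12, h11] at hb
      have hAj : A ⟨j, hj⟩ = true := by
        by_contra hcon
        simp [hcon] at hb
      refine (ensures_unite (j := ⟨j, hj⟩) hM' h12 hAj hroot hD hN).mono ?_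
      rintro M'' t ⟨h1, h2⟩
      refine ⟨h1, ?_⟩
      simp only [Test.cost, NExp.cost]
      omega
    · simp only [Test.natEq_eq_false, NExp.eval, h12, h11] at hb
      have hAj : A ⟨j, hj⟩ ≠ true := by
        intro hcon
        simp [hcon] at hb
      refine Ensures.skip ⟨⟨root, hroot.1.mono (Nat.le_succ _), ?_, hroot.2.2⟩, ?_⟩
      · intro e he hAe
        rcases Nat.lt_succ_iff_lt_or_eq.1 he with he | he
        · exact hroot.2.1 e he hAe
        · obtain rfl : e = ⟨j, hj⟩ := Fin.ext he
          exact absurd hAe hAj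
      · simp only [Test.cost, NExp.cost]
        omega
  · rintro M' t ⟨h1, h2⟩
    refine ⟨h1, h2.trans ?_⟩
    simp only [NExp.cost, sum_const, card_range, smul_eq_mul]
    nlinarith

/-! #### Colours -/

/-- The uniform distribution on `Fin q`. -/
noncomputable def uniformColour (q : ℕ) [NeZero q] : PMF (Fin q) :=
  proportional (fun _ => 1) fun _ => one_pos

theorem refines_drawColours [NeZero q] (hM : HasInput S w δ M) (hones : ∀ i < q, M.real 1 i = 1)
    (hN : n < N) :
    Refines ((drawColours q).run N M) (productPMF (fun _ : Fin n => uniformColour q) fun _ => 0)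
      fun g M' t => (∀ v : Fin n, M'.nat 10 v = g v) ∧ t ≤ 50 * (n + 1) := by
  refine (refines_forLoop n (k := fillKernel fun _ => uniformColour q)
    (fun j g M' => ∀ v : Fin n, (v : ℕ) < j → M'.nat 10 v = g v)
    (fun _ => 20) (fun _ => 0) rfl hN (fun j A M' z h => by simpa using h) (fun M' hF => ?_)
    (by simp) ?_).mono ?_
  · rw [NExp.eval, NExp.eval, hF.nat 0 rfl, hM.numVert]
  · intro j hj g M' hF h12 hI
    rw [fillKernel, dif_pos hj]
    refine Refines.map (refines_sample (Fin.val : Fin q → ℕ) Fin.val_injective lt_iff_exists_fin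
      (fun _ => one_pos) fun i => ?_) _ ?_
    · rw [hF.real 1 rfl]
      exact hones i i.2
    · rintro b M'' t ⟨rfl, rfl⟩
      refine ⟨fun v hv => ?_, by simp [NExp.cost]⟩
      have : (NExp.var 12).eval M' = j := h12
      rw [this]
      rcases Nat.lt_succ_iff_lt_or_eq.1 hv with hv | hv
      · have hne : v ≠ ⟨j, hj⟩ := fun h => hv.ne (congrArg Fin.val h)
        rw [Function.update_of_ne hne]
        simp [Function.update_of_ne hv.ne, hI v hv]
      · obtain rfl : v = ⟨j, hj⟩ := Fin.ext hv
        simp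
  · rintro g M' t - ⟨h1, h2⟩
    refine ⟨fun v => h1 v v.2, ?_⟩
    simp only [NExp.cost, sum_const, card_range, smul_eq_mul] at h2
    omega

/-- The shift by `τ - σ` is a measure preserving bijection from the colour assignments that induce
`σ` to those that induce `τ`. So all compatible colourings are equally likely, and no others occur.
-/
theorem map_comp_root_eq_uniform [NeZero q] {A : Fin m → Bool} {root : Fin n → Fin n}
    (hroot : ∀ e, A e = true → root (G.src e) = root (G.tgt e))
    (hσ : ∀ σ ∈ G.compatible (Fin q) A, ∀ v, σ (root v) = σ v) :
    (productPMF (fun _ : Fin n => uniformColour q) fun _ => 0).map (fun g v => g (root v)) =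
      uniformCompatible G q A := by
  classical
  set p := productPMF (fun _ : Fin n => uniformColour q) fun _ => 0
  have hconst : ∀ g g', p g = p g' := by
    intro g g'
    simp only [p, productPMF_apply, uniformColour, proportional_apply]
  have hmem : ∀ g : Fin n → Fin q, (fun v => g (root v)) ∈ G.compatible (Fin q) A := by
    intro g
    rw [Multigraph.compatible, mem_filter]
    exact ⟨mem_univ _, fun e he => by simp only [hroot e he]⟩
  have happ : ∀ σ, p.map (fun g v => g (root v)) σ =
      ∑ g, if σ = fun v => g (root v) then p g else 0 := by
    intro σ
    rw [PMF.map_apply, tsum_fintype]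
    exact sum_congr rfl fun g _ => by congr
  have heq : ∀ σ ∈ G.compatible (Fin q) A, ∀ τ ∈ G.compatible (Fin q) A,
      p.map (fun g v => g (root v)) σ = p.map (fun g v => g (root v)) τ := by
    intro σ h1 τ h2
    rw [happ, happ, ← Equiv.sum_comp (Equiv.addRight (τ - σ)) fun g =>
      if τ = fun v => g (root v) then p g else 0]
    refine sum_congr rfl fun g _ => ?_
    rw [hconst (Equiv.addRight (τ - σ) g) g]
    congr 1
    rw [eq_iff_iff, funext_iff, funext_iff]
    refine forall_congr' fun v => ?_
    simp only [Equiv.coe_addRight, Pi.add_apply, Pi.sub_apply, hσ σ h1 v, hσ τ h2 v]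
    constructor
    · intro h; rw [← h]; abel
    · intro h
      have : g (root v) = τ v - (τ v - σ v) := by rw [eq_sub_iff_add_eq, ← h]
      rw [this]; abel
  ext σ
  rw [uniformCompatible, PMF.uniformOfFinset_apply]
  split_ifs with h
  · refine ENNReal.eq_inv_of_mul_eq_one_left ?_
    have hsum : ∑ τ ∈ G.compatible (Fin q) A, p.map (fun g v => g (root v)) τ = 1 := by
      rw [← (p.map fun g v => g (root v)).tsum_coe, tsum_fintype]
      refine sum_subset (subset_univ _) fun τ _ hτ => ?_
      rw [happ]
      refine sum_eq_zero fun g _ => if_neg ?_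
      rintro rfl
      exact hτ (hmem g)
    rw [sum_congr rfl fun τ hτ => heq τ hτ σ h, sum_const, nsmul_eq_mul] at hsum
    rw [mul_comm, hsum]
  · rw [happ]
    refine sum_eq_zero fun g _ => if_neg ?_
    rintro rfl
    exact h (hmem g)

/-- A root is found in constant time and only the at most `k` non-roots cost up to `D` steps. This
gives a bound of order `n + D * k` instead of `n * D`, and is the purpose of the field `nonroot`. -/
theorem ensures_copyColours {root : Fin n → Fin n} {k D : ℕ} (hM : HasInput S w δ M)
    (huf : UnionFind (M.nat 8) (M.nat 9) root k) (hD : k + 1 ≤ 2 ^ D) (hN : D < N) (hnN : n < N)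
    {g : Fin n → Fin q} (hg : ∀ v : Fin n, M.nat 10 v = g v) :
    Ensures (copyColours.run N M) fun M' t =>
      Encodes M' (fun v => g (root v)) ∧ t ≤ 60 * (n + 1) + 20 * D * k := by
  have hrank := huf.rank_root_le hD
  refine (ensures_forLoop n (fun j M' => ∀ v : Fin n, (v : ℕ) < j → M'.nat 6 v = g (root v))
    (fun j => if h : j < n then 20 * (if root ⟨j, h⟩ ≠ ⟨j, h⟩ then D else 0) + 30 else 0) rfl hnN
    (fun j M' z h => by simpa using h) (fun M' hF => ?_) (by simp) ?_).mono ?_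
  · rw [NExp.eval, NExp.eval, hF.nat 0 rfl, hM.numVert]
  · intro j hj M' hF h12 hI
    set v : Fin n := ⟨j, hj⟩ with hv
    have h9' : M'.nat 9 = M.nat 9 := hF.nat 9 rfl
    have huf' : UnionFind (M'.nat 8) (M'.nat 9) root k := by rwa [h9', hF.nat 8 rfl]
    refine Ensures.seq (P := fun M'' t => M''.nat 18 0 = v ∧ t = 4)
      (Ensures.setNat ⟨by simp [NExp.eval, h12, hv], rfl⟩) ?_
    rintro M₁ t₁ hF₁ ⟨h1, rfl⟩
    have h91 : M₁.nat 9 = M.nat 9 := (hF₁.nat 9 rfl).trans h9'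
    have huf₁ : UnionFind (M₁.nat 8) (M₁.nat 9) root k := by
      rwa [hF₁.nat 8 rfl, hF₁.nat 9 rfl]
    have hdepth : M.nat 9 (root v) - M.nat 9 v ≤ if root v ≠ v then D else 0 := by
      have := hrank v
      split_ifs with h
      · omega
      · rw [not_not] at h; rw [h]; simp
    refine Ensures.seq (ensures_findRoot huf₁ (by norm_num) h1 ?_) ?_
    · have := hrank v
      rw [h91]
      omega
    rintro M₂ t₂ hF₂ ⟨h2, ht₂⟩
    rw [h91] at ht₂
    refine Ensures.setNat ⟨?_, ?_⟩
    · have e1 : (NExp.var 12).eval M₂ = j := by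
        rw [NExp.eval, NExp.eval, hF₂.nat 12 rfl, hF₁.nat 12 rfl, h12]
      have e2 : (NExp.get 10 (.var 18)).eval M₂ = g (root v) := by
        rw [NExp.eval, NExp.eval, NExp.eval, h2, hF₂.nat 10 rfl, hF₁.nat 10 rfl, hF.nat 10 rfl, hg]
      rw [e1, e2]
      intro u hu
      rcases Nat.lt_succ_iff_lt_or_eq.1 hu with hu | hu
      · have h6 : M₂.nat 6 = M'.nat 6 := by rw [hF₂.nat 6 rfl, hF₁.nat 6 rfl]
        simp [Function.update_of_ne hu.ne, h6, hI u hu]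
      · obtain rfl : u = v := Fin.ext hu
        simp [hv]
    · rw [dif_pos hj]
      change _ ≤ 20 * (if root v ≠ v then D else 0) + 30
      simp only [NExp.cost]
      omega
  · rintro M' t ⟨h1, h2⟩
    refine ⟨fun v => h1 v v.2, h2.trans ?_⟩
    have hsum : ∑ j ∈ range n, (if h : j < n then
        20 * (if root ⟨j, h⟩ ≠ ⟨j, h⟩ then D else 0) + 30 else 0) =
        20 * ((univ.filter fun v => root v ≠ v).card * D) + n * 30 := by
      rw [sum_range]
      simp only [Fin.is_lt, dite_true, Fin.eta]
      rw [sum_add_distrib, ← mul_sum, ← sum_filter, sum_const, sum_const, card_univ,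
        Fintype.card_fin, smul_eq_mul, smul_eq_mul]
    rw [sum_add_distrib, hsum]
    have := Nat.mul_le_mul_right D huf.nonroot
    simp only [NExp.cost, sum_const, card_range, smul_eq_mul]
    nlinarith

end Specs

end RAM

namespace RAM

open Prog

/-! ### Assembly of the sampler, number of steps and running time -/

section Sampler

variable {n m r q : ℕ} {G : Multigraph n m}

/-- A bound on the running time of the sampler. -/
def timeBound (q a n m r l L : ℕ) : ℕ :=
  30 * (r + q + 1) + (3 * a + 40) * (L + 1) + (600 * (q + l + 1) * (a * r * (L + 1)) + 20) +
    -- The final summand `l` is not running time: it makes the bound exceed the size of every member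
    -- even if no heat bath step is made, as the loop rules demand.
    50 * (m + 1) + (200 * (L + 1) * m + 20) + 50 * (n + 1) + (60 * (n + 1) + 20 * L * m) + l

theorem refines_pottsSampler [NeZero q] (S : EvenGeneratingSet G r) {w y δ : ℝ} (hw : 1 < w)
    (hy : y = (w + (q - 1)) / (w - 1)) (hy0 : 0 < y) (a : ℕ) {l L : ℕ}
    (hl : ∀ i, (S.C i).card ≤ l) (hL : ∀ k < L, δ * 2 ^ k < m) (hL' : m ≤ δ * 2 ^ L)
    (hm : m + 1 ≤ 2 ^ L) {N : ℕ} (hN : timeBound q a n m r l L ≤ N) :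
    Refines ((pottsSampler q a).run N (input G S w δ))
      ((iterKernel (fun _ => glauber S hy0) 0 (a * r * (L + 1)) (0 : Fin m → ZMod q)).bind
        (colourLaw G hw))
      fun σ M' t => Encodes M' σ ∧ t ≤ timeBound q a n m r l L := by
  set K := a * r * (L + 1) with hK
  have hB := hN
  -- These comparisons make every iteration count smaller than the time bound, so that no loop is
  -- cut off.
  have hKle : K ≤ 600 * (q + l + 1) * K := Nat.le_mul_of_pos_left _ (by omega)
  have hmL : m ≤ (L + 1) * m := Nat.le_mul_of_pos_left _ (by omega)
  have hLa : L + 1 ≤ (3 * a + 40) * (L + 1) := Nat.le_mul_of_pos_left _ (by omega)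
  rw [timeBound, ← hK] at hN
  have h0 := hasInput_input S w δ
  refine Ensures.seq_refines (ensures_initOnes (q := q) h0 (by omega)) ?_
  rintro M₁ t₁ hF₁ ⟨h1, ht₁⟩
  have hM₁ := h0.frame hF₁ (fun a ha => by interval_cases a <;> rfl) rfl
  refine Ensures.seq_refines (ensures_countSteps hM₁ a L hL hL' (by omega)) ?_
  rintro M₂ t₂ hF₂ ⟨h2, ht₂⟩
  have hM₂ := hM₁.frame hF₂ (fun a ha => by interval_cases a <;> rfl) rfl
  have hones₂ : ∀ i < r + q, M₂.real 1 i = 1 := fun i hi => by rw [hF₂.real 1 rfl, h1 i hi]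
  have hflow₂ : HasFlow (0 : Fin m → ZMod q) M₂ := fun e => by
    rw [hF₂.nat 7 rfl, hF₁.nat 7 rfl]
    simp [input]
  refine Refines.seq (refines_runChain hy hy0 hl hM₂ hflow₂ (fun i hi => hones₂ i (by omega))
    (by omega) (by omega) h2 (by omega) (fun h => ?_)) ?_
  · refine Nat.pos_of_ne_zero fun hr => ?_
    rw [hK, hr, mul_zero, zero_mul] at h
    exact lt_irrefl 0 h
  rintro f M₃ t₃ hF₃ ⟨h3, ht₃⟩
  have hM₃ := hM₂.frame hF₃ (fun a ha => by interval_cases a <;> rfl) rfl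
  refine Refines.seq (refines_openEdges hw hM₃ h3 (by omega)) ?_
  rintro A M₄ t₄ hF₄ ⟨h4, ht₄⟩
  have hM₄ := hM₃.frame hF₄ (fun a ha => by interval_cases a <;> rfl) rfl
  refine Ensures.seq_refines (ensures_components (q := q) hM₄ h4 ?_ ?_ (D := L) (by omega)
    (by omega) (by omega)) ?_
  · rw [hF₄.nat 8 rfl, hF₃.nat 8 rfl, hF₂.nat 8 rfl, hF₁.nat 8 rfl]
    rfl
  · rw [hF₄.nat 9 rfl, hF₃.nat 9 rfl, hF₂.nat 9 rfl, hF₁.nat 9 rfl]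
    rfl
  rintro M₅ t₅ hF₅ ⟨⟨root, huf, hroot, hσ⟩, ht₅⟩
  have hM₅ := hM₄.frame hF₅ (fun a ha => by interval_cases a <;> rfl) rfl
  have hones₅ : ∀ i < q, M₅.real 1 i = 1 := fun i hi => by
    rw [hF₅.real 1 rfl, hF₄.real 1 rfl, hF₃.real 1 rfl, hones₂ i (by omega)]
  rw [← map_comp_root_eq_uniform (fun e => hroot e e.2) hσ, ← PMF.bind_pure_comp]
  refine Refines.seq (refines_drawColours hM₅ hones₅ (by omega)) ?_
  rintro g M₆ t₆ hF₆ ⟨h6, ht₆⟩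
  have hM₆ := hM₅.frame hF₆ (fun a ha => by interval_cases a <;> rfl) rfl
  rw [← hF₆.nat 8 rfl, ← hF₆.nat 9 rfl] at huf
  refine Ensures.to_refines _ ((ensures_copyColours hM₆ huf hm (by omega) (by omega) h6).mono ?_)
  rintro M₇ t₇ ⟨h7, ht₇⟩
  refine ⟨h7, ?_⟩
  rw [timeBound, ← hK]
  omega

/-- The number of doublings that take `δ` to at least `m`. -/
theorem exists_doublings (m : ℕ) {δ : ℝ} (h0 : 0 < δ) (h1 : δ < 1) :
    ∃ L : ℕ, (∀ k < L, δ * 2 ^ k < m) ∧ m ≤ δ * 2 ^ L ∧ m + 1 ≤ 2 ^ L ∧ (m = 0 → L = 0) ∧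
      (1 ≤ m → (L : ℝ) ≤ 2 * Real.log (m / δ) + 1) := by
  classical
  have hex : ∃ L : ℕ, (m : ℝ) ≤ δ * 2 ^ L := by
    obtain ⟨L, hL⟩ := pow_unbounded_of_one_lt ((m : ℝ) / δ) one_lt_two
    exact ⟨L, by rw [div_lt_iff₀ h0] at hL; linarith⟩
  have hmin : ∀ k < Nat.find hex, δ * 2 ^ k < m := fun k hk => not_le.1 (Nat.find_min hex hk)
  have hspec := Nat.find_spec hex
  refine ⟨Nat.find hex, hmin, hspec, ?_, ?_, ?_⟩
  -- Since `δ < 1`, the same `L` also bounds the ranks in the union-find structure.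
  · have : (m : ℝ) < 2 ^ Nat.find hex := by
      refine hspec.trans_lt ?_
      have : (0 : ℝ) < 2 ^ Nat.find hex := by positivity
      nlinarith
    exact_mod_cast this
  · rintro rfl
    rw [Nat.find_eq_zero]
    simp [h0.le]
  · intro hm
    generalize Nat.find hex = L at hmin
    have hm' : (1 : ℝ) ≤ m := by exact_mod_cast hm
    have hmd : 1 ≤ (m : ℝ) / δ := by rw [le_div_iff₀ h0]; linarith
    cases L with
    | zero =>
      have := Real.log_nonneg hmd
      push_cast
      linarith
    | succ L =>
      have hlt := hmin L (Nat.lt_succ_self L)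
      have h2 : (2 : ℝ) ^ L ≤ m / δ := by rw [le_div_iff₀ h0]; linarith
      have h3 := Real.log_le_log (by positivity) h2
      rw [Real.log_pow] at h3
      -- The penultimate doubling is still too small, and the factor `2` exceeds `1 / log 2`.
      have h4 := Real.log_two_gt_d9
      have h5 : (0 : ℝ) ≤ L := Nat.cast_nonneg L
      push_cast
      nlinarith

/-- A block of `a * r` steps gains the factor `exp (-c a) ≤ 1 / (κ + 2)`. Of the `L + 1` blocks, `L`
are used as halvings and turn `m` into at most `δ`; the last absorbs the factor `κ` from `r ≤ κ m`.
-/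
theorem mul_pow_le_of_steps {a r m κ L : ℕ} {c δ : ℝ} (hc1 : c ≤ 1)
    (ha : (κ + 1 : ℝ) ≤ c * a) (hr : r ≤ κ * m) (hL : m ≤ δ * 2 ^ L) (hδ : 0 < δ) :
    (r : ℝ) * (1 - c / r) ^ (a * r * (L + 1)) ≤ δ := by
  rcases Nat.eq_zero_or_pos r with rfl | hrpos
  · simpa using hδ.le
  have hr1 : (1 : ℝ) ≤ r := by exact_mod_cast hrpos
  have hr0 : (r : ℝ) ≠ 0 := by linarith
  have h0 : 0 ≤ 1 - c / r := sub_nonneg.2 (div_le_one_of_le₀ (hc1.trans hr1) (by linarith))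
  have h1 : 1 - c / r ≤ Real.exp (-(c / r)) := by
    have := Real.add_one_le_exp (-(c / r))
    linarith
  have h2 : (1 - c / r) ^ (a * r * (L + 1)) ≤ Real.exp (-(c * a)) ^ (L + 1) := by
    refine (pow_le_pow_left₀ h0 h1 _).trans (le_of_eq ?_)
    rw [← Real.exp_nat_mul, ← Real.exp_nat_mul]
    congr 1
    push_cast
    field_simp
  have h3 : Real.exp (-(c * a)) ≤ 1 / (κ + 2) := by
    rw [Real.exp_neg, ← one_div]
    refine one_div_le_one_div_of_le (by positivity) ?_
    have := Real.add_one_le_exp (c * a)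
    linarith
  have hκ : (0 : ℝ) ≤ κ := Nat.cast_nonneg κ
  have h4 : Real.exp (-(c * a)) ^ (L + 1) ≤ (1 / 2) ^ L * (1 / (κ + 2)) := by
    rw [pow_succ]
    refine mul_le_mul (pow_le_pow_left₀ (Real.exp_nonneg _) (h3.trans ?_) L) h3
      (Real.exp_nonneg _) (by positivity)
    exact one_div_le_one_div_of_le (by norm_num) (by linarith)
  have hr' : (r : ℝ) ≤ κ * m := by exact_mod_cast hr
  calc (r : ℝ) * (1 - c / r) ^ (a * r * (L + 1))
      ≤ r * ((1 / 2) ^ L * (1 / (κ + 2))) :=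
        mul_le_mul_of_nonneg_left (h2.trans h4) (by linarith)
    _ ≤ κ * (δ * 2 ^ L) * ((1 / 2) ^ L * (1 / (κ + 2))) := by
        refine mul_le_mul_of_nonneg_right (hr'.trans ?_) (by positivity)
        exact mul_le_mul_of_nonneg_left hL hκ
    _ = δ * (κ / (κ + 2)) := by
        rw [one_div_pow]
        field_simp
    _ ≤ δ := by
        refine mul_le_of_le_one_right hδ.le (div_le_one_of_le₀ (by linarith) (by positivity))

/-- A constant for the running time. -/
def timeConst (q a κ : ℕ) : ℕ := 1000 * (q + 1) * (a + 1) * (κ + 1)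

theorem timeBound_le {q a n m r l L κ : ℕ} (hr : r ≤ κ * m) :
    timeBound q a n m r l L ≤
      timeConst q a κ * (1 + n + l + L + m * (l + 1) * (L + 1)) := by
  set W := m * (l + 1) * (L + 1) with hW
  have hC : timeConst q a κ = 1000 * (1 + q + a + κ + q * a + q * κ + a * κ + q * a * κ) := by
    rw [timeConst]; ring
  have e1 : m ≤ W := by
    rw [hW, mul_assoc]; exact Nat.le_mul_of_pos_right _ (by positivity)
  have e2 : (L + 1) * m ≤ W := by
    rw [hW, mul_right_comm, mul_comm (L + 1)]; exact Nat.le_mul_of_pos_right _ (by positivity)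
  have e3 : (l + 1) * (m * (L + 1)) = W := by rw [hW]; ring
  have e4 : r ≤ κ * W := hr.trans (Nat.mul_le_mul_left κ e1)
  have e5 : (q + l + 1) * (a * r * (L + 1)) ≤ (q + 1) * a * κ * W := by
    calc (q + l + 1) * (a * r * (L + 1)) ≤ ((q + 1) * (l + 1)) * (a * (κ * m) * (L + 1)) := by
          refine Nat.mul_le_mul (by nlinarith) ?_
          exact Nat.mul_le_mul_right _ (Nat.mul_le_mul_left a hr)
      _ = (q + 1) * a * κ * ((l + 1) * (m * (L + 1))) := by ring
      _ = (q + 1) * a * κ * W := by rw [e3]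
  have e6 : L * m ≤ W := le_trans (by nlinarith) e2
  rw [timeBound, hC]
  nlinarith [Nat.zero_le (q * n), Nat.zero_le (q * l), Nat.zero_le (q * L), Nat.zero_le (q * W),
    Nat.zero_le (a * n), Nat.zero_le (a * l), Nat.zero_le (a * W), Nat.zero_le (κ * n),
    Nat.zero_le (κ * l), Nat.zero_le (κ * L), Nat.zero_le (a * L), Nat.zero_le κ,
    Nat.zero_le (q * a * (1 + n + l + L + W)), Nat.zero_le (q * κ * (1 + n + l + L + W)),
    Nat.zero_le (a * κ * (1 + n + l + L)), Nat.zero_le (q * a * κ * (1 + n + l + L))]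

/-- The sampler works whenever the dynamics contracts. -/
theorem samples_pottsSampler [NeZero q] {w c : ℝ} (hw : 1 < w) (hc1 : c ≤ 1)
    {a κ : ℕ} (ha : (κ + 1 : ℝ) ≤ c * a) (S : EvenGeneratingSet G r) (hr : r ≤ κ * m)
    (hc : ∀ j, ∑ i ∈ univ.erase j,
      FlowChain.theta ((w - 1) / (w + (q - 1))) (S.C i ∩ S.C j).card ≤ 1 - c)
    {l : ℕ} (hl : ∀ i, (S.C i).card ≤ l) {δ : ℝ} (h0 : 0 < δ) (h1 : δ < 1) :
    ∃ T : ℕ, Samples (pottsSampler q a) (input G S w δ) T (G.potts q w) δ ∧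
      (m = 0 → (T : ℝ) ≤ timeConst q a κ * (1 + n + l)) ∧
      (1 ≤ m → (T : ℝ) ≤ timeConst q a κ *
        (1 + n + 6 * (m * (l + 1)) * (Real.log (m / δ) + 1))) := by
  obtain ⟨L, hL, hL', hm, hm0, hLog⟩ := exists_doublings m h0 h1
  have hq : (1 : ℝ) ≤ q := by exact_mod_cast NeZero.one_le
  have hy0 : 0 < (w + (q - 1)) / (w - 1) := div_pos (by linarith) (by linarith)
  have hT : (timeBound q a n m r l L : ℝ) ≤
      timeConst q a κ * (1 + n + l + L + m * (l + 1) * (L + 1)) := by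
    exact_mod_cast timeBound_le hr
  refine ⟨timeBound q a n m r l L, ?_, ?_, ?_⟩
  · refine samples_of_refines (refines_pottsSampler S hw rfl hy0 a hl hL hL' hm le_rfl) ?_
    refine ideal_sampler_tv S hw rfl hy0 hc1 ?_ _ (mul_pow_le_of_steps hc1 ha hr hL' h0)
    rwa [inv_div]
  · intro h
    rw [hm0 h] at hT ⊢
    subst h
    simpa using hT
  · intro h
    refine hT.trans (mul_le_mul_of_nonneg_left ?_ (Nat.cast_nonneg _))
    have hL2 := hLog h
    have hm' : (1 : ℝ) ≤ m := by exact_mod_cast h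
    have hl0 : (0 : ℝ) ≤ l := Nat.cast_nonneg l
    have hL0 : (0 : ℝ) ≤ L := Nat.cast_nonneg L
    have hW1 : (l : ℝ) + 1 ≤ m * (l + 1) := by nlinarith
    set W : ℝ := m * (l + 1)
    have hW : 1 ≤ W := by linarith
    nlinarith

end Sampler

/-- The running time in terms of a bound `ρ * p` on the work of a sweep over the edges. -/
theorem time_le_of_bounds {n m l l₀ C T : ℕ} {δ ρ p : ℝ} (h0 : 0 < δ) (h1 : δ < 1) (hρ : 0 ≤ ρ)
    (hp0 : 0 ≤ p) (hp : (m : ℝ) * (l + 1) ≤ ρ * p) (hl : m ≤ 1 → l ≤ l₀)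
    (hT0 : m = 0 → (T : ℝ) ≤ C * (1 + n + l))
    (hT1 : 1 ≤ m → (T : ℝ) ≤ C * (1 + n + 6 * (m * (l + 1)) * (Real.log (m / δ) + 1))) :
    (T : ℝ) ≤ C * (24 * ρ + 6 * l₀ + 7) * (1 + n + p * Real.log (m / δ)) ∧
    (2 ≤ m → n ≤ 2 * m →
      (T : ℝ) ≤ C * (24 * ρ + 6 * l₀ + 7) * (p * Real.log (m / δ))) := by
  have hC : (0 : ℝ) ≤ C := Nat.cast_nonneg C
  have hn : (0 : ℝ) ≤ n := Nat.cast_nonneg n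
  have hl0 : (0 : ℝ) ≤ l₀ := Nat.cast_nonneg l₀
  have hln : (0 : ℝ) ≤ l := Nat.cast_nonneg l
  rcases Nat.eq_zero_or_pos m with rfl | hm
  · refine ⟨(hT0 rfl).trans ?_, fun h => by omega⟩
    have : (l : ℝ) ≤ l₀ := by exact_mod_cast hl (by omega)
    rw [mul_assoc (C : ℝ)]
    refine mul_le_mul_of_nonneg_left ?_ hC
    simp only [Nat.cast_zero, zero_div, Real.log_zero, mul_zero, add_zero]
    nlinarith [mul_nonneg hρ hn, mul_nonneg hl0 hn]
  have hm1 : (1 : ℝ) ≤ m := by exact_mod_cast hm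
  have hmd : (m : ℝ) ≤ m / δ := by rw [le_div_iff₀ h0]; nlinarith
  set X := Real.log (m / δ) with hX
  have hX0 : 0 ≤ X := Real.log_nonneg (hm1.trans hmd)
  have hT := hT1 hm
  set W : ℝ := m * (l + 1) with hW
  have hWm : (m : ℝ) ≤ W := by rw [hW]; nlinarith
  have hWX : W * X ≤ ρ * (p * X) := by
    rw [← mul_assoc]; exact mul_le_mul_of_nonneg_right hp hX0
  have hpX : 0 ≤ p * X := mul_nonneg hp0 hX0
  have hlX : 0 ≤ (l₀ : ℝ) * (p * X) := mul_nonneg hl0 hpX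
  have hρX : 0 ≤ ρ * (p * X) := mul_nonneg hρ hpX
  rcases Nat.lt_or_ge m 2 with hm2 | hm2
  · refine ⟨hT.trans ?_, fun h => by omega⟩
    -- For `m = 1` the logarithm can be arbitrarily small, so the terms without it must be absorbed
    -- by `1 + n`; this requires the separate bound `l₀`.
    have hll : (l : ℝ) ≤ l₀ := by exact_mod_cast hl (by omega)
    have hm3 : (m : ℝ) = 1 := by
      have : m = 1 := by omega
      rw [this, Nat.cast_one]
    have hW2 : W ≤ l₀ + 1 := by rw [hW, hm3]; linarith
    rw [mul_assoc (C : ℝ)]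
    refine mul_le_mul_of_nonneg_left ?_ hC
    nlinarith [mul_nonneg hρ hn, mul_nonneg hl0 hn]
  · have hm3 : (2 : ℝ) ≤ m := by exact_mod_cast hm2
    -- From `m ≥ 2` on, the logarithm is bounded below and absorbs the additive terms.
    have hX2 : 1 / 2 ≤ X := by
      have h2 := Real.log_two_gt_d9
      have h3 := Real.log_le_log zero_lt_two (hm3.trans hmd)
      linarith
    have hW0 : 0 ≤ W := by linarith
    have hWX2 : W ≤ 2 * (W * X) := by nlinarith
    constructor
    · refine hT.trans ?_
      rw [mul_assoc (C : ℝ)]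
      refine mul_le_mul_of_nonneg_left ?_ hC
      nlinarith [mul_nonneg hρ hn, mul_nonneg hl0 hn]
    · intro _ hnm
      have hnm' : (n : ℝ) ≤ 2 * m := by exact_mod_cast hnm
      refine hT.trans ?_
      rw [mul_assoc (C : ℝ)]
      refine mul_le_mul_of_nonneg_left ?_ hC
      nlinarith

end RAM

/-! ### Bounds from the parameters of the generating set and the two thresholds for the weight -/

namespace Multigraph

theorem NoIsolatedVertex.le_two_mul {n m : ℕ} {G : Multigraph n m} (h : G.NoIsolatedVertex) :
    n ≤ 2 * m := by
  have h1 : (univ : Finset (Fin n)) ⊆ univ.image G.src ∪ univ.image G.tgt := by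
    intro v _
    obtain ⟨e, he | he⟩ := h v
    · exact mem_union_left _ (mem_image.2 ⟨e, mem_univ e, he⟩)
    · exact mem_union_right _ (mem_image.2 ⟨e, mem_univ e, he⟩)
  have h2 := (card_le_card h1).trans (card_union_le _ _)
  have h3 := card_image_le (s := univ) (f := G.src)
  have h4 := card_image_le (s := univ) (f := G.tgt)
  simp only [card_univ, Fintype.card_fin] at h2 h3 h4
  omega

end Multigraph

namespace EvenGeneratingSet

variable {n m r : ℕ} {G : Multigraph n m}

theorem card_inter_le_iota (S : EvenGeneratingSet G r) {i j : Fin r} (h : i ≠ j) :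
    (S.C i ∩ S.C j).card ≤ S.iota :=
  le_sup (f := fun p : Fin r × Fin r => (S.C p.1 ∩ S.C p.2).card) (b := (i, j))
    (mem_filter.2 ⟨mem_univ _, h⟩)

theorem card_neighbours_le_d (S : EvenGeneratingSet G r) (j : Fin r) :
    (univ.filter fun i : Fin r => i ≠ j ∧ (S.C j ∩ S.C i).Nonempty).card ≤ S.d :=
  le_sup (f := fun i : Fin r =>
    (univ.filter fun j : Fin r => j ≠ i ∧ (S.C i ∩ S.C j).Nonempty).card) (mem_univ j)

theorem card_le_ell (S : EvenGeneratingSet G r) (i : Fin r) : (S.C i).card ≤ S.ell :=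
  le_sup (f := fun i : Fin r => (S.C i).card) (mem_univ i)

theorem card_containing_le_s (S : EvenGeneratingSet G r) (e : Fin m) :
    (univ.filter fun i : Fin r => e ∈ S.C i).card ≤ S.s :=
  le_sup (f := fun e : Fin m => (univ.filter fun i : Fin r => e ∈ S.C i).card) (mem_univ e)

/-- Disjoint members contribute `theta x 0 = 0`, so at most `d` terms remain. -/
theorem sum_theta_le_of_d_iota (S : EvenGeneratingSet G r) {x : ℝ} (hx : 0 ≤ x) (hx1 : x ≤ 1)
    {d ι : ℕ} (hd : S.d ≤ d) (hι : S.iota ≤ ι) (j : Fin r) :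
    ∑ i ∈ univ.erase j, FlowChain.theta x (S.C i ∩ S.C j).card ≤ d * FlowChain.theta x ι := by
  have h1 : ∑ i ∈ univ.filter (fun i : Fin r => i ≠ j ∧ (S.C j ∩ S.C i).Nonempty),
      FlowChain.theta x (S.C i ∩ S.C j).card =
      ∑ i ∈ univ.erase j, FlowChain.theta x (S.C i ∩ S.C j).card := by
    refine sum_subset (fun i hi => mem_erase.2 ⟨(mem_filter.1 hi).2.1, mem_univ i⟩) ?_
    intro i hi hi'
    have : ¬ (S.C j ∩ S.C i).Nonempty := fun h =>
      hi' (mem_filter.2 ⟨mem_univ i, (mem_erase.1 hi).1, h⟩)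
    rw [not_nonempty_iff_eq_empty, inter_comm] at this
    rw [this, card_empty, FlowChain.theta_zero]
  rw [← h1]
  refine (sum_le_card_nsmul _ _ (FlowChain.theta x ι) fun i hi => ?_).trans ?_
  · exact FlowChain.theta_mono hx hx1
      ((S.card_inter_le_iota (mem_filter.1 hi).2.1).trans hι)
  · rw [nsmul_eq_mul]
    refine mul_le_mul_of_nonneg_right ?_ (FlowChain.theta_nonneg hx hx1 ι)
    exact_mod_cast (S.card_neighbours_le_d j).trans hd

/-- Double counting: every edge of `C j` lies in at most `s - 1` other members. -/
theorem sum_card_inter_le (S : EvenGeneratingSet G r) {l s : ℕ} (hl : S.ell ≤ l) (hs : S.s ≤ s)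
    (j : Fin r) : ∑ i ∈ univ.erase j, (S.C i ∩ S.C j).card ≤ l * (s - 1) := by
  have h1 : ∀ i, (S.C i ∩ S.C j).card = ∑ e ∈ S.C j, if e ∈ S.C i then 1 else 0 := by
    intro i
    rw [inter_comm, ← filter_mem_eq_inter, card_filter]
  simp only [h1]
  rw [sum_comm]
  refine (sum_le_card_nsmul _ _ (s - 1) fun e he => ?_).trans ?_
  · rw [← card_filter]
    have h2 : (univ.erase j).filter (fun i => e ∈ S.C i) =
        (univ.filter fun i => e ∈ S.C i).erase j := by
      ext i; simp
    rw [h2, card_erase_of_mem (by simpa using he)]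
    exact Nat.sub_le_sub_right ((S.card_containing_le_s e).trans hs) 1
  · rw [smul_eq_mul]
    exact Nat.mul_le_mul_right _ ((S.card_le_ell j).trans hl)

theorem sum_theta_le_of_ell_s (S : EvenGeneratingSet G r) {x : ℝ} (hx : 0 ≤ x) (hx1 : x ≤ 1)
    {l s : ℕ} (hl : S.ell ≤ l) (hs : S.s ≤ s) (j : Fin r) :
    ∑ i ∈ univ.erase j, FlowChain.theta x (S.C i ∩ S.C j).card ≤
      (l * (s - 1) : ℕ) * FlowChain.theta x 1 := by
  refine (sum_le_sum fun i _ => FlowChain.theta_le_mul hx hx1 _).trans ?_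
  rw [← sum_mul, ← Nat.cast_sum]
  refine mul_le_mul_of_nonneg_right ?_ (FlowChain.theta_nonneg hx hx1 1)
  exact_mod_cast S.sum_card_inter_le hl hs j

end EvenGeneratingSet

/-- With `x = 1 - u`, `u = q / (w + q - 1)`, the claim is `d - 1 < (d + 1) x ^ ι`. Bernoulli gives
`x ^ ι ≥ 1 - ι u`, and the hypothesis on `w` says exactly `(d + 1) ι u < 2`. -/
theorem d_mul_theta_lt_one {q w : ℝ} {d ι : ℕ} (hq : 2 ≤ q) (hd : 2 ≤ d) (hι : 1 ≤ ι)
    (hw : ((d : ℝ) + 1) * (ι : ℝ) / 2 * q - (q - 1) < w) :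
    1 < w ∧ d * FlowChain.theta ((w - 1) / (w + (q - 1))) ι < 1 := by
  have hd' : (2 : ℝ) ≤ d := by exact_mod_cast hd
  have hι' : (1 : ℝ) ≤ ι := by exact_mod_cast hι
  have hdi : 3 ≤ ((d : ℝ) + 1) * ι := by nlinarith
  have hw1 : 1 < w := by nlinarith
  refine ⟨hw1, ?_⟩
  set u : ℝ := q / (w + (q - 1)) with hu
  have hden : 0 < w + (q - 1) := by linarith
  have hx : (w - 1) / (w + (q - 1)) = 1 + -u := by
    rw [hu]; field_simp; ring
  have hu0 : 0 ≤ u := div_nonneg (by linarith) hden.le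
  have hu1 : u ≤ 1 := (div_le_one hden).2 (by linarith)
  have hu2 : ((d : ℝ) + 1) * (ι * u) < 2 := by
    rw [hu, ← mul_div_assoc, ← mul_div_assoc, div_lt_iff₀ hden]
    linarith
  have hb := one_add_mul_le_pow (a := -u) (by linarith) ι
  rw [hx, FlowChain.theta]
  have hpos : 0 ≤ (1 + -u) ^ ι := pow_nonneg (by linarith) _
  generalize (1 + -u) ^ ι = z at hb hpos
  rw [← mul_div_assoc, div_lt_one (by linarith)]
  nlinarith

/-- Here `theta x 1 = q / (2 w + q - 2)`, so `l (s - 1) q < 2 w + q - 2` is required; it follows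
from the bound on `w` because `2 (q - 1) ≥ q`. -/
theorem mul_theta_one_lt_one {q w : ℝ} {l s : ℕ} (hq : 2 ≤ q) (hl : 3 ≤ l) (hs : 2 ≤ s)
    (hw : (q - 1) * ((l : ℝ) * (s : ℝ) - 1) < w) :
    1 < w ∧ (l * (s - 1) : ℕ) * FlowChain.theta ((w - 1) / (w + (q - 1))) 1 < 1 := by
  have hl' : (3 : ℝ) ≤ l := by exact_mod_cast hl
  have hs' : (2 : ℝ) ≤ s := by exact_mod_cast hs
  have hls : 6 ≤ (l : ℝ) * s := by nlinarith
  have hw1 : 1 < w := by nlinarith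
  refine ⟨hw1, ?_⟩
  have hden : 0 < w + (q - 1) := by linarith
  have hx : FlowChain.theta ((w - 1) / (w + (q - 1))) 1 = q / (2 * w + q - 2) := by
    rw [FlowChain.theta, pow_one, one_sub_div hden.ne', one_add_div hden.ne',
      div_div_div_cancel_right₀ hden.ne']
    congr 1 <;> ring
  rw [hx, Nat.cast_mul, Nat.cast_sub (by omega), Nat.cast_one, ← mul_div_assoc,
    div_lt_one (by linarith)]
  nlinarith

theorem theorem1 (q : ℕ) (hq : 2 ≤ q) :
    (∀ d ι κ : ℕ, 2 ≤ d → 1 ≤ ι →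
      ∀ w : ℝ, ((d : ℝ) + 1) * (ι : ℝ) / 2 * (q : ℝ) - ((q : ℝ) - 1) < w →
      ∃ (P : RAM.Prog) (K : ℝ),
        ∀ (n m r : ℕ) (G : Multigraph n m) (S : EvenGeneratingSet G r),
          r ≤ κ * m → S.d ≤ d → S.iota ≤ ι →
          ∀ δ : ℝ, 0 < δ → δ < 1 →
          ∃ T : ℕ,
            RAM.Samples P (RAM.input G S w δ) T (G.potts q w) δ ∧
            (T : ℝ) ≤ K * (1 + (n : ℝ) + (m : ℝ) ^ 2 * Real.log ((m : ℝ) / δ)) ∧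
            (2 ≤ m → G.NoIsolatedVertex →
              (T : ℝ) ≤ K * ((m : ℝ) ^ 2 * Real.log ((m : ℝ) / δ)))) ∧
    (∀ ℓ s κ : ℕ, 3 ≤ ℓ → 2 ≤ s →
      ∀ w : ℝ, ((q : ℝ) - 1) * ((ℓ : ℝ) * (s : ℝ) - 1) < w →
      ∃ (P : RAM.Prog) (K : ℝ),
        ∀ (n m r : ℕ) (G : Multigraph n m) (S : EvenGeneratingSet G r),
          r ≤ κ * m → S.ell ≤ ℓ → S.s ≤ s →
          ∀ δ : ℝ, 0 < δ → δ < 1 →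
          ∃ T : ℕ,
            RAM.Samples P (RAM.input G S w δ) T (G.potts q w) δ ∧
            (T : ℝ) ≤ K * (1 + (n : ℝ) + (m : ℝ) * Real.log ((m : ℝ) / δ)) ∧
            (2 ≤ m → G.NoIsolatedVertex →
              (T : ℝ) ≤ K * ((m : ℝ) * Real.log ((m : ℝ) / δ)))) := by
  have hq' : (2 : ℝ) ≤ q := by exact_mod_cast hq
  have : NeZero q := ⟨by omega⟩
  have hx : ∀ w : ℝ, 1 < w → 0 ≤ (w - 1) / (w + (q - 1)) ∧ (w - 1) / (w + (q - 1)) ≤ 1 := by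
    intro w hw
    exact ⟨div_nonneg (by linarith) (by linarith), (div_le_one (by linarith)).2 (by linarith)⟩
  have hsteps : ∀ (κ : ℕ) (c : ℝ), 0 < c → ∃ a : ℕ, (κ + 1 : ℝ) ≤ c * a := by
    intro κ c hc
    obtain ⟨a, ha⟩ := exists_nat_ge ((κ + 1 : ℝ) / c)
    exact ⟨a, by rwa [div_le_iff₀' hc] at ha⟩
  constructor
  · intro d ι κ hd hι w hw
    obtain ⟨hw1, hθ⟩ := d_mul_theta_lt_one hq' hd hι hw
    obtain ⟨hx0, hx1⟩ := hx w hw1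
    -- The gap `c = 1 - d * theta`, and with it `a` and the program, depends on the fixed parameters
    -- only, not on the graph.
    obtain ⟨a, ha⟩ := hsteps κ _ (sub_pos.2 hθ)
    refine ⟨RAM.Prog.pottsSampler q a, RAM.timeConst q a κ * (24 * 2 + 6 * (1 : ℕ) + 7), ?_⟩
    intro n m r G S hr hSd hSι δ h0 h1
    obtain ⟨T, hT, hT0, hT1⟩ := RAM.samples_pottsSampler hw1
      (sub_le_self _ (mul_nonneg (Nat.cast_nonneg d) (FlowChain.theta_nonneg hx0 hx1 ι))) ha S hr
      (fun j => (S.sum_theta_le_of_d_iota hx0 hx1 hSd hSι j).trans (by linarith))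
      (l := m) (fun i => (card_le_univ _).trans (by simp)) h0 h1
    have hmm : (m : ℝ) ≤ (m : ℝ) ^ 2 := by exact_mod_cast Nat.le_self_pow two_ne_zero m
    -- Members are only known to have at most `m` edges, and `m (m + 1) ≤ 2 m ^ 2`.
    have := RAM.time_le_of_bounds (l₀ := 1) (ρ := 2) (p := (m : ℝ) ^ 2) h0 h1 (by norm_num)
      (by positivity) (by nlinarith) (fun h => h) hT0 hT1
    exact ⟨T, hT, this.1, fun hm hG => this.2 hm hG.le_two_mul⟩
  · intro ℓ s κ hℓ hs w hw
    obtain ⟨hw1, hθ⟩ := mul_theta_one_lt_one hq' hℓ hs hw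
    obtain ⟨hx0, hx1⟩ := hx w hw1
    obtain ⟨a, ha⟩ := hsteps κ _ (sub_pos.2 hθ)
    refine ⟨RAM.Prog.pottsSampler q a, RAM.timeConst q a κ * (24 * (ℓ + 1) + 6 * ℓ + 7), ?_⟩
    intro n m r G S hr hSℓ hSs δ h0 h1
    obtain ⟨T, hT, hT0, hT1⟩ := RAM.samples_pottsSampler hw1
      (sub_le_self _ (mul_nonneg (Nat.cast_nonneg _) (FlowChain.theta_nonneg hx0 hx1 1))) ha S hr
      (fun j => (S.sum_theta_le_of_ell_s hx0 hx1 hSℓ hSs j).trans (by linarith))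
      (l := ℓ) (fun i => (S.card_le_ell i).trans hSℓ) h0 h1
    -- Now members have at most `ℓ` edges, so a heat bath step takes bounded time and the bound is
    -- linear in `m` up to the logarithm.
    have := RAM.time_le_of_bounds (l₀ := ℓ) (ρ := (ℓ : ℝ) + 1) (p := m) h0 h1 (by positivity)
      (by positivity) (by rw [mul_comm]) (fun _ => le_rfl) hT0 hT1
    exact ⟨T, hT, this.1, fun hm hG => this.2 hm hG.le_two_mul⟩
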